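/- Let $d\ge 2$, and let $\mathcal S=C^\infty(\mathbb S^{d-1})$ be the smooth complex functions on the unit sphere of $\mathbb R^d$, with the topology generated by the norms $\|(\mathrm{Id}-\Delta)^n h\|_\infty$, $n\in\mathbb N$ ($\Delta$ the Laplace–Beltrami operator). Let $\mathcal S'$ be its topological dual, with bilinear pairing $\langle\cdot|\cdot\rangle$; an integrable function $f$ is identified with the element $\varphi\mapsto\int f\varphi$ of $\mathcal S'$. For each $n\in\mathbb N$ let $Y_n^1,\dots,Y_n^{N_d(n)}$ be an $L^2$-orthonormal basis of the eigenspace of $\Delta$ for the eigenvalue $-n(n+d-2)$. Let $\mathcal D:\mathcal S\to\mathcal S$, $\mathcal Dh=\sum_n \hat D_n\sum_m \hat h_n^m Y_n^m$ with $\hat h_n^m=\int h\,\overline{Y_n^m}$, be a spherical pseudo-differential operator: $\hat D_n\in\mathbb R$, the set $\mathfrak K_{\mathcal D}=\{n:\hat D_n=0\}$ is finite, and $|\hat D_n|=\Theta(n^p)$ for some $p\ge 0$. It acts on $\mathcal S'$ by $\langle\mathcal D u|\varphi\rangle=\langle u|\mathcal D\varphi\rangle$, and likewise its pseudo-inverse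 $\mathcal D^\dagger h=\sum_{n\notin\mathfrak K_{\mathcal D}}\hat D_n^{-1}\sum_m\hat h_n^mY_n^m$. Its zonal Green kernel is $$\psi_{\mathcal D}(t)=\sum_{n\notin\mathfrak K_{\mathcal D}}\frac{N_d(n)}{a_d\,\hat D_n}P_{n,d}(t),$$ where $a_d$ is the area of $\mathbb S^{d-1}$ and $P_{n,d}$ is the $d$-dimensional ultraspherical polynomial of degree $n$ with $P_{n,d}(1)=1$. Assume that $\mathcal D$ is spline-admissible: for every $\mathbf s\in\mathbb S^{d-1}$ the series for $\psi_{\mathcal D}(\langle\mathbf r,\mathbf s\rangle)$ converges at every $\mathbf r\in\mathbb S^{d-1}$, and the Green function $\mathcal D^\dagger\delta_{\mathbf s}\in\mathcal S'$ is an ordinary (integrable) function. Let $\mathbf r_1,\dots,\mathbf r_M\in\mathbb S^{d-1}$. 1. If $\mathfrak s\in\mathcal S'$ and $\alpha_1,\dots,\alpha_M\in\mathbb C$ satisfy $\mathcal D\mathfrak s=\sum_{i=1}^M\alpha_i\delta_{\mathbf r_i}$ (that is, $\mathfrak s$ is a $\mathcal D$-spline with knots $\mathbf r_i$ and amplitudes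 $\alpha_i$), then $\mathfrak s$ is the ordinary integrable function $$\mathfrak s(\mathbf r)=\sum_{i=1}^M\alpha_i\,\psi_{\mathcal D}(\langle\mathbf r,\mathbf r_i\rangle)+\sum_{n\in\mathfrak K_{\mathcal D}}\sum_{m=1}^{N_d(n)}\hat\beta_n^m\,Y_n^m(\mathbf r),\qquad \hat\beta_n^m=\langle\mathfrak s|\overline{Y_n^m}\rangle$$ (so $\hat\beta_n^m=\langle\mathfrak s|Y_n^m\rangle$ when the $Y_n^m$ are real-valued). 2. If $\mathfrak K_{\mathcal D}=\emptyset$, then every such $\mathfrak s$ equals $\sum_{i=1}^M\alpha_i\,\psi_{\mathcal D}(\langle\cdot,\mathbf r_i\rangle)$; the functions $\psi_{\mathcal D}(\langle\cdot,\mathbf r_i\rangle)$ are integrable, and the space of all $\mathcal D$-splines with knots $\mathbf r_1,\dots,\mathbf r_M$ is exactly $\mathrm{span}\{\psi_{\mathcal D}(\langle\cdot,\mathbf r_i\rangle):i=1,\dots,M\}$. If moreover $p>d-1$, these functions lie in $L^2(\mathbb S^{d-1})$. -/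

import Mathlib

open MeasureTheory Filter Topology
open scoped Manifold ContDiff InnerProductSpace

noncomputable section

namespace Spherical

/-! Throughout, `m` is the dimension of the sphere, so the ambient dimension is `d = m + 1`. -/

/-- The ambient Euclidean space `ℝ^d`, `d = m + 1`. -/
abbrev Ambient (m : ℕ) : Type := EuclideanSpace ℝ (Fin (m + 1))

/-- The unit sphere `𝕊^{d-1} ⊂ ℝ^d`, `d = m + 1`. -/
abbrev Sphere (m : ℕ) : Type := Metric.sphere (0 : Ambient m) 1

/-- The surface (Lebesgue) measure of the sphere. -/
def surface (m : ℕ) : Measure (Sphere m) := (volume : Measure (Ambient m)).toSphere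

instance (m : ℕ) : IsFiniteMeasure (surface m) := by
  unfold surface; infer_instance

/-- The total area of the sphere. -/
def area (m : ℕ) : ℝ := (surface m).real Set.univ

/-! ### Smooth functions, the Laplace-Beltrami operator and generalised functions -/

/-- The complex vector space of smooth functions on the sphere, as a subspace of all functions. -/
def smoothSubmodule (m : ℕ) : Submodule ℂ (Sphere m → ℂ) where
  carrier := {h | ContMDiff (𝓡 m) 𝓘(ℝ, ℂ) ∞ h}
  add_mem' ha hb := ContMDiff.add ha hb
  zero_mem' := contMDiff_const
  smul_mem' c _ hf :=
    ((ContinuousLinearMap.mul ℝ ℂ c).contDiff.contMDiff (n := ∞)).comp hf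

/-- The space `C^∞(𝕊^{d-1})` of smooth complex functions (with its own topology, see below). -/
def TestFun (m : ℕ) : Type := smoothSubmodule m

namespace TestFun

variable {m : ℕ}

instance : AddCommGroup (TestFun m) := inferInstanceAs (AddCommGroup (smoothSubmodule m))
instance : Module ℂ (TestFun m) := inferInstanceAs (Module ℂ (smoothSubmodule m))
instance : FunLike (TestFun m) (Sphere m) ℂ where
  coe h := h.1
  coe_injective := Subtype.coe_injective

theorem contMDiff (h : TestFun m) : ContMDiff (𝓡 m) 𝓘(ℝ, ℂ) ∞ (h : Sphere m → ℂ) := h.2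

theorem continuous (h : TestFun m) : Continuous (h : Sphere m → ℂ) := h.contMDiff.continuous

@[ext] theorem ext {g h : TestFun m} (H : ∀ r, g r = h r) : g = h := DFunLike.ext _ _ H

@[simp] theorem add_apply (g h : TestFun m) (r : Sphere m) : (g + h) r = g r + h r := rfl
@[simp] theorem smul_apply (c : ℂ) (h : TestFun m) (r : Sphere m) : (c • h) r = c * h r := rfl

/-- The pointwise complex conjugate of a smooth function. -/
def conjugate (h : TestFun m) : TestFun m :=
  ⟨fun r => starRingEnd ℂ (h r),
    ((Complex.conjCLE : ℂ →L[ℝ] ℂ).contDiff.contMDiff (n := ∞)).comp h.contMDiff⟩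

/-- The extension of a function on the sphere to `ℝ^d ∖ {0}` that is constant along rays
(with value `0` at the origin). -/
def radialExt (h : Sphere m → ℂ) (x : Ambient m) : ℂ :=
  if hx : x = 0 then 0 else
    h ⟨‖x‖⁻¹ • x, by
      rw [mem_sphere_zero_iff_norm, norm_smul, norm_inv, norm_norm,
        inv_mul_cancel₀ (norm_ne_zero_iff.mpr hx)]⟩

theorem contDiffAt_radialExt (h : TestFun m) {x : Ambient m} (hx : x ≠ 0) :
    ContDiffAt ℝ ∞ (radialExt h) x := by
  have : Fact (Module.finrank ℝ (Ambient m) = m + 1) := ⟨finrank_euclideanSpace_fin⟩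
  let U : TopologicalSpace.Opens (Ambient m) := ⟨{0}ᶜ, isOpen_compl_singleton⟩
  have hU : ∀ u : U, (u : Ambient m) ≠ 0 := fun u => u.2
  let f : U → Ambient m := fun u => ‖(u : Ambient m)‖⁻¹ • (u : Ambient m)
  have hf : ContMDiff 𝓘(ℝ, Ambient m) 𝓘(ℝ, Ambient m) ∞ f := by
    intro u
    refine (contMDiffAt_subtype_iff (f := fun y : Ambient m => ‖y‖⁻¹ • y)).mpr ?_
    refine ContDiffAt.contMDiffAt ?_
    exact ((contDiffAt_norm ℝ (hU u)).inv (norm_ne_zero_iff.mpr (hU u))).smul contDiffAt_id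
  have hf' : ∀ u, f u ∈ Metric.sphere (0 : Ambient m) 1 := by
    intro u
    simp only [f]
    rw [mem_sphere_zero_iff_norm, norm_smul, norm_inv, norm_norm,
        inv_mul_cancel₀ (norm_ne_zero_iff.mpr (hU u))]
  have hp := hf.codRestrict_sphere (n := m) hf'
  have hc : ContMDiff 𝓘(ℝ, Ambient m) 𝓘(ℝ, ℂ) ∞ (fun u : U => radialExt h u) := by
    have := h.contMDiff.comp hp
    convert! this using 1
    ext u
    simp only [radialExt, dif_neg (hU u)]
    rfl
  have := hc ⟨x, hx⟩
  rw [contMDiffAt_subtype_iff (f := radialExt (h : Sphere m → ℂ))] at this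
  exact this.contDiffAt

theorem sphere_ne_zero (r : Sphere m) : (r : Ambient m) ≠ 0 := ne_zero_of_mem_unit_sphere r

/-- The Laplace-Beltrami operator of the sphere: the restriction to the sphere of the Euclidean
Laplacian of the extension that is constant along rays. -/
def laplaceBeltrami : TestFun m →ₗ[ℂ] TestFun m where
  toFun h := ⟨fun r => (Laplacian.laplacian (radialExt h) : Ambient m → ℂ) r, by
    have : Fact (Module.finrank ℝ (Ambient m) = m + 1) := ⟨finrank_euclideanSpace_fin⟩
    intro r
    have h1 : ContDiffAt ℝ ∞ (Laplacian.laplacian (radialExt h) : Ambient m → ℂ) r := by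
      rw [InnerProductSpace.laplacian_eq_iteratedFDeriv_stdOrthonormalBasis]
      refine ContDiffAt.sum fun i _ => ?_
      have h2 : ContDiffAt ℝ ∞ (iteratedFDeriv ℝ 2 (radialExt h)) (r : Ambient m) :=
        (h.contDiffAt_radialExt (sphere_ne_zero r)).iteratedFDeriv_right (i := 2) (by norm_cast)
      exact ((ContinuousMultilinearMap.apply ℝ (fun _ : Fin 2 => Ambient m) ℂ
        _).contDiff.contDiffAt).comp _ h2
    exact h1.contMDiffAt.comp r (contMDiff_coe_sphere (n := m) r)⟩
  map_add' g h := by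
    ext r
    have e : radialExt (g + h : TestFun m) = radialExt (g : Sphere m → ℂ) + radialExt h := by
      ext x; by_cases hx : x = 0 <;> simp [radialExt, hx]
    change (Laplacian.laplacian (radialExt (g + h : TestFun m)) : Ambient m → ℂ) r = _
    rw [e, ((g.contDiffAt_radialExt (sphere_ne_zero r)).of_le (by norm_cast)).laplacian_add
      ((h.contDiffAt_radialExt (sphere_ne_zero r)).of_le (by norm_cast))]
    rfl
  map_smul' c h := by
    ext r
    have e : radialExt (c • h : TestFun m) = c • radialExt (h : Sphere m → ℂ) := by
      ext x; by_cases hx : x = 0 <;> simp [radialExt, hx]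
    change (Laplacian.laplacian (radialExt (c • h : TestFun m)) : Ambient m → ℂ) r = _
    rw [e, InnerProductSpace.laplacian_smul c
      ((h.contDiffAt_radialExt (sphere_ne_zero r)).of_le (by norm_cast))]
    rfl

/-- Smooth functions as continuous functions. -/
def toContₗ : TestFun m →ₗ[ℂ] C(Sphere m, ℂ) where
  toFun h := ⟨h, h.continuous⟩
  map_add' _ _ := rfl
  map_smul' _ _ := rfl

/-- The norms `‖h‖_{n,∞} = ‖(Id - Δ)^n h‖_∞`. -/
def seminormFamily (m : ℕ) : SeminormFamily ℂ (TestFun m) ℕ := fun n =>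
  (normSeminorm ℂ C(Sphere m, ℂ)).comp
    (toContₗ.comp ((LinearMap.id - laplaceBeltrami : TestFun m →ₗ[ℂ] TestFun m) ^ n))

/-- The topology of `C^∞(𝕊^{d-1})` generated by the norms `‖·‖_{n,∞}`. -/
instance : TopologicalSpace (TestFun m) := (seminormFamily m).moduleFilterBasis.topology

theorem withSeminorms (m : ℕ) : WithSeminorms (seminormFamily m) := ⟨rfl⟩

instance : IsTopologicalAddGroup (TestFun m) := (withSeminorms m).topologicalAddGroup
instance : ContinuousSMul ℂ (TestFun m) := (withSeminorms m).continuousSMul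

/-- The continuous inclusion of smooth functions into continuous functions. -/
def toCont : TestFun m →L[ℂ] C(Sphere m, ℂ) where
  toLinearMap := toContₗ
  cont := by
    refine WithSeminorms.continuous_of_continuous_comp
      (norm_withSeminorms ℂ C(Sphere m, ℂ)) toContₗ fun _ => ?_
    exact (withSeminorms m).continuous_seminorm 0

end TestFun

/-- Generalised functions: the topological dual of `C^∞(𝕊^{d-1})`. -/
abbrev GenFun (m : ℕ) : Type := TestFun m →L[ℂ] ℂ

variable {m : ℕ}

/-- The Dirac measure at `r`, as a generalised function. -/
def dirac (r : Sphere m) : GenFun m := (ContinuousMap.evalCLM ℂ r).comp TestFun.toCont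

/-- The generalised function `φ ↦ ∫ f φ` induced by an ordinary (integrable) function `f`. -/
def regular (f : Sphere m → ℂ) (hf : Integrable f (surface m)) : GenFun m :=
  (LinearMap.mkContinuous
    { toFun := fun φ : C(Sphere m, ℂ) => ∫ r, f r * φ r ∂(surface m)
      map_add' := fun φ χ => by
        simp only [ContinuousMap.add_apply, mul_add]
        exact integral_add
          (hf.mul_bdd (c := ‖φ‖) φ.continuous.aestronglyMeasurable
            (ae_of_all _ φ.norm_coe_le_norm))
          (hf.mul_bdd (c := ‖χ‖) χ.continuous.aestronglyMeasurable
            (ae_of_all _ χ.norm_coe_le_norm))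
      map_smul' := fun c φ => by
        simp only [ContinuousMap.smul_apply, smul_eq_mul, RingHom.id_apply, mul_left_comm _ c]
        exact integral_const_mul _ _ }
    (∫ r, ‖f r‖ ∂(surface m))
    (fun φ => by
      simp only [LinearMap.coe_mk, AddHom.coe_mk]
      rw [← integral_mul_const]
      refine norm_integral_le_of_norm_le (hf.norm.mul_const _) (ae_of_all _ fun r => ?_)
      rw [norm_mul]
      exact mul_le_mul_of_nonneg_left (φ.norm_coe_le_norm r) (norm_nonneg _))).comp TestFun.toCont

/-! ### Spherical harmonics -/

/-- The space of spherical harmonics of order `n`: the eigenspace of the Laplace-Beltrami operator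
with eigenvalue `-n(n+d-2)`. -/
def Harm (m n : ℕ) : Submodule ℂ (TestFun m) :=
  Module.End.eigenspace (TestFun.laplaceBeltrami : TestFun m →ₗ[ℂ] TestFun m)
    (-((n : ℂ) * ((n : ℂ) + (m : ℂ) - 1)))

/-- The geometric multiplicity `N_d(n)` of the eigenvalue `-n(n+d-2)`. -/
def harmDim (m n : ℕ) : ℕ := Module.finrank ℂ (Harm m n)

/-- The `L²` inner product `∫ f(r) conj(g(r)) dr`. -/
def l2inner (f g : TestFun m) : ℂ := ∫ r, f r * starRingEnd ℂ (g r) ∂(surface m)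

/-- A choice of orthonormal basis `Y_n^1, …, Y_n^{N_d(n)}` of each space of spherical harmonics. -/
structure HarmonicBasis (m : ℕ) where
  Y : ∀ n : ℕ, Fin (harmDim m n) → TestFun m
  orthonormal : ∀ n i j, l2inner (Y n i) (Y n j) = if i = j then 1 else 0
  span_eq : ∀ n, Submodule.span ℂ (Set.range (Y n)) = Harm m n

/-- The component `∑_k ĥ_n^k Y_n^k` of order `n` in the spherical Fourier expansion of `h`, where
`ĥ_n^k = ⟨h, Y_n^k⟩`. -/
def HarmonicBasis.component (B : HarmonicBasis m) (n : ℕ) (h : TestFun m) : TestFun m :=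
  ∑ k, l2inner h (B.Y n k) • B.Y n k

/-- The `d`-dimensional ultraspherical (Legendre) polynomials, `d = m + 1`, normalised by
`P_{n,d}(1) = 1`, through the recurrence
`(n + d - 2) P_{n+1} = (2n + d - 2) t P_n - n P_{n-1}`. -/
def ultraspherical (m : ℕ) : ℕ → ℝ → ℝ
  | 0, _ => 1
  | 1, t => t
  | n + 2, t => ((2 * n + m + 1 : ℝ) * t * ultraspherical m (n + 1) t
      - (n + 1 : ℝ) * ultraspherical m n t) / (n + m : ℝ)

/-! ### Pseudo-differential operators, Green functions and splines -/

/-- A spherical pseudo-differential operator: a linear operator `D` on `C^∞(𝕊^{d-1})` of the form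
`D h = ∑_n D̂_n ∑_k ĥ_n^k Y_n^k`, with real Fourier symbol `D̂` that has finitely many zeros and
satisfies `|D̂_n| = Θ(n^p)` for some `p ≥ 0`. -/
structure PseudoDiffOp (B : HarmonicBasis m) where
  toLin : TestFun m →ₗ[ℂ] TestFun m
  symbol : ℕ → ℝ
  /-- the spectral growth order `p` -/
  order : ℝ
  hasSum : ∀ (h : TestFun m) (r : Sphere m),
    HasSum (fun n => (symbol n : ℂ) * B.component n h r) (toLin h r)
  finite_zeros : {n : ℕ | symbol n = 0}.Finite
  order_nonneg : 0 ≤ order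
  growth : (fun n : ℕ => |symbol n|) =Θ[atTop] (fun n : ℕ => (n : ℝ) ^ order)

namespace PseudoDiffOp

variable {B : HarmonicBasis m} (D : PseudoDiffOp B)

/-- The finite set of zeros of the Fourier symbol. -/
def zeros : Finset ℕ := D.finite_zeros.toFinset

/-- The Moore-Penrose pseudo-inverse `D† h = ∑_{D̂_n ≠ 0} D̂_n⁻¹ ∑_k ĥ_n^k Y_n^k`. -/
def pinv (h : TestFun m) (r : Sphere m) : ℂ :=
  ∑' n, if n ∈ D.zeros then 0 else ((D.symbol n : ℂ))⁻¹ * B.component n h r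

/-- `Ψ` is the Green function `D† δ_s`, i.e. `⟨Ψ|φ⟩ = ⟨δ_s|D† φ⟩` for all smooth `φ`. -/
def IsGreenFunction (s : Sphere m) (Ψ : GenFun m) : Prop :=
  ∀ φ : TestFun m, Ψ φ = D.pinv φ s

/-- Partial sums of the series `∑_{D̂_n ≠ 0} N_d(n) / (area · D̂_n) P_{n,d}(t)`. -/
def greenPartial (N : ℕ) (t : ℝ) : ℝ :=
  ∑ n ∈ Finset.range N, if n ∈ D.zeros then 0 else
    (harmDim m n : ℝ) / (area m * D.symbol n) * ultraspherical m n t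

/-- The zonal Green kernel `ψ_D(t)`: the sum of the series above (where it converges). -/
def greenKernel (t : ℝ) : ℝ := limUnder atTop (fun N => D.greenPartial N t)

/-- The trace `r ↦ ψ_D(⟨r, s⟩)` of the zonal Green kernel. -/
def trace (s r : Sphere m) : ℂ := (D.greenKernel (inner ℝ (r : Ambient m) (s : Ambient m)) : ℝ)

/-- `D` is spline-admissible if the traces of the zonal Green kernel are ordinary, pointwise defined
functions: the series defining `ψ_D(⟨r, s⟩)` converges at every point `r`, and the generalised
function `D† δ_s` is induced by some integrable function. -/
def IsSplineAdmissible : Prop :=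
  ∀ s : Sphere m,
    (∀ r : Sphere m, ∃ l : ℝ,
      Tendsto (fun N => D.greenPartial N (inner ℝ (r : Ambient m) (s : Ambient m))) atTop (𝓝 l)) ∧
    ∃ (f : Sphere m → ℂ) (hf : Integrable f (surface m)), D.IsGreenFunction s (regular f hf)

/-- The extension of `D` to generalised functions, `⟨D u|φ⟩ = ⟨u|D φ⟩`. -/
def dualApply (u : GenFun m) : TestFun m →ₗ[ℂ] ℂ := (u : TestFun m →ₗ[ℂ] ℂ).comp D.toLin

/-- `u` is a `D`-spline with knots `r_i` and amplitudes `α_i`: `D u = ∑ α_i δ_{r_i}`. -/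
def IsSpline {M : ℕ} (r : Fin M → Sphere m) (α : Fin M → ℂ) (u : GenFun m) : Prop :=
  D.dualApply u = ((∑ i, α i • dirac (r i) : GenFun m) : TestFun m →ₗ[ℂ] ℂ)

/-- The linear space of `D`-splines with knots among `r_1, …, r_M`. -/
def splineSpace {M : ℕ} (r : Fin M → Sphere m) : Submodule ℂ (GenFun m) where
  carrier := {u | ∃ α : Fin M → ℂ, D.IsSpline r α u}
  add_mem' := by
    rintro u v ⟨α, hα⟩ ⟨β, hβ⟩
    refine ⟨α + β, ?_⟩
    ext φ
    have h1 := LinearMap.congr_fun hα φ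
    have h2 := LinearMap.congr_fun hβ φ
    simp only [dualApply, LinearMap.comp_apply, ContinuousLinearMap.coe_coe,
      sum_apply, smul_apply] at h1 h2
    simp [dualApply, h1, h2, add_mul, Finset.sum_add_distrib]
  zero_mem' := ⟨0, by ext φ; simp [dualApply]⟩
  smul_mem' := by
    rintro c u ⟨α, hα⟩
    refine ⟨c • α, ?_⟩
    ext φ
    have h1 := LinearMap.congr_fun hα φ
    simp only [dualApply, LinearMap.comp_apply, ContinuousLinearMap.coe_coe,
      sum_apply, smul_apply] at h1
    simp [dualApply, h1, Finset.mul_sum, mul_assoc]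

end PseudoDiffOp

end Spherical

end

/-! Testing `D s = ∑ α_i δ_{r_i}` on a harmonic `φ` of order `n` gives `D̂_n s(φ) = ∑ α_i φ(r_i)`.
If `D̂_n ≠ 0` this fixes `s` on the eigenspace of order `n`, with the values of `∑ α_i D†δ_{r_i}`.
If `D̂_n = 0` it leaves `s` free there, and `s` is recovered from its coefficients in that
finite-dimensional space. The two sides of the formula thus agree on all harmonics, hence as
generalised functions (`genFun_eq_zero`).

The hard point is that `D†δ_s`, assumed to be some integrable `f`, equals `ψ_D(⟨·, s⟩)` almost
everywhere (`ae_eq_trace`): pointwise convergence of the Green series says nothing by itself about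
convergence as generalised functions. Let `F_ε` be the series with weights `(1 + ε λ_n)^{-m}`, where
`λ_n = n(n+d-2)` and `m = d - 1`. The weights decrease in `n` and tend to `1`, so by Abel summation
`F_ε` tends pointwise to `ψ_D` (`tendsto_smoothed`). Also `F_ε` is formally `(Id - εΔ)^{-m} f`, and
these resolvents contract `L¹`, so `F_ε → f` in `L¹` (`tendsto_integral_smoothed_sub`). A
subsequence converges almost everywhere and identifies the limits.

The contraction is dual to a maximum principle for `Id - εΔ` in the sup norm
(`norm_laplace_max_principle`). The same principle orders the norms defining the topology, and with
uniform density of harmonics it gives `genFun_eq_zero`.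

The Legendre series is the Fourier series of `D†δ_s` by the addition theorem (`kernel_eq`): the
reproducing kernel of an eigenspace is rotation invariant, hence zonal, hence a multiple of `P_n`.
The norms of the `P_n` yield `N_d(n) = O(n^{d-2})` (`harmDim_le`), which controls every summability
question. If no `D̂_n` vanishes, then `D†D = Id` on smooth functions, so each trace is itself a
spline; if `p > d - 1`, the Green series converges absolutely and its traces are bounded. -/

noncomputable section

namespace Spherical

variable {m : ℕ}

/-! ### Second derivatives along lines and the Laplacian -/

section Lines

variable {E F : Type*} [NormedAddCommGroup E] [NormedSpace ℝ E]
  [NormedAddCommGroup F] [NormedSpace ℝ F]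

theorem hasDerivAt_comp_line {f : E → F} {x v : E} {t : ℝ} (hf : DifferentiableAt ℝ f (x + t • v)) :
    HasDerivAt (fun t : ℝ => f (x + t • v)) (fderiv ℝ f (x + t • v) v) t := by
  have h1 : HasDerivAt (fun t : ℝ => x + t • v) v t := by
    simpa using ((hasDerivAt_id t).smul_const v).const_add x
  exact hf.hasFDerivAt.comp_hasDerivAt t h1

/-- Every Laplacian below is evaluated through this reduction to one-variable second derivatives
along the vectors of an orthonormal basis. -/
theorem iteratedFDeriv_two_line {f : E → F} {x : E} (hf : ContDiffAt ℝ 2 f x) (v : E) :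
    iteratedFDeriv ℝ 2 f x ![v, v] = deriv (deriv fun t : ℝ => f (x + t • v)) 0 := by
  have hline : Tendsto (fun t : ℝ => x + t • v) (𝓝 0) (𝓝 x) := by
    have : Continuous fun t : ℝ => x + t • v := by fun_prop
    simpa using this.tendsto 0
  have h1 : deriv (fun t : ℝ => f (x + t • v)) =ᶠ[𝓝 0] fun t => fderiv ℝ f (x + t • v) v := by
    filter_upwards [hline.eventually (hf.eventually (by simp))] with t ht
    exact (hasDerivAt_comp_line (ht.differentiableAt (by simp))).deriv
  have h2 : DifferentiableAt ℝ (fderiv ℝ f) (x + (0 : ℝ) • v) := by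
    rw [zero_smul, add_zero]
    exact (hf.fderiv_right (m := 1) (by norm_num)).differentiableAt (by simp)
  have h3 := (hasDerivAt_comp_line h2).clm_apply (hasDerivAt_const (0 : ℝ) v)
  rw [h1.deriv_eq, h3.deriv, iteratedFDeriv_two_apply]
  simp

/-- A positive second derivative would make `a` a local minimum as well; then `g` would be constant
near `a`, with vanishing second derivative. -/
theorem deriv_deriv_nonpos_of_isLocalMax {g : ℝ → ℝ} {a : ℝ} (hg : IsLocalMax g a)
    (hc : ContinuousAt g a) : deriv (deriv g) a ≤ 0 := by
  by_contra! h
  have hmin := isLocalMin_of_deriv_deriv_pos h hg.deriv_eq_zero hc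
  have hconst : g =ᶠ[𝓝 a] fun _ => g a := by
    filter_upwards [hg, hmin] with x h1 h2 using le_antisymm h1 h2
  have : deriv (deriv g) a = 0 := by
    rw [hconst.deriv.deriv_eq]; simp
  exact h.ne' this

end Lines

theorem laplacian_nonpos_of_isLocalMax {f : Ambient m → ℝ} {x : Ambient m}
    (hf : ContDiffAt ℝ 2 f x) (hx : IsLocalMax f x) :
    (Laplacian.laplacian f : Ambient m → ℝ) x ≤ 0 := by
  rw [InnerProductSpace.laplacian_eq_iteratedFDeriv_stdOrthonormalBasis]
  refine Finset.sum_nonpos fun i _ => ?_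
  rw [iteratedFDeriv_two_line hf]
  set v := stdOrthonormalBasis ℝ (Ambient m) i
  have hcont : Continuous fun t : ℝ => x + t • v := by fun_prop
  have hline : Tendsto (fun t : ℝ => x + t • v) (𝓝 0) (𝓝 x) := by
    simpa using hcont.tendsto 0
  refine deriv_deriv_nonpos_of_isLocalMax ?_ ?_
  · have := hline.eventually hx
    simpa [IsLocalMax, IsMaxFilter] using this
  · refine ContinuousAt.comp (g := f) ?_ hcont.continuousAt
    simpa using hf.continuousAt

/-! ### Radial extensions and the maximum principle -/

namespace TestFun

theorem laplaceBeltrami_apply (h : TestFun m) (r : Sphere m) :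
    laplaceBeltrami h r = (Laplacian.laplacian (radialExt h) : Ambient m → ℂ) r := rfl

theorem contDiffAt_two_radialExt (h : TestFun m) {x : Ambient m} (hx : x ≠ 0) :
    ContDiffAt ℝ 2 (radialExt h) x := (h.contDiffAt_radialExt hx).of_le (by norm_cast)

/-- The radial projection onto the sphere. -/
def normalize (x : Ambient m) (hx : x ≠ 0) : Sphere m :=
  ⟨‖x‖⁻¹ • x, by
      rw [mem_sphere_zero_iff_norm, norm_smul, norm_inv, norm_norm,
        inv_mul_cancel₀ (norm_ne_zero_iff.mpr hx)]⟩

theorem radialExt_of_ne (h : Sphere m → ℂ) {x : Ambient m} (hx : x ≠ 0) :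
    radialExt h x = h (normalize x hx) := dif_neg hx

@[simp] theorem radialExt_zero (h : Sphere m → ℂ) : radialExt h 0 = 0 := dif_pos rfl

@[simp] theorem radialExt_coe (h : Sphere m → ℂ) (r : Sphere m) : radialExt h r = h r := by
  rw [radialExt_of_ne h (sphere_ne_zero r)]
  congr 1
  ext1
  simp [normalize]

theorem radialExt_smul (h : Sphere m → ℂ) {c : ℝ} (hc : 0 < c) (x : Ambient m) :
    radialExt h (c • x) = radialExt h x := by
  rcases eq_or_ne x 0 with rfl | hx
  · simp
  · rw [radialExt_of_ne h hx, radialExt_of_ne h (smul_ne_zero hc.ne' hx)]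
    congr 1
    ext1
    simp only [normalize, norm_smul, Real.norm_eq_abs, abs_of_pos hc, smul_smul]
    congr 1
    field_simp

/-- At a maximum point `r₀` of `‖h‖`, multiply by a unimodular `c` making `c h(r₀) = ‖h(r₀)‖`. Then
`Re(c h)` is maximal at `r₀`, so its Laplacian there is nonpositive and subtracting `ε` times it can
only increase the value. -/
theorem norm_laplace_max_principle (h : TestFun m) {ε : ℝ} (hε : 0 ≤ ε) {C : ℝ}
    (hC : ∀ r, ‖h r - ε * laplaceBeltrami h r‖ ≤ C) (r : Sphere m) : ‖h r‖ ≤ C := by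
  obtain ⟨r₀, -, hr₀⟩ := isCompact_univ.exists_isMaxOn ⟨r, Set.mem_univ r⟩
    h.continuous.norm.continuousOn
  have hmax : ∀ q, ‖h q‖ ≤ ‖h r₀‖ := fun q => hr₀ (Set.mem_univ q)
  refine (hmax r).trans ?_
  obtain ⟨c, hc1, hc2⟩ : ∃ c : ℂ, ‖c‖ = 1 ∧ c * h r₀ = (‖h r₀‖ : ℂ) := by
    rcases eq_or_ne (h r₀) 0 with h0 | h0
    · exact ⟨1, by simp, by simp [h0]⟩
    · refine ⟨(‖h r₀‖ : ℂ) / h r₀, by simp [h0], by field_simp⟩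
  let L : ℂ →L[ℝ] ℝ := Complex.reCLM.comp (ContinuousLinearMap.mul ℝ ℂ c)
  have hL : ∀ z, L z = (c * z).re := fun z => rfl
  have hcd := h.contDiffAt_two_radialExt (sphere_ne_zero r₀)
  -- The maximum persists in the ambient space: away from the origin the extension takes only values
  -- of `h`, and at the origin it is `0`.
  have hloc : IsLocalMax (L ∘ radialExt h) (r₀ : Ambient m) := by
    refine Filter.Eventually.of_forall fun x => ?_
    simp only [Function.comp, hL, radialExt_coe, hc2, Complex.ofReal_re]
    refine (Complex.re_le_norm _).trans ?_
    rw [norm_mul, hc1, one_mul]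
    rcases eq_or_ne x 0 with rfl | hx
    · simp
    · rw [radialExt_of_ne _ hx]; exact hmax _
  have hlap := laplacian_nonpos_of_isLocalMax (L.contDiff.contDiffAt.comp _ hcd) hloc
  rw [hcd.laplacian_CLM_comp_left] at hlap
  simp only [Function.comp, hL, ← laplaceBeltrami_apply] at hlap
  have h2 := (Complex.re_le_norm (c * (h r₀ - ε * laplaceBeltrami h r₀)))
  rw [norm_mul, hc1, one_mul, mul_sub, hc2, mul_left_comm, Complex.sub_re, Complex.re_ofReal_mul,
    Complex.ofReal_re] at h2
  have := hC r₀
  nlinarith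

/-- The extension is homogeneous of degree `0`, so its Laplacian is homogeneous of degree `-2`. -/
theorem laplacian_radialExt (h : TestFun m) {x : Ambient m} (hx : x ≠ 0) :
    (Laplacian.laplacian (radialExt h) : Ambient m → ℂ) x =
      ((‖x‖ ^ 2 : ℝ) : ℂ)⁻¹ * radialExt (laplaceBeltrami h) x := by
  have hn : 0 < ‖x‖ := norm_pos_iff.mpr hx
  rw [radialExt_of_ne _ hx, laplaceBeltrami_apply,
    InnerProductSpace.laplacian_eq_iteratedFDeriv_stdOrthonormalBasis, Finset.mul_sum]
  refine Finset.sum_congr rfl fun i _ => ?_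
  rw [iteratedFDeriv_two_line (h.contDiffAt_two_radialExt hx),
    iteratedFDeriv_two_line (h.contDiffAt_two_radialExt (sphere_ne_zero _))]
  set v := stdOrthonormalBasis ℝ (Ambient m) i
  set g : ℝ → ℂ := fun t => radialExt h ((normalize x hx : Ambient m) + t • v)
  have e : (fun t : ℝ => radialExt h (x + t • v)) = fun t => g (‖x‖⁻¹ * t) := by
    ext t
    simp only [g, normalize]
    rw [← radialExt_smul h (inv_pos.mpr hn) (x + t • v), smul_add, smul_smul]
  have e1 : deriv (fun t => g (‖x‖⁻¹ * t)) = fun t => ‖x‖⁻¹ • deriv g (‖x‖⁻¹ * t) := by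
    ext t; exact deriv_comp_mul_left _ _ _
  have e2 : deriv (fun t => ‖x‖⁻¹ • deriv g (‖x‖⁻¹ * t)) 0
      = ‖x‖⁻¹ • ‖x‖⁻¹ • deriv (deriv g) (‖x‖⁻¹ * 0) := by
    rw [← deriv_comp_mul_left (c := ‖x‖⁻¹) (f := deriv g), deriv_fun_const_smul_field]
  rw [e, e1, e2, mul_zero, smul_smul]
  simp [sq]

theorem fderiv_radialExt_self (h : TestFun m) {x : Ambient m} (hx : x ≠ 0) :
    fderiv ℝ (radialExt h) x x = 0 := by
  have h1 : HasDerivAt (fun t : ℝ => radialExt h (x + t • x))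
      (fderiv ℝ (radialExt h) (x + (0 : ℝ) • x) x) 0 := by
    refine hasDerivAt_comp_line ?_
    simpa using (h.contDiffAt_two_radialExt hx).differentiableAt (by simp)
  have h2 : (fun t : ℝ => radialExt h (x + t • x)) =ᶠ[𝓝 0] fun _ => radialExt h x := by
    filter_upwards [eventually_gt_nhds (show (-1 : ℝ) < 0 by norm_num)] with t ht
    rw [show x + t • x = (1 + t) • x by rw [add_smul, one_smul]]
    exact radialExt_smul h (by linarith) x
  simpa using h1.unique ((hasDerivAt_const (0 : ℝ) _).congr_of_eventuallyEq h2)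

@[simp] theorem conjugate_apply (h : TestFun m) (r : Sphere m) :
    h.conjugate r = starRingEnd ℂ (h r) := rfl

theorem laplaceBeltrami_conjugate (h : TestFun m) :
    laplaceBeltrami h.conjugate = (laplaceBeltrami h).conjugate := by
  ext r
  have e : radialExt h.conjugate = (Complex.conjCLE : ℂ →L[ℝ] ℂ) ∘ radialExt h := by
    ext x
    by_cases hx : x = 0
    · simp [hx]
    · simp [radialExt_of_ne _ hx]
  rw [laplaceBeltrami_apply, e,
    (h.contDiffAt_two_radialExt (sphere_ne_zero r)).laplacian_CLM_comp_left]
  rfl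

/-! ### Isometries of the sphere -/

/-- The action of a linear isometry on the sphere. -/
def sphereMap (R : Ambient m ≃ₗᵢ[ℝ] Ambient m) (r : Sphere m) : Sphere m :=
  ⟨R r, by rw [mem_sphere_zero_iff_norm, R.norm_map]; simp⟩

theorem contMDiff_sphereMap (R : Ambient m ≃ₗᵢ[ℝ] Ambient m) :
    ContMDiff (𝓡 m) (𝓡 m) ∞ (sphereMap R) := by
  have : Fact (Module.finrank ℝ (Ambient m) = m + 1) := ⟨finrank_euclideanSpace_fin⟩
  have h1 : ContMDiff (𝓡 m) 𝓘(ℝ, Ambient m) ∞ (fun r : Sphere m => R r) :=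
    R.toContinuousLinearEquiv.contDiff.contMDiff.comp (contMDiff_coe_sphere (n := m))
  exact h1.codRestrict_sphere (n := m) _

/-- Composition of a smooth function with a linear isometry. -/
def compIsometry (h : TestFun m) (R : Ambient m ≃ₗᵢ[ℝ] Ambient m) : TestFun m :=
  ⟨fun r => h (sphereMap R r), h.contMDiff.comp (contMDiff_sphereMap R)⟩

@[simp] theorem compIsometry_apply (h : TestFun m) (R : Ambient m ≃ₗᵢ[ℝ] Ambient m)
    (r : Sphere m) : h.compIsometry R r = h (sphereMap R r) := rfl

theorem radialExt_compIsometry (h : TestFun m) (R : Ambient m ≃ₗᵢ[ℝ] Ambient m) (x : Ambient m) :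
    radialExt (h.compIsometry R) x = radialExt h (R x) := by
  by_cases hx : x = 0
  · simp [hx]
  · rw [radialExt_of_ne _ hx, radialExt_of_ne _ (by simpa using hx : R x ≠ 0), compIsometry_apply]
    congr 1
    ext1
    simp [normalize, sphereMap]

/-- The Euclidean Laplacian may be computed in any orthonormal basis, in particular in the image
under `R` of the standard one. -/
theorem laplaceBeltrami_compIsometry (h : TestFun m) (R : Ambient m ≃ₗᵢ[ℝ] Ambient m) :
    laplaceBeltrami (h.compIsometry R) = (laplaceBeltrami h).compIsometry R := by
  ext r
  rw [laplaceBeltrami_apply, compIsometry_apply, laplaceBeltrami_apply,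
    InnerProductSpace.laplacian_eq_iteratedFDeriv_stdOrthonormalBasis,
    InnerProductSpace.laplacian_eq_iteratedFDeriv_orthonormalBasis _
      ((stdOrthonormalBasis ℝ (Ambient m)).map R)]
  refine Finset.sum_congr rfl fun i _ => ?_
  rw [iteratedFDeriv_two_line ((h.compIsometry R).contDiffAt_two_radialExt (sphere_ne_zero r)),
    iteratedFDeriv_two_line (h.contDiffAt_two_radialExt (sphere_ne_zero _))]
  simp only [radialExt_compIsometry, map_add, map_smul, OrthonormalBasis.map_apply]
  rfl

end TestFun

open scoped Pointwise in
/-- The surface measure is invariant under linear isometries. -/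
theorem measurePreserving_sphereMap (R : Ambient m ≃ₗᵢ[ℝ] Ambient m) :
    MeasurePreserving (TestFun.sphereMap R) (surface m) (surface m) := by
  have hc : Continuous (TestFun.sphereMap R) := (TestFun.contMDiff_sphereMap R).continuous
  refine ⟨hc.measurable, ?_⟩
  ext s hs
  rw [Measure.map_apply hc.measurable hs, surface, Measure.toSphere_apply' _ hs,
    Measure.toSphere_apply' _ (hc.measurable hs)]
  congr 1
  -- The surface measure of a set is a multiple of the volume of the cone over it, and the cone over
  -- the preimage is the preimage of the cone.
  rw [← R.measurePreserving.measure_preimage_emb R.toHomeomorph.measurableEmbedding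
    (Set.Ioo (0 : ℝ) 1 • (Subtype.val '' s))]
  congr 1
  ext x
  simp only [Set.mem_smul, Set.mem_image, Set.mem_preimage]
  constructor
  · rintro ⟨c, hc, _, ⟨q, hq, rfl⟩, rfl⟩
    exact ⟨c, hc, R q, ⟨_, hq, rfl⟩, by simp⟩
  · rintro ⟨c, hc, _, ⟨q, hq, rfl⟩, hx⟩
    have hqq : TestFun.sphereMap R (TestFun.sphereMap R.symm q) = q := by
      ext1; simp [TestFun.sphereMap]
    refine ⟨c, hc, _, ⟨TestFun.sphereMap R.symm q, by rwa [hqq], rfl⟩, ?_⟩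
    apply R.injective
    rw [map_smul]
    simpa [TestFun.sphereMap] using hx

/-! ### Self-adjointness of the Laplace-Beltrami operator -/

open TestFun

/-- Polar coordinates. This transfers integration by parts from Euclidean space to the sphere. -/
theorem integral_norm_mul_radialExt (ψ : ℝ → ℂ) (G : Sphere m → ℂ) :
    ∫ x : Ambient m, ψ ‖x‖ * radialExt G x =
      (∫ r, G r ∂(surface m)) * ∫ y : Set.Ioi (0 : ℝ), ψ y ∂(Measure.volumeIoiPow m) := by
  have hdim : Module.finrank ℝ (Ambient m) - 1 = m := by simp
  calc
    ∫ x : Ambient m, ψ ‖x‖ * radialExt G x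
      = ∫ x : ({(0)}ᶜ : Set (Ambient m)), ψ ‖x.1‖ * radialExt G x.1
          ∂(Measure.comap (↑) (volume : Measure (Ambient m))) := by
      rw [integral_subtype_comap (measurableSet_singleton _).compl
        fun x => ψ ‖x‖ * radialExt G x, restrict_compl_singleton]
    _ = ∫ z : Sphere m × Set.Ioi (0 : ℝ), G z.1 * ψ z.2
          ∂((volume : Measure (Ambient m)).toSphere.prod (Measure.volumeIoiPow m)) := by
      have hmp := (volume : Measure (Ambient m)).measurePreserving_homeomorphUnitSphereProd
      rw [hdim] at hmp
      rw [← hmp.integral_comp (Homeomorph.measurableEmbedding _)]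
      refine integral_congr_ae (ae_of_all _ fun x => ?_)
      simp only [homeomorphUnitSphereProd_apply_snd_coe]
      rw [mul_comm, radialExt_of_ne G x.2]
      congr 2
      ext1
      rw [homeomorphUnitSphereProd_apply_fst_coe]
      rfl
    _ = _ := integral_prod_mul G fun y : Set.Ioi (0 : ℝ) => ψ y

/-- A bump function on the positive reals. -/
def radialBump : ContDiffBump (2 : ℝ) := ⟨1 / 2, 1, by norm_num, by norm_num⟩

/-- A smooth radial cutoff function supported in an annulus. -/
def cutoff (x : Ambient m) : ℝ := radialBump (‖x‖ ^ 2)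

theorem contDiff_cutoff : ContDiff ℝ ∞ (cutoff (m := m)) :=
  radialBump.contDiff.comp (contDiff_norm_sq ℝ)

/-- In the variable `‖x‖ ^ 2` the bump lives on `(1, 3)`, which lies inside the annulus `1 < ‖x‖ <
2`. -/
theorem cutoff_eq_zero {x : Ambient m} (hx : ‖x‖ ≤ 1 ∨ 2 ≤ ‖x‖) : cutoff x = 0 := by
  refine radialBump.zero_of_le_dist ?_
  simp only [radialBump, Real.dist_eq]
  rcases hx with hx | hx
  · have : ‖x‖ ^ 2 ≤ 1 := pow_le_one₀ (norm_nonneg _) hx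
    rw [abs_sub_comm]; exact le_trans (by linarith) (le_abs_self _)
  · have : 4 ≤ ‖x‖ ^ 2 := by nlinarith
    exact le_trans (by linarith) (le_abs_self _)

/-- Radial extensions are singular at the origin; a factor vanishing near it makes the product
continuous with compact support. -/
theorem integrable_mul_of_annulus {P Q : Ambient m → ℂ} (hP : Continuous P)
    (hP0 : ∀ x, ‖x‖ < 1 ∨ 2 < ‖x‖ → P x = 0) (hQ : ∀ x, x ≠ 0 → ContinuousAt Q x) :
    Integrable fun x => P x * Q x := by
  refine Continuous.integrable_of_hasCompactSupport ?_ ?_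
  · rw [continuous_iff_continuousAt]
    intro x
    rcases eq_or_ne x 0 with rfl | hx
    · have : (fun x => P x * Q x) =ᶠ[𝓝 0] fun _ => 0 := by
        filter_upwards [Metric.ball_mem_nhds (0 : Ambient m) one_pos] with y hy
        rw [hP0 y (Or.inl (by simpa using hy)), zero_mul]
      exact continuousAt_const.congr this.symm
    · exact hP.continuousAt.mul (hQ x hx)
  · refine HasCompactSupport.intro (isCompact_closedBall (0 : Ambient m) 2) fun x hx => ?_
    rw [hP0 x (Or.inr (by simpa using hx)), zero_mul]

theorem fderiv_eq_zero_of_annulus {A : Ambient m → ℂ}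
    (hA : ∀ x, ‖x‖ < 1 ∨ 2 < ‖x‖ → A x = 0) (x : Ambient m) (hx : ‖x‖ < 1 ∨ 2 < ‖x‖) :
    fderiv ℝ A x = 0 := by
  have hopen : IsOpen {y : Ambient m | ‖y‖ < 1 ∨ 2 < ‖y‖} :=
    (isOpen_lt continuous_norm continuous_const).union (isOpen_lt continuous_const continuous_norm)
  have : A =ᶠ[𝓝 x] fun _ => 0 := by
    filter_upwards [hopen.mem_nhds hx] with y hy using hA y hy
  rw [this.fderiv_eq]; simp

theorem contDiff_cutoff_mul (f : TestFun m) :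
    ContDiff ℝ ∞ fun x => (cutoff x : ℂ) * radialExt f x := by
  rw [contDiff_iff_contDiffAt]
  intro x
  rcases eq_or_ne x 0 with rfl | hx
  · have : (fun x : Ambient m => (cutoff x : ℂ) * radialExt f x) =ᶠ[𝓝 0] fun _ => 0 := by
      filter_upwards [Metric.ball_mem_nhds (0 : Ambient m) one_pos] with y hy
      rw [cutoff_eq_zero (Or.inl (le_of_lt (by simpa using hy)))]; simp
    exact contDiffAt_const.congr_of_eventuallyEq this
  · exact ((Complex.ofRealCLM.contDiff.comp contDiff_cutoff).contDiffAt).mul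
      (f.contDiffAt_radialExt hx)

theorem fderiv_cutoff (x v : Ambient m) :
    fderiv ℝ cutoff x v = deriv radialBump (‖x‖ ^ 2) * (2 * inner ℝ x v) := by
  have h1 : HasFDerivAt (fun x : Ambient m => ‖x‖ ^ 2) (2 • innerSL ℝ x) x :=
    (hasStrictFDerivAt_norm_sq x).hasFDerivAt
  have h2 : HasDerivAt radialBump (deriv radialBump (‖x‖ ^ 2)) (‖x‖ ^ 2) :=
    ((radialBump.contDiff (n := 1)).differentiable (by simp) _).hasDerivAt
  have := (h2.comp_hasFDerivAt x h1).fderiv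
  rw [show cutoff (m := m) = radialBump ∘ fun x : Ambient m => ‖x‖ ^ 2 from rfl, this]
  simp

/-- The gradient of the cutoff is parallel to `x`, while `radialExt g` has no radial derivative, so
differentiating the cutoff contributes nothing. -/
theorem sum_fderiv_cutoff_mul (f g : TestFun m) {ι : Type*} [Fintype ι]
    (b : OrthonormalBasis ι ℝ (Ambient m)) (x : Ambient m) :
    ∑ i, fderiv ℝ (fun x => (cutoff x : ℂ) * radialExt f x) x (b i) * fderiv ℝ (radialExt g) x (b i)
      = cutoff x * ∑ i, fderiv ℝ (radialExt f) x (b i) * fderiv ℝ (radialExt g) x (b i) := by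
  rcases eq_or_ne x 0 with rfl | hx
  · rw [fderiv_eq_zero_of_annulus (fun y hy => ?_) 0 (by simp),
      cutoff_eq_zero (by simp)]
    · simp
    · rw [cutoff_eq_zero (hy.imp le_of_lt le_of_lt)]; simp
  have h1 : HasFDerivAt (fun x : Ambient m => (cutoff x : ℂ))
      (Complex.ofRealCLM.comp (fderiv ℝ cutoff x)) x :=
    Complex.ofRealCLM.hasFDerivAt.comp x
      (contDiff_cutoff.differentiable (by simp) x).hasFDerivAt
  have h2 : HasFDerivAt (radialExt f) (fderiv ℝ (radialExt f) x) x :=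
    ((f.contDiffAt_two_radialExt hx).differentiableAt (by simp)).hasFDerivAt
  have h3 : ∑ i, (inner ℝ x (b i) : ℂ) * fderiv ℝ (radialExt g) x (b i) = 0 := by
    have h := congrArg (fderiv ℝ (radialExt g) x) (b.sum_repr' x)
    rw [fderiv_radialExt_self g hx, map_sum] at h
    rw [← h]
    refine Finset.sum_congr rfl fun i _ => ?_
    rw [map_smul, Complex.real_smul, real_inner_comm]
  rw [(h1.fun_mul h2).fderiv]
  simp only [_root_.add_apply, _root_.smul_apply, ContinuousLinearMap.comp_apply, smul_eq_mul, add_mul,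
    Finset.sum_add_distrib, Complex.ofRealCLM_apply, fderiv_cutoff, Complex.ofReal_mul]
  have h4 : ∑ i, radialExt f x * (((deriv radialBump (‖x‖ ^ 2) : ℝ) : ℂ) *
      (((2 : ℝ) : ℂ) * (inner ℝ x (b i) : ℝ))) * fderiv ℝ (radialExt g) x (b i) = 0 := by
    rw [← mul_zero (radialExt f x * (((deriv radialBump (‖x‖ ^ 2) : ℝ) : ℂ) * ((2 : ℝ) : ℂ))), ← h3,
      Finset.mul_sum]
    exact Finset.sum_congr rfl fun i _ => by ring
  rw [h4, add_zero, Finset.mul_sum]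
  exact Finset.sum_congr rfl fun i _ => by ring

theorem contDiffAt_fderiv_radialExt (g : TestFun m) (v : Ambient m) {x : Ambient m} (hx : x ≠ 0) :
    ContDiffAt ℝ ∞ (fun x => fderiv ℝ (radialExt g) x v) x :=
  ((g.contDiffAt_radialExt hx).fderiv_right (m := ∞) (by norm_cast)).clm_apply contDiffAt_const

theorem integral_cutoff_mul_second_deriv (f g : TestFun m) (v : Ambient m) :
    ∫ x, ((cutoff x : ℂ) * radialExt f x) * iteratedFDeriv ℝ 2 (radialExt g) x ![v, v] =
      - ∫ x, fderiv ℝ (fun x => (cutoff x : ℂ) * radialExt f x) x v *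
          fderiv ℝ (radialExt g) x v := by
  set A : Ambient m → ℂ := fun x => (cutoff x : ℂ) * radialExt f x with hA
  have hA0 : ∀ x, ‖x‖ < 1 ∨ 2 < ‖x‖ → A x = 0 := fun x hx => by
    simp [hA, cutoff_eq_zero (hx.imp le_of_lt le_of_lt)]
  have hAc : ContDiff ℝ ∞ A := contDiff_cutoff_mul f
  have hA' : Continuous fun x => fderiv ℝ A x v :=
    (hAc.continuous_fderiv (by simp)).clm_apply continuous_const
  have hcd := fun x (hx : x ≠ 0) => contDiffAt_fderiv_radialExt g v hx
  have key : ∀ x, x ≠ 0 → fderiv ℝ (fun x => fderiv ℝ (radialExt g) x v) x v =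
      iteratedFDeriv ℝ 2 (radialExt g) x ![v, v] := by
    intro x hx
    have h2 : DifferentiableAt ℝ (fderiv ℝ (radialExt g)) x :=
      ((g.contDiffAt_two_radialExt hx).fderiv_right (m := 1) (by norm_num)).differentiableAt
        (by simp)
    rw [(h2.hasFDerivAt.clm_apply (hasFDerivAt_const v x)).fderiv, iteratedFDeriv_two_apply]
    simp
  have hts : ∀ x ∈ tsupport A, x ≠ 0 := by
    rintro x hx rfl
    refine (notMem_tsupport_iff_eventuallyEq.mpr ?_) hx
    filter_upwards [Metric.ball_mem_nhds (0 : Ambient m) one_pos] with y hy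
    exact hA0 y (Or.inl (by simpa using hy))
  rw [← integral_mul_fderiv_eq_neg_fderiv_mul_of_integrable (𝕜 := ℂ)]
  · refine integral_congr_ae (ae_of_all _ fun x => ?_)
    rcases eq_or_ne x 0 with rfl | hx
    · simp [hA0 0 (by simp)]
    · simp only [key x hx, hA]
  · exact integrable_mul_of_annulus hA'
      (fun x hx => by rw [fderiv_eq_zero_of_annulus hA0 x hx]; simp)
      fun x hx => (hcd x hx).continuousAt
  · refine integrable_mul_of_annulus hAc.continuous hA0 fun x hx => ?_
    exact (((hcd x hx).fderiv_right (m := 0) (by simp)).clm_apply contDiffAt_const).continuousAt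
  · exact integrable_mul_of_annulus hAc.continuous hA0 fun x hx => (hcd x hx).continuousAt
  · exact fun x _ => hAc.differentiable (by simp) x
  · exact fun x hx => (hcd x (hts x hx)).differentiableAt (by simp)

/-- Green's identity on the annulus. The right-hand side is symmetric in `f` and `g`, which is the
source of the symmetry of the Laplace–Beltrami operator. -/
theorem integral_cutoff_mul_laplacian (f g : TestFun m) :
    ∫ x, ((cutoff x : ℂ) * radialExt f x) * (Laplacian.laplacian (radialExt g) : Ambient m → ℂ) x =
      - ∫ x, (cutoff x : ℂ) * ∑ i, fderiv ℝ (radialExt f) x (stdOrthonormalBasis ℝ (Ambient m) i) *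
          fderiv ℝ (radialExt g) x (stdOrthonormalBasis ℝ (Ambient m) i) := by
  simp_rw [← sum_fderiv_cutoff_mul]
  have hA0 : ∀ x : Ambient m, ‖x‖ < 1 ∨ 2 < ‖x‖ → (cutoff x : ℂ) * radialExt f x = 0 :=
    fun x hx => by simp [cutoff_eq_zero (hx.imp le_of_lt le_of_lt)]
  have hAc := contDiff_cutoff_mul f
  rw [InnerProductSpace.laplacian_eq_iteratedFDeriv_stdOrthonormalBasis]
  simp_rw [Finset.mul_sum]
  rw [integral_finsetSum, integral_finsetSum, ← Finset.sum_neg_distrib]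
  · exact Finset.sum_congr rfl fun i _ => integral_cutoff_mul_second_deriv f g _
  · intro i _
    refine integrable_mul_of_annulus
      ((hAc.continuous_fderiv (by simp)).clm_apply continuous_const)
      (fun x hx => by rw [fderiv_eq_zero_of_annulus hA0 x hx]; simp)
      fun x hx => (contDiffAt_fderiv_radialExt g _ hx).continuousAt
  · intro i _
    refine integrable_mul_of_annulus hAc.continuous hA0 fun x hx => ?_
    have h2 := (g.contDiffAt_radialExt hx).iteratedFDeriv_right (m := 0) (i := 2) (by norm_cast)
    exact ((ContinuousMultilinearMap.apply ℝ (fun _ : Fin 2 => Ambient m) ℂ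
        _).contDiff.contDiffAt.comp x h2).continuousAt

theorem integral_cutoff_mul_laplacian_eq (f g : TestFun m) :
    ∫ x, ((cutoff x : ℂ) * radialExt f x) * (Laplacian.laplacian (radialExt g) : Ambient m → ℂ) x =
      (∫ r, f r * laplaceBeltrami g r ∂(surface m)) *
        ∫ y : Set.Ioi (0 : ℝ), ((radialBump ((y : ℝ) ^ 2) * ((y : ℝ) ^ 2)⁻¹ : ℝ) : ℂ)
          ∂(Measure.volumeIoiPow m) := by
  rw [← integral_norm_mul_radialExt fun y => ((radialBump (y ^ 2) * (y ^ 2)⁻¹ : ℝ) : ℂ)]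
  refine integral_congr_ae (ae_of_all _ fun x => ?_)
  rcases eq_or_ne x 0 with rfl | hx
  · simp
  · simp only [laplacian_radialExt g hx, radialExt_of_ne _ hx, cutoff, Complex.ofReal_mul,
      Complex.ofReal_inv]
    ring

theorem radial_integral_ne_zero :
    ∫ y : Set.Ioi (0 : ℝ), ((radialBump ((y : ℝ) ^ 2) * ((y : ℝ) ^ 2)⁻¹ : ℝ) : ℂ)
      ∂(Measure.volumeIoiPow m) ≠ 0 := by
  intro h0
  have h1 := integral_norm_mul_radialExt (m := m)
    (fun y => ((radialBump (y ^ 2) * (y ^ 2)⁻¹ : ℝ) : ℂ)) (fun _ => 1)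
  rw [h0, mul_zero] at h1
  have h2 : ∀ x : Ambient m, ((radialBump (‖x‖ ^ 2) * (‖x‖ ^ 2)⁻¹ : ℝ) : ℂ) *
      radialExt (fun _ => 1) x = ((cutoff x * (‖x‖ ^ 2)⁻¹ : ℝ) : ℂ) := by
    intro x
    rcases eq_or_ne x 0 with rfl | hx
    · simp
    · simp [radialExt_of_ne _ hx, cutoff]
  simp_rw [h2] at h1
  rw [integral_complex_ofReal, Complex.ofReal_eq_zero] at h1
  -- The integrand is nonnegative and is nonzero at a point of norm `3/2`, because `|9/4 - 2| ≤ 1/2`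
  -- puts `9/4` where the bump equals `1`.
  refine (Continuous.integral_pos_of_hasCompactSupport_nonneg_nonzero (x :=
    (EuclideanSpace.single 0 (3/2) : Ambient m)) (μ := volume) (?_ : Continuous _) ?_ ?_ ?_).ne' h1
  · rw [continuous_iff_continuousAt]
    intro x
    rcases eq_or_ne x 0 with rfl | hx
    · have : (fun x : Ambient m => cutoff x * (‖x‖ ^ 2)⁻¹) =ᶠ[𝓝 0] fun _ => 0 := by
        filter_upwards [Metric.ball_mem_nhds (0 : Ambient m) one_pos] with y hy
        rw [cutoff_eq_zero (Or.inl (le_of_lt (by simpa using hy))), zero_mul]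
      exact continuousAt_const.congr this.symm
    · refine contDiff_cutoff.continuous.continuousAt.mul (ContinuousAt.inv₀ (by fun_prop) ?_)
      simpa using hx
  · refine HasCompactSupport.intro (isCompact_closedBall (0 : Ambient m) 2) fun x hx => ?_
    rw [cutoff_eq_zero (Or.inr (le_of_lt (by simpa using hx))), zero_mul]
  · exact fun x => mul_nonneg radialBump.nonneg (by positivity)
  · refine mul_ne_zero ?_ (by simp)
    have : cutoff (EuclideanSpace.single 0 (3/2) : Ambient m) = 1 := by
      refine radialBump.one_of_mem_closedBall ?_
      simp only [PiLp.norm_single, radialBump, Metric.mem_closedBall, Real.dist_eq]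
      norm_num [abs_le]
    rw [this]; exact one_ne_zero

/-- The Laplace-Beltrami operator is symmetric. -/
theorem integral_mul_laplaceBeltrami (f g : TestFun m) :
    ∫ r, f r * laplaceBeltrami g r ∂(surface m) = ∫ r, laplaceBeltrami f r * g r ∂(surface m) := by
  have h1 := integral_cutoff_mul_laplacian_eq f g
  have h2 := integral_cutoff_mul_laplacian_eq g f
  rw [integral_cutoff_mul_laplacian] at h1 h2
  simp_rw [mul_comm (fderiv ℝ (radialExt g) _ _)] at h2
  -- Both spherical integrals, multiplied by the same nonzero radial constant, equal minus the same
  -- Dirichlet form.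
  have h3 := mul_right_cancel₀ radial_integral_ne_zero (h1.symm.trans h2)
  rw [h3]
  exact integral_congr_ae (ae_of_all _ fun r => mul_comm _ _)

/-! ### Ultraspherical polynomials -/

open Polynomial

/-- The ultraspherical polynomials as polynomials. -/
def ultraPoly (m : ℕ) : ℕ → ℝ[X]
  | 0 => 1
  | 1 => X
  | n + 2 => C ((n + m : ℝ)⁻¹) * ((2 * n + m + 1 : ℝ[X]) * X * ultraPoly m (n + 1)
      - (n + 1 : ℝ[X]) * ultraPoly m n)

theorem eval_ultraPoly (t : ℝ) : ∀ n, (ultraPoly m n).eval t = ultraspherical m n t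
  | 0 => by simp [ultraPoly, ultraspherical]
  | 1 => by simp [ultraPoly, ultraspherical]
  | n + 2 => by
    rw [ultraPoly, ultraspherical, ← eval_ultraPoly t (n + 1), ← eval_ultraPoly t n]
    simp [div_eq_inv_mul]

theorem ultraPoly_rec (hm : 1 ≤ m) (n : ℕ) :
    (n + m : ℝ[X]) * ultraPoly m (n + 2) =
      (2 * n + m + 1 : ℝ[X]) * X * ultraPoly m (n + 1) - (n + 1 : ℝ[X]) * ultraPoly m n := by
  have h : (n + m : ℝ[X]) * C ((n + m : ℝ)⁻¹) = 1 := by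
    have h0 : (n + m : ℝ) ≠ 0 := by positivity
    have : (n + m : ℝ[X]) = C (n + m : ℝ) := by simp
    rw [this, ← C_mul, mul_inv_cancel₀ h0, C_1]
  rw [ultraPoly, ← mul_assoc, h, one_mul]

theorem natCast_add_ne_zero (hm : 1 ≤ m) (n : ℕ) : (n + m : ℝ[X]) ≠ 0 := by
  have : ((n + m : ℕ) : ℝ[X]) ≠ 0 := by
    rw [Ne, Nat.cast_eq_zero]; omega
  simpa using this

/-- The two relations need a joint induction: the first at `n + 1` uses the differentiated
recurrence and both relations at `n`; the second at `n + 1` is the first at `n` plus the recurrence.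
-/
theorem ultraPoly_ladder (hm : 1 ≤ m) (n : ℕ) :
    (1 - X ^ 2) * derivative (ultraPoly m (n + 1)) =
        (n + 1 : ℝ[X]) * (ultraPoly m n - X * ultraPoly m (n + 1)) ∧
      (1 - X ^ 2) * derivative (ultraPoly m n) =
        (n + m - 1 : ℝ[X]) * (X * ultraPoly m n - ultraPoly m (n + 1)) := by
  induction n with
  | zero => simp [ultraPoly, sq]
  | succ n ih =>
    obtain ⟨h1, h2⟩ := ih
    have hr := ultraPoly_rec hm n
    have hr' := congrArg derivative hr
    simp only [derivative_mul, derivative_add, derivative_sub, derivative_natCast, derivative_X,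
      derivative_one, derivative_ofNat, zero_mul, mul_one, zero_add, add_zero, mul_zero] at hr'
    constructor
    · apply mul_left_cancel₀ (natCast_add_ne_zero hm n)
      push_cast
      linear_combination (1 - X ^ 2) * hr' + (2 * n + m + 1) * X * h1 - (n + 1) * h2
        + (n + 2) * X * hr
    · push_cast
      linear_combination h1 + hr

theorem one_sub_X_sq_ne_zero : (1 - X ^ 2 : ℝ[X]) ≠ 0 := by
  intro h
  have := congrArg (eval 0) h
  simp at this

/-- The ultraspherical differential equation. -/
theorem ultraPoly_ode (hm : 1 ≤ m) (n : ℕ) :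
    (1 - X ^ 2) * derivative (derivative (ultraPoly m n)) - (m : ℝ[X]) * X * derivative (ultraPoly m n)
      = - (n * (n + m - 1) : ℝ[X]) * ultraPoly m n := by
  cases n with
  | zero => simp [ultraPoly]
  | succ n =>
    obtain ⟨h1, h2⟩ := ultraPoly_ladder hm n
    have h3 := congrArg derivative h1
    simp only [derivative_mul, derivative_add, derivative_sub, derivative_natCast, derivative_X,
      derivative_one, zero_mul, zero_add, derivative_X_pow, one_mul] at h3
    -- Differentiating the first ladder relation brings in the derivative of `P_n`; after
    -- multiplication by `1 - X²` the second relation eliminates it.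
    apply mul_left_cancel₀ one_sub_X_sq_ne_zero
    push_cast at h3 ⊢
    simp only [map_ofNat, pow_one] at h3
    linear_combination (1 - X ^ 2) * h3 + (n + 1) * h2 - (n + m - 1) * X * h1

/-! ### Zonal functions -/

/-- The zonal function `r ↦ p(⟨r, s⟩)`. -/
def zonal (p : ℝ[X]) (s : Sphere m) : TestFun m :=
  ⟨fun r => ((p.eval (inner ℝ (r : Ambient m) (s : Ambient m)) : ℝ) : ℂ), by
    have h : ContDiff ℝ ∞ fun x : Ambient m =>
        ((p.eval (inner ℝ x (s : Ambient m)) : ℝ) : ℂ) :=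
      Complex.ofRealCLM.contDiff.comp ((contDiff_aeval p ∞).comp (contDiff_id.inner ℝ contDiff_const))
    have : Fact (Module.finrank ℝ (Ambient m) = m + 1) := ⟨finrank_euclideanSpace_fin⟩
    exact h.contMDiff.comp (contMDiff_coe_sphere (n := m))⟩

theorem zonal_apply (p : ℝ[X]) (s r : Sphere m) :
    zonal p s r = ((p.eval (inner ℝ (r : Ambient m) (s : Ambient m)) : ℝ) : ℂ) := rfl

/-- With `a = ⟨r, s⟩`, `b = ⟨v, s⟩`, `c = ⟨r, v⟩` and `r`, `s`, `v` unit vectors, the function is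
the cosine of the angle between `r + t v` and `s`. -/
theorem hasDerivAt_angle {a b c t : ℝ} (ht : 0 < 1 + 2 * c * t + t ^ 2) :
    HasDerivAt (fun t => (a + t * b) / √(1 + 2 * c * t + t ^ 2))
      (b / √(1 + 2 * c * t + t ^ 2) - (a + t * b) * (c + t) / √(1 + 2 * c * t + t ^ 2) ^ 3) t := by
  have hq : HasDerivAt (fun t : ℝ => 1 + 2 * c * t + t ^ 2) (2 * c + 2 * t) t := by
    have := (((hasDerivAt_id t).const_mul (2 * c)).const_add 1).fun_add ((hasDerivAt_id t).fun_pow 2)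
    simpa using this
  have hn : HasDerivAt (fun t : ℝ => a + t * b) b t := by
    simpa using ((hasDerivAt_id t).mul_const b).const_add a
  have hs := Real.sqrt_pos.mpr ht
  refine (hn.fun_div (hq.sqrt ht.ne') hs.ne').congr_deriv ?_
  field_simp

theorem hasDerivAt_angle_deriv (a b c : ℝ) :
    HasDerivAt (fun t => b / √(1 + 2 * c * t + t ^ 2) -
        (a + t * b) * (c + t) / √(1 + 2 * c * t + t ^ 2) ^ 3)
      (3 * a * c ^ 2 - 2 * b * c - a) 0 := by
  have hq : HasDerivAt (fun t : ℝ => 1 + 2 * c * t + t ^ 2) (2 * c) 0 := by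
    have := (((hasDerivAt_id (0 : ℝ)).const_mul (2 * c)).const_add 1).fun_add
      ((hasDerivAt_id (0 : ℝ)).fun_pow 2)
    simpa using this
  have hs : HasDerivAt (fun t : ℝ => √(1 + 2 * c * t + t ^ 2)) c 0 := by
    have := hq.sqrt (by norm_num)
    simpa using this
  have hn : HasDerivAt (fun t : ℝ => (a + t * b) * (c + t)) (b * c + a) 0 := by
    have h1 : HasDerivAt (fun t : ℝ => a + t * b) b 0 := by
      simpa using ((hasDerivAt_id (0 : ℝ)).mul_const b).const_add a
    have h2 : HasDerivAt (fun t : ℝ => c + t) 1 0 := (hasDerivAt_id (0 : ℝ)).const_add c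
    simpa using h1.fun_mul h2
  have := ((hasDerivAt_const (0 : ℝ) b).fun_div hs (by simp)).fun_sub
    (hn.fun_div (hs.fun_pow 3) (by simp))
  refine this.congr_deriv ?_
  simp
  ring

theorem radialExt_zonal (p : ℝ[X]) (s : Sphere m) {x : Ambient m} (hx : x ≠ 0) :
    radialExt (zonal p s) x = ((p.eval (inner ℝ x (s : Ambient m) / ‖x‖) : ℝ) : ℂ) := by
  rw [radialExt_of_ne _ hx, zonal_apply]
  congr 2
  rw [TestFun.normalize, real_inner_smul_left]
  ring

theorem deriv_deriv_radialExt_zonal (p : ℝ[X]) (s r : Sphere m) (v : Ambient m) (hv : ‖v‖ = 1) :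
    deriv (deriv fun t : ℝ => radialExt (zonal p s) ((r : Ambient m) + t • v)) 0 =
      ((p.derivative.derivative.eval (inner ℝ (r : Ambient m) (s : Ambient m)) *
          (inner ℝ v (s : Ambient m) -
            inner ℝ (r : Ambient m) (s : Ambient m) * inner ℝ (r : Ambient m) v) ^ 2 +
        p.derivative.eval (inner ℝ (r : Ambient m) (s : Ambient m)) *
          (3 * inner ℝ (r : Ambient m) (s : Ambient m) * inner ℝ (r : Ambient m) v ^ 2
            - 2 * inner ℝ v (s : Ambient m) * inner ℝ (r : Ambient m) v
            - inner ℝ (r : Ambient m) (s : Ambient m)) : ℝ) : ℂ) := by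
  set a : ℝ := inner ℝ (r : Ambient m) (s : Ambient m)
  set b : ℝ := inner ℝ v (s : Ambient m)
  set c : ℝ := inner ℝ (r : Ambient m) v
  have hr : ‖(r : Ambient m)‖ = 1 := by simp
  have hnorm : ∀ t : ℝ, ‖(r : Ambient m) + t • v‖ ^ 2 = 1 + 2 * c * t + t ^ 2 := by
    intro t
    rw [norm_add_sq_real, hr, norm_smul, hv, real_inner_smul_right, Real.norm_eq_abs, mul_one,
      sq_abs]
    ring
  have hpos : ∀ᶠ t : ℝ in 𝓝 0, 0 < 1 + 2 * c * t + t ^ 2 := by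
    have : Continuous fun t : ℝ => 1 + 2 * c * t + t ^ 2 := by fun_prop
    exact this.continuousAt.eventually_const_lt (by norm_num)
  have e1 : ∀ t : ℝ, 0 < 1 + 2 * c * t + t ^ 2 → radialExt (zonal p s) ((r : Ambient m) + t • v) =
      ((p.eval ((a + t * b) / √(1 + 2 * c * t + t ^ 2)) : ℝ) : ℂ) := by
    intro t ht
    have hne : (r : Ambient m) + t • v ≠ 0 := by
      intro h0
      have := hnorm t
      rw [h0, norm_zero] at this
      norm_num at this
      linarith
    rw [radialExt_zonal p s hne, ← hnorm t, Real.sqrt_sq (norm_nonneg _), inner_add_left,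
      real_inner_smul_left]
  have e2 : deriv (fun t : ℝ => radialExt (zonal p s) ((r : Ambient m) + t • v)) =ᶠ[𝓝 0]
      fun t => ((p.derivative.eval ((a + t * b) / √(1 + 2 * c * t + t ^ 2)) *
        (b / √(1 + 2 * c * t + t ^ 2) - (a + t * b) * (c + t) / √(1 + 2 * c * t + t ^ 2) ^ 3) :
          ℝ) : ℂ) := by
    filter_upwards [hpos.eventually_nhds] with t ht
    have h1 : (fun t : ℝ => radialExt (zonal p s) ((r : Ambient m) + t • v)) =ᶠ[𝓝 t] fun t =>
        ((p.eval ((a + t * b) / √(1 + 2 * c * t + t ^ 2)) : ℝ) : ℂ) := ht.mono e1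
    rw [h1.deriv_eq]
    exact (((p.hasDerivAt _).comp t (hasDerivAt_angle ht.self_of_nhds)).ofReal_comp).deriv
  rw [e2.deriv_eq]
  have h3 := ((p.derivative.hasDerivAt _).comp (0 : ℝ)
    (hasDerivAt_angle (a := a) (b := b) (c := c) (t := 0) (by norm_num))).mul
    (hasDerivAt_angle_deriv a b c)
  refine (h3.ofReal_comp.deriv).trans ?_
  congr 1
  simp
  ring

/-- Sum the second derivatives over an orthonormal basis, with `a = ⟨r, s⟩`. Parseval gives `∑ b² =
∑ c² = 1` and `∑ b c = a`, so `p''` gets the factor `1 - 2a² + a²` and `p'` the factor `3a - 2a -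
(m+1)a`. -/
theorem laplaceBeltrami_zonal (p : ℝ[X]) (s : Sphere m) :
    laplaceBeltrami (zonal p s) =
      zonal ((1 - X ^ 2) * derivative (derivative p) - (m : ℝ[X]) * X * derivative p) s := by
  ext r
  set B := stdOrthonormalBasis ℝ (Ambient m)
  rw [laplaceBeltrami_apply, InnerProductSpace.laplacian_eq_iteratedFDeriv_stdOrthonormalBasis,
    zonal_apply]
  simp_rw [iteratedFDeriv_two_line ((zonal p s).contDiffAt_two_radialExt (sphere_ne_zero r)),
    deriv_deriv_radialExt_zonal p s r _ ((stdOrthonormalBasis ℝ (Ambient m)).norm_eq_one _)]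
  rw [← Complex.ofReal_sum]
  congr 1
  set a : ℝ := inner ℝ (r : Ambient m) (s : Ambient m) with ha
  have h1 : ∑ i, inner ℝ (B i) (s : Ambient m) ^ 2 = 1 := by
    have := B.sum_inner_mul_inner (s : Ambient m) s
    simp only [real_inner_self_eq_norm_sq, norm_eq_of_mem_sphere] at this
    rw [one_pow] at this
    refine Eq.trans ?_ this
    exact Finset.sum_congr rfl fun i _ => by rw [real_inner_comm (B i)]; ring
  have h2 : ∑ i, inner ℝ (r : Ambient m) (B i) ^ 2 = 1 := by
    have := B.sum_inner_mul_inner (r : Ambient m) r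
    simp only [real_inner_self_eq_norm_sq, norm_eq_of_mem_sphere] at this
    rw [one_pow] at this
    refine Eq.trans ?_ this
    exact Finset.sum_congr rfl fun i _ => by rw [real_inner_comm _ (B i)]; ring
  have h3 : ∑ i, inner ℝ (r : Ambient m) (B i) * inner ℝ (B i) (s : Ambient m) = a :=
    B.sum_inner_mul_inner (r : Ambient m) s
  have h4 : ∑ i : Fin (Module.finrank ℝ (Ambient m)), (1 : ℝ) = m + 1 := by
    simp
  calc
    _ = p.derivative.derivative.eval a * ((∑ i, inner ℝ (B i) (s : Ambient m) ^ 2)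
          - 2 * a * (∑ i, inner ℝ (r : Ambient m) (B i) * inner ℝ (B i) (s : Ambient m))
          + a ^ 2 * ∑ i, inner ℝ (r : Ambient m) (B i) ^ 2)
        + p.derivative.eval a * (3 * a * (∑ i, inner ℝ (r : Ambient m) (B i) ^ 2)
          - 2 * (∑ i, inner ℝ (r : Ambient m) (B i) * inner ℝ (B i) (s : Ambient m))
          - a * ∑ i : Fin (Module.finrank ℝ (Ambient m)), (1 : ℝ)) := by
      simp only [Finset.mul_sum, ← Finset.sum_sub_distrib, ← Finset.sum_add_distrib]
      exact Finset.sum_congr rfl fun i _ => by ring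
    _ = _ := by
      rw [h1, h2, h3, h4]
      simp
      ring

theorem zonal_ultraPoly_mem (hm : 1 ≤ m) (n : ℕ) (s : Sphere m) :
    zonal (ultraPoly m n) s ∈ Harm m n := by
  rw [Harm, Module.End.mem_eigenspace_iff, laplaceBeltrami_zonal, ultraPoly_ode hm]
  ext r
  rw [smul_apply, zonal_apply, zonal_apply]
  simp

/-! ### Orthogonality of the eigenspaces -/

/-- Minus the eigenvalue of the Laplace-Beltrami operator on harmonics of order `n`. -/
def eig (m n : ℕ) : ℝ := n * (n + m - 1)

theorem laplaceBeltrami_of_mem {n : ℕ} {h : TestFun m} (hh : h ∈ Harm m n) :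
    laplaceBeltrami h = (-(eig m n : ℂ)) • h := by
  rw [Harm, Module.End.mem_eigenspace_iff] at hh
  rw [hh, eig]
  push_cast
  rfl

theorem mem_Harm_iff {n : ℕ} {h : TestFun m} :
    h ∈ Harm m n ↔ laplaceBeltrami h = (-(eig m n : ℂ)) • h := by
  refine ⟨laplaceBeltrami_of_mem, fun hh => ?_⟩
  rw [Harm, Module.End.mem_eigenspace_iff, hh, eig]
  push_cast
  rfl

theorem sq_le_eig (hm : 1 ≤ m) (n : ℕ) : (n : ℝ) ^ 2 ≤ eig m n := by
  have : (1 : ℝ) ≤ m := by exact_mod_cast hm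
  unfold eig
  nlinarith [(Nat.cast_nonneg n : (0 : ℝ) ≤ n)]

theorem eig_nonneg (hm : 1 ≤ m) (n : ℕ) : 0 ≤ eig m n := (sq_nonneg _).trans (sq_le_eig hm n)

theorem eig_strictMono (hm : 1 ≤ m) : StrictMono (eig m) := by
  refine strictMono_nat_of_lt_succ fun n => ?_
  have : (1 : ℝ) ≤ m := by exact_mod_cast hm
  unfold eig
  push_cast
  nlinarith [(Nat.cast_nonneg n : (0 : ℝ) ≤ n)]

theorem conjugate_mem {n : ℕ} {h : TestFun m} (hh : h ∈ Harm m n) : h.conjugate ∈ Harm m n := by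
  rw [mem_Harm_iff] at hh ⊢
  rw [laplaceBeltrami_conjugate, hh]
  ext r
  simp only [conjugate_apply, smul_apply, map_mul, map_neg, Complex.conj_ofReal]

theorem compIsometry_mem {n : ℕ} {h : TestFun m} (hh : h ∈ Harm m n)
    (R : Ambient m ≃ₗᵢ[ℝ] Ambient m) : h.compIsometry R ∈ Harm m n := by
  rw [mem_Harm_iff] at hh ⊢
  rw [laplaceBeltrami_compIsometry, hh]
  rfl

/-- Symmetry of the operator and distinctness of the eigenvalues. The form is bilinear, without
conjugation, to match the pairing with generalised functions. -/
theorem integral_mul_eq_zero_of_ne (hm : 1 ≤ m) {n k : ℕ} (hnk : n ≠ k) {f g : TestFun m}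
    (hf : f ∈ Harm m n) (hg : g ∈ Harm m k) : ∫ r, f r * g r ∂(surface m) = 0 := by
  have h := integral_mul_laplaceBeltrami f g
  rw [laplaceBeltrami_of_mem hf, laplaceBeltrami_of_mem hg] at h
  simp only [smul_apply, mul_left_comm _ (-(eig m k : ℂ)), mul_assoc, integral_const_mul] at h
  have h2 : ((eig m n : ℂ) - eig m k) ≠ 0 := by
    rw [sub_ne_zero]
    exact_mod_cast (eig_strictMono hm).injective.ne hnk
  refine (mul_eq_zero.mp (?_ : ((eig m n : ℂ) - eig m k) * _ = 0)).resolve_left h2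
  linear_combination h

theorem l2inner_eq_zero_of_ne (hm : 1 ≤ m) {n k : ℕ} (hnk : n ≠ k) {f g : TestFun m}
    (hf : f ∈ Harm m n) (hg : g ∈ Harm m k) : l2inner f g = 0 :=
  integral_mul_eq_zero_of_ne hm hnk hf (conjugate_mem hg)

/-! ### Density of the spherical harmonics in the continuous functions -/

/-- Finite linear combinations of spherical harmonics. -/
def harmonics (m : ℕ) : Submodule ℂ (TestFun m) := ⨆ n, Harm m n

theorem mem_harmonics {n : ℕ} {h : TestFun m} (hh : h ∈ Harm m n) : h ∈ harmonics m :=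
  Submodule.mem_iSup_of_mem n hh

theorem exists_sum_of_mem_harmonics {h : TestFun m} (hh : h ∈ harmonics m) :
    ∃ (N : ℕ) (φ : ℕ → TestFun m), (∀ n, φ n ∈ Harm m n) ∧ h = ∑ n ∈ Finset.range N, φ n := by
  classical
  obtain ⟨f, hf, rfl⟩ := (Submodule.mem_iSup_iff_exists_finsupp _ _).mp hh
  refine ⟨f.support.sup id + 1, f, hf, ?_⟩
  rw [Finsupp.sum]
  refine Finset.sum_subset (fun n hn => ?_) fun n _ hn => by simpa using hn
  rw [Finset.mem_range, Nat.lt_succ_iff]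
  exact Finset.le_sup (f := id) hn

theorem zonal_add (p q : ℝ[X]) (s : Sphere m) : zonal (p + q) s = zonal p s + zonal q s := by
  ext r
  rw [add_apply]
  simp only [zonal_apply, eval_add, Complex.ofReal_add]

theorem zonal_smul (c : ℝ) (p : ℝ[X]) (s : Sphere m) : zonal (c • p) s = (c : ℂ) • zonal p s := by
  ext r
  rw [smul_apply]
  simp only [zonal_apply, eval_smul, smul_eq_mul, Complex.ofReal_mul]

/-- The three-term recurrence makes the span stable under multiplication by `X`, and it contains
`1`. -/
theorem mem_span_ultraPoly (hm : 1 ≤ m) (p : ℝ[X]) :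
    p ∈ Submodule.span ℝ (Set.range (ultraPoly m)) := by
  set W := Submodule.span ℝ (Set.range (ultraPoly m))
  have hP : ∀ n, ultraPoly m n ∈ W := fun n => Submodule.subset_span ⟨n, rfl⟩
  have hX : ∀ q ∈ W, X * q ∈ W := by
    intro q hq
    induction hq using Submodule.span_induction with
    | mem q hq =>
      obtain ⟨n, rfl⟩ := hq
      cases n with
      | zero => simpa [ultraPoly] using hP 1
      | succ n =>
        have h0 : (2 * n + m + 1 : ℝ) ≠ 0 := by positivity
        have e : X * ultraPoly m (n + 1) = (2 * n + m + 1 : ℝ)⁻¹ •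
            ((n + m : ℝ) • ultraPoly m (n + 2) + (n + 1 : ℝ) • ultraPoly m n) := by
          rw [eq_inv_smul_iff₀ h0]
          simp only [smul_eq_C_mul]
          have := ultraPoly_rec hm n
          simp only [map_add, map_mul, map_natCast, map_one, map_ofNat]
          linear_combination -this
        rw [e]
        exact W.smul_mem _ (W.add_mem (W.smul_mem _ (hP _)) (W.smul_mem _ (hP _)))
    | zero => simp
    | add a b _ _ ha hb => rw [mul_add]; exact W.add_mem ha hb
    | smul c a _ ha => rw [mul_smul_comm]; exact W.smul_mem _ ha
  induction p using Polynomial.induction_on with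
  | C a =>
    have := W.smul_mem a (hP 0)
    rwa [ultraPoly, smul_eq_C_mul, mul_one] at this
  | add p q hp hq => exact W.add_mem hp hq
  | monomial n a ih =>
    rw [pow_succ, ← mul_assoc, mul_comm]
    exact hX _ ih

theorem zonal_mem_harmonics (hm : 1 ≤ m) (p : ℝ[X]) (s : Sphere m) : zonal p s ∈ harmonics m := by
  induction mem_span_ultraPoly hm p using Submodule.span_induction with
  | mem q hq =>
    obtain ⟨n, rfl⟩ := hq
    exact mem_harmonics (zonal_ultraPoly_mem hm n s)
  | zero =>
    convert (harmonics m).zero_mem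
    ext r
    simp only [zonal_apply, eval_zero, Complex.ofReal_zero]
    rfl
  | add a b _ _ ha hb => rw [zonal_add]; exact (harmonics m).add_mem ha hb
  | smul c a _ ha => rw [zonal_smul]; exact (harmonics m).smul_mem _ ha

/-- Linear forms restricted to the sphere. -/
def linForm (y : Ambient m) : C(Sphere m, ℝ) := ⟨fun r => inner ℝ (r : Ambient m) y, by fun_prop⟩

/-- The exponentials of the linear forms on the sphere, as a monoid homomorphism. -/
def expForm (m : ℕ) : Multiplicative (Ambient m) →* C(Sphere m, ℝ) where
  toFun y := NormedSpace.exp (linForm y.toAdd)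
  map_one' := by
    have : linForm (0 : Ambient m) = 0 := by ext r; simp [linForm]
    simp [this]
  map_mul' x y := by
    have : linForm (x.toAdd + y.toAdd) = linForm x.toAdd + linForm y.toAdd := by
      ext r; simp [linForm, inner_add_right]
    rw [toAdd_mul, this, NormedSpace.exp_add]

theorem exp_linForm_apply (y : Ambient m) (r : Sphere m) :
    NormedSpace.exp (linForm y) r = Real.exp (inner ℝ (r : Ambient m) y) := by
  have := NormedSpace.map_exp (ContinuousMap.evalAlgHom ℝ ℝ r)
    (by change Continuous fun f : C(Sphere m, ℝ) => f r; fun_prop) (linForm y)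
  rw [Real.exp_eq_exp_ℝ]
  exact this

/-- Products of exponentials of linear forms are again such exponentials, so their span is already
an algebra. It separates points, and Stone–Weierstrass applies. -/
theorem closure_expForm (m : ℕ) :
    closure (Submodule.span ℝ (Set.range (expForm m)) : Set C(Sphere m, ℝ)) = Set.univ := by
  have h1 := ContinuousMap.subalgebra_topologicalClosure_eq_top_of_separatesPoints
    (Algebra.adjoin ℝ (Set.range (expForm m))) (by
      intro r s hrs
      refine ⟨_, ⟨expForm m (Multiplicative.ofAdd ((r : Ambient m) - (s : Ambient m))),
        Algebra.subset_adjoin ⟨_, rfl⟩, rfl⟩, ?_⟩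
      change NormedSpace.exp (linForm ((r : Ambient m) - (s : Ambient m))) r ≠
        NormedSpace.exp (linForm ((r : Ambient m) - (s : Ambient m))) s
      rw [exp_linForm_apply, exp_linForm_apply, Ne, Real.exp_eq_exp, ← sub_eq_zero,
        ← inner_sub_left, inner_self_eq_zero, sub_eq_zero]
      exact fun h => hrs (Subtype.ext h))
  have h2 : (Algebra.adjoin ℝ (Set.range (expForm m)) : Set C(Sphere m, ℝ)) =
      Submodule.span ℝ (Set.range (expForm m)) := by
    have := Algebra.adjoin_eq_span ℝ (Set.range (expForm m))
    rw [← MonoidHom.coe_mrange, Submonoid.closure_eq] at this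
    rw [← MonoidHom.coe_mrange, ← this]
    rfl
  rw [← h2, ← Subalgebra.topologicalClosure_coe, h1]
  rfl

/-- The inclusion of real into complex continuous functions. -/
def ofRealCont (m : ℕ) : C(Sphere m, ℝ) →L[ℝ] C(Sphere m, ℂ) :=
  Complex.ofRealCLM.compLeftContinuous ℝ (Sphere m)

/-- The closure of the spherical harmonics in the continuous functions. -/
def harmonicsClosure (m : ℕ) : Submodule ℂ C(Sphere m, ℂ) :=
  ((harmonics m).map toContₗ).topologicalClosure

/-- The exponential series of a linear form converges uniformly, and its terms are multiples of
powers of `⟨·, y⟩`, that is, polynomial zonal functions with pole `y/‖y‖`. By density of the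
exponentials this suffices. -/
theorem ofRealCont_mem (hm : 1 ≤ m) (g : C(Sphere m, ℝ)) :
    ofRealCont m g ∈ harmonicsClosure m := by
  set K : Submodule ℝ C(Sphere m, ℝ) :=
    ((harmonicsClosure m).restrictScalars ℝ).comap (ofRealCont m : C(Sphere m, ℝ) →ₗ[ℝ] _) with hK
  have hclosed : IsClosed (K : Set C(Sphere m, ℝ)) :=
    (Submodule.isClosed_topologicalClosure _).preimage (ofRealCont m).continuous
  have hpow : ∀ (y : Ambient m) (k : ℕ), linForm y ^ k ∈ K := by
    intro y k
    refine Submodule.le_topologicalClosure _ ?_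
    -- For `y = 0` there is no direction to normalise: the power is the constant `0 ^ k` (equal to
    -- `1` for `k = 0`), and any pole serves.
    rcases eq_or_ne y 0 with rfl | hy
    · refine ⟨zonal (C ((0 : ℝ) ^ k)) (TestFun.normalize (EuclideanSpace.single 0 1) (by simp)),
        zonal_mem_harmonics hm _ _, ?_⟩
      ext r
      change zonal _ _ r = (((linForm (0 : Ambient m) ^ k) r : ℝ) : ℂ)
      simp [zonal_apply, linForm]
    · refine ⟨zonal ((‖y‖ ^ k) • X ^ k) (TestFun.normalize y hy),
        zonal_mem_harmonics hm _ _, ?_⟩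
      have hy' : ‖y‖ ≠ 0 := by simpa using hy
      ext r
      have : ‖y‖ ^ k * inner ℝ (r : Ambient m) (TestFun.normalize y hy) ^ k =
          inner ℝ (r : Ambient m) y ^ k := by
        rw [← mul_pow]
        congr 1
        rw [TestFun.normalize, real_inner_smul_right]
        field_simp
      change zonal _ _ r = (((linForm y ^ k) r : ℝ) : ℂ)
      rw [zonal_apply, eval_smul, eval_pow, eval_X, smul_eq_mul, this]
      rfl
  have hexp : ∀ y, expForm m y ∈ K := by
    intro y
    have h1 := NormedSpace.exp_series_hasSum_exp' (𝕂 := ℝ) (linForm y.toAdd)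
    exact hclosed.mem_of_tendsto h1 (Eventually.of_forall fun s =>
      K.sum_mem fun k _ => K.smul_mem _ (hpow _ _))
  have hspan : (Submodule.span ℝ (Set.range (expForm m)) : Set C(Sphere m, ℝ)) ⊆ K :=
    Submodule.span_le.mpr (by rintro _ ⟨y, rfl⟩; exact hexp y)
  have hall := closure_minimal hspan hclosed
  rw [closure_expForm] at hall
  exact hall (Set.mem_univ g)

/-- Spherical harmonics are uniformly dense in the continuous functions. -/
theorem exists_harmonics_near (hm : 1 ≤ m) (g : C(Sphere m, ℂ)) {ε : ℝ} (hε : 0 < ε) :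
    ∃ h ∈ harmonics m, ∀ r, ‖g r - h r‖ < ε := by
  have hg : g ∈ harmonicsClosure m := by
    have e : g = ofRealCont m ⟨fun r => (g r).re, by fun_prop⟩ +
        Complex.I • ofRealCont m ⟨fun r => (g r).im, by fun_prop⟩ := by
      ext r
      simp only [ofRealCont, ContinuousMap.add_apply, ContinuousMap.smul_apply, smul_eq_mul]
      rw [mul_comm]
      exact (Complex.re_add_im (g r)).symm
    rw [e]
    exact Submodule.add_mem _ (ofRealCont_mem hm _) (Submodule.smul_mem _ _ (ofRealCont_mem hm _))
  obtain ⟨_, ⟨h, hh, rfl⟩, hd⟩ := Metric.mem_closure_iff.mp hg ε hε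
  refine ⟨h, hh, fun r => ?_⟩
  rw [dist_eq_norm] at hd
  exact (ContinuousMap.norm_coe_le_norm (g - toContₗ h) r).trans_lt hd

/-! ### The `L²` inner product -/

instance (m : ℕ) : (surface m).IsOpenPosMeasure := by
  unfold surface; infer_instance

theorem integrable_of_continuous {E : Type*} [NormedAddCommGroup E] {f : Sphere m → E}
    (hf : Continuous f) : Integrable f (surface m) :=
  hf.integrable_of_hasCompactSupport (HasCompactSupport.of_compactSpace f)

theorem integrable_l2 (f g : TestFun m) :
    Integrable (fun r => f r * starRingEnd ℂ (g r)) (surface m) :=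
  integrable_of_continuous (f.continuous.mul (Complex.continuous_conj.comp g.continuous))

theorem l2inner_add_left (f g h : TestFun m) : l2inner (f + g) h = l2inner f h + l2inner g h := by
  simp only [l2inner, TestFun.add_apply, add_mul]
  exact integral_add (integrable_l2 f h) (integrable_l2 g h)

theorem l2inner_smul_left (c : ℂ) (f h : TestFun m) : l2inner (c • f) h = c * l2inner f h := by
  simp only [l2inner, TestFun.smul_apply, mul_assoc, integral_const_mul]

theorem l2inner_conj (f g : TestFun m) : starRingEnd ℂ (l2inner f g) = l2inner g f := by
  rw [l2inner, ← integral_conj, l2inner]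
  refine integral_congr_ae (ae_of_all _ fun r => ?_)
  simp [mul_comm]

/-- The inner product against a fixed function, as a linear form. -/
def l2left (h : TestFun m) : TestFun m →ₗ[ℂ] ℂ where
  toFun f := l2inner f h
  map_add' f g := l2inner_add_left f g h
  map_smul' c f := l2inner_smul_left c f h

theorem l2inner_sum_left {ι : Type*} (s : Finset ι) (f : ι → TestFun m) (h : TestFun m) :
    l2inner (∑ i ∈ s, f i) h = ∑ i ∈ s, l2inner (f i) h := map_sum (l2left h) f s

theorem l2inner_sub_left (f g h : TestFun m) : l2inner (f - g) h = l2inner f h - l2inner g h :=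
  map_sub (l2left h) f g

theorem l2inner_sum_right {ι : Type*} (s : Finset ι) (f : ι → TestFun m) (h : TestFun m) :
    l2inner h (∑ i ∈ s, f i) = ∑ i ∈ s, l2inner h (f i) := by
  rw [← l2inner_conj, l2inner_sum_left, map_sum]
  exact Finset.sum_congr rfl fun i _ => l2inner_conj _ _

theorem l2inner_smul_right (c : ℂ) (f h : TestFun m) :
    l2inner f (c • h) = starRingEnd ℂ c * l2inner f h := by
  rw [← l2inner_conj, l2inner_smul_left, map_mul, l2inner_conj]

theorem l2inner_compIsometry (f g : TestFun m) (R : Ambient m ≃ₗᵢ[ℝ] Ambient m) :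
    l2inner (f.compIsometry R) (g.compIsometry R) = l2inner f g := by
  have hc : Continuous fun r => f r * starRingEnd ℂ (g r) :=
    f.continuous.mul (Complex.continuous_conj.comp g.continuous)
  have := integral_map (μ := surface m) (φ := sphereMap R)
    (measurePreserving_sphereMap R).measurable.aemeasurable
    (f := fun r => f r * starRingEnd ℂ (g r)) hc.aestronglyMeasurable
  rw [(measurePreserving_sphereMap R).map_eq] at this
  exact this.symm

theorem continuous_eq_zero_of_integral_mul_conj {d : Sphere m → ℂ} (hd : Continuous d)
    (h : ∫ r, d r * starRingEnd ℂ (d r) ∂(surface m) = 0) : d = 0 := by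
  have h1 : ∫ r, ‖d r‖ ^ 2 ∂(surface m) = 0 := by
    have e : ∀ r, d r * starRingEnd ℂ (d r) = ((‖d r‖ ^ 2 : ℝ) : ℂ) := fun r => by
      rw [Complex.mul_conj, Complex.normSq_eq_norm_sq]
    simp_rw [e, integral_complex_ofReal] at h
    exact_mod_cast h
  have hc : Continuous fun r => ‖d r‖ ^ 2 := by fun_prop
  have h2 := (integral_eq_zero_iff_of_nonneg (fun r => by positivity)
    (integrable_of_continuous hc)).mp h1
  have h3 := (hc.ae_eq_iff_eq (surface m) continuous_const).mp h2
  ext r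
  have h4 : ‖d r‖ ^ 2 = 0 := congrFun h3 r
  simpa using h4

theorem eq_zero_of_l2inner_self {d : TestFun m} (h : l2inner d d = 0) : d = 0 :=
  TestFun.ext fun r => congrFun (continuous_eq_zero_of_integral_mul_conj d.continuous h) r

theorem area_pos (m : ℕ) : 0 < area m := by
  have : Nonempty (Sphere m) := ⟨TestFun.normalize (EuclideanSpace.single 0 1) (by simp)⟩
  rw [area, Measure.real, ENNReal.toReal_pos_iff]
  exact ⟨isOpen_univ.measure_pos _ Set.univ_nonempty, measure_lt_top _ _⟩

/-! ### Projections and reproducing kernels -/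

namespace HarmonicBasis

variable (B : HarmonicBasis m)

theorem mem (n : ℕ) (k : Fin (harmDim m n)) : B.Y n k ∈ Harm m n := by
  rw [← B.span_eq]; exact Submodule.subset_span ⟨k, rfl⟩

theorem component_add (n : ℕ) (f g : TestFun m) :
    B.component n (f + g) = B.component n f + B.component n g := by
  simp only [component, l2inner_add_left, add_smul, Finset.sum_add_distrib]

theorem component_smul (n : ℕ) (c : ℂ) (f : TestFun m) :
    B.component n (c • f) = c • B.component n f := by
  simp only [component, l2inner_smul_left, mul_smul, Finset.smul_sum]

theorem component_mem (n : ℕ) (f : TestFun m) : B.component n f ∈ Harm m n :=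
  Submodule.sum_mem _ fun k _ => Submodule.smul_mem _ _ (B.mem n k)

theorem component_of_mem {n : ℕ} {f : TestFun m} (hf : f ∈ Harm m n) : B.component n f = f := by
  rw [← B.span_eq] at hf
  induction hf using Submodule.span_induction with
  | mem f hf =>
    obtain ⟨k, rfl⟩ := hf
    simp [component, B.orthonormal]
  | zero =>
    have := B.component_smul n 0 0
    simpa using this
  | add f g _ _ hf hg => rw [component_add, hf, hg]
  | smul c f _ hf => rw [component_smul, hf]

theorem component_of_mem_ne (hm : 1 ≤ m) {n k : ℕ} (hnk : n ≠ k) {f : TestFun m}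
    (hf : f ∈ Harm m n) : B.component k f = 0 := by
  refine Finset.sum_eq_zero fun i _ => ?_
  rw [l2inner_eq_zero_of_ne hm hnk hf (B.mem k i), zero_smul]

/-- The reproducing kernel of the space of harmonics of order `n`. -/
def kernel (n : ℕ) (s : Sphere m) : TestFun m := ∑ k, starRingEnd ℂ (B.Y n k s) • B.Y n k

theorem kernel_mem (n : ℕ) (s : Sphere m) : B.kernel n s ∈ Harm m n :=
  Submodule.sum_mem _ fun k _ => Submodule.smul_mem _ _ (B.mem n k)

theorem _root_.Spherical.TestFun.sum_apply {ι : Type*} (s : Finset ι) (f : ι → TestFun m)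
    (r : Sphere m) : (∑ i ∈ s, f i) r = ∑ i ∈ s, f i r := by
  classical
  induction s using Finset.induction_on with
  | empty => rfl
  | insert a s ha ih => rw [Finset.sum_insert ha, Finset.sum_insert ha, TestFun.add_apply, ih]

theorem kernel_apply (n : ℕ) (s r : Sphere m) :
    B.kernel n s r = ∑ k, starRingEnd ℂ (B.Y n k s) * B.Y n k r := by
  simp only [kernel, TestFun.sum_apply, TestFun.smul_apply]

theorem l2inner_kernel (n : ℕ) (s : Sphere m) (f : TestFun m) :
    l2inner f (B.kernel n s) = B.component n f s := by
  simp only [kernel, component, l2inner_sum_right, l2inner_smul_right, TestFun.sum_apply,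
    TestFun.smul_apply, Complex.conj_conj, mul_comm]

theorem l2inner_kernel_of_mem {n : ℕ} (s : Sphere m) {f : TestFun m} (hf : f ∈ Harm m n) :
    l2inner f (B.kernel n s) = f s := by
  rw [l2inner_kernel, component_of_mem B hf]

theorem kernel_conj (n : ℕ) (s r : Sphere m) :
    starRingEnd ℂ (B.kernel n s r) = B.kernel n r s := by
  rw [kernel_apply, kernel_apply, map_sum]
  refine Finset.sum_congr rfl fun k _ => ?_
  rw [map_mul, Complex.conj_conj, mul_comm]

/-- The function `K_n(Rs, R·)` is a harmonic of order `n` whose pairing with each `f` of that order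
is `f(s)`. This property characterises `K_n(s, ·)`; pairing with `K_n(r, ·)` compares values at `r`.
-/
theorem kernel_sphereMap (n : ℕ) (R : Ambient m ≃ₗᵢ[ℝ] Ambient m) (s r : Sphere m) :
    B.kernel n (sphereMap R s) (sphereMap R r) = B.kernel n s r := by
  have hR : ∀ q, sphereMap R.symm (sphereMap R q) = q := fun q => by
    ext1; simp [sphereMap]
  set k' := (B.kernel n (sphereMap R s)).compIsometry R with hk'
  have hk : k' ∈ Harm m n := compIsometry_mem (B.kernel_mem n _) R
  have key : ∀ f ∈ Harm m n, l2inner f k' = f s := by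
    intro f hf
    have e : f = (f.compIsometry R.symm).compIsometry R := by
      ext q; simp [hR]
    rw [e, hk', l2inner_compIsometry, l2inner_kernel_of_mem B _ (compIsometry_mem hf _),
      ← e, compIsometry_apply, hR]
  have e2 : l2inner (B.kernel n r) k' = B.kernel n r s := key _ (B.kernel_mem n r)
  have e3 : k' r = starRingEnd ℂ (B.kernel n r s) := by
    rw [← e2, l2inner_conj, l2inner_kernel_of_mem B _ hk]
  rw [kernel_conj] at e3
  exact e3

end HarmonicBasis

/-! ### Reflections and zonality of the reproducing kernel -/

/-- The reflection exchanging two points of the sphere. -/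
def swapReflection (r q : Sphere m) : Ambient m ≃ₗᵢ[ℝ] Ambient m :=
  (Submodule.span ℝ {(r : Ambient m) - (q : Ambient m)})ᗮ.reflection

theorem swapReflection_left (r q : Sphere m) : sphereMap (swapReflection r q) r = q :=
  Subtype.ext (Submodule.reflection_sub (by simp))

theorem swapReflection_fixed {r q s : Sphere m}
    (h : inner ℝ (r : Ambient m) (s : Ambient m) = inner ℝ (q : Ambient m) (s : Ambient m)) :
    sphereMap (swapReflection r q) s = s := by
  refine Subtype.ext (Submodule.reflection_mem_subspace_eq_self ?_)
  rw [Submodule.mem_orthogonal_singleton_iff_inner_right, inner_sub_left, h, sub_self]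

namespace HarmonicBasis

variable (B : HarmonicBasis m)

/-- When `r - q` is orthogonal to `s`, the reflection exchanging `r` and `q` fixes `s`; invariance
of the kernel does the rest. -/
theorem kernel_eq_of_inner_eq (n : ℕ) {r q s : Sphere m}
    (h : inner ℝ (r : Ambient m) (s : Ambient m) = inner ℝ (q : Ambient m) (s : Ambient m)) :
    B.kernel n s r = B.kernel n s q := by
  rw [← B.kernel_sphereMap n (swapReflection r q) s r, swapReflection_left,
    swapReflection_fixed h]

theorem kernel_self (n : ℕ) (r q : Sphere m) : B.kernel n r r = B.kernel n q q := by
  rw [← B.kernel_sphereMap n (swapReflection r q), swapReflection_left]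

/-- The diagonal is constant by invariance, and its integral is the number of orthonormal basis
functions. -/
theorem kernel_self_eq (n : ℕ) (r : Sphere m) :
    B.kernel n r r = ((harmDim m n / area m : ℝ) : ℂ) := by
  have h1 : ∫ q, B.kernel n q q ∂(surface m) = harmDim m n := by
    simp only [kernel_apply, mul_comm (starRingEnd ℂ _)]
    rw [integral_finsetSum _ fun k _ => integrable_l2 _ _]
    have : ∀ k, ∫ q, B.Y n k q * starRingEnd ℂ (B.Y n k q) ∂(surface m) = 1 := fun k => by
      have := B.orthonormal n k k
      rwa [if_pos rfl] at this
    simp [this]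
  simp_rw [B.kernel_self n _ r] at h1
  rw [integral_const, Complex.real_smul] at h1
  have ha : (area m : ℂ) ≠ 0 := by exact_mod_cast (area_pos m).ne'
  push_cast
  rw [eq_div_iff ha, mul_comm]
  exact h1

end HarmonicBasis

/-! ### The addition theorem -/

theorem exists_orthogonal_unit (hm : 1 ≤ m) (s : Sphere m) :
    ∃ e : Ambient m, ‖e‖ = 1 ∧ inner ℝ e (s : Ambient m) = 0 := by
  have : Fact (Module.finrank ℝ (Ambient m) = m + 1) := ⟨finrank_euclideanSpace_fin⟩
  have h1 : Module.finrank ℝ (Submodule.span ℝ {(s : Ambient m)})ᗮ = m :=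
    Submodule.finrank_orthogonal_span_singleton (sphere_ne_zero s)
  have h2 : Nontrivial (Submodule.span ℝ {(s : Ambient m)})ᗮ :=
    Module.nontrivial_of_finrank_pos (R := ℝ) (by omega)
  obtain ⟨e, he⟩ := exists_norm_eq (Submodule.span ℝ {(s : Ambient m)})ᗮ (c := 1) zero_le_one
  refine ⟨e, by simpa using he, ?_⟩
  have := Submodule.mem_orthogonal_singleton_iff_inner_right.mp e.2
  rwa [real_inner_comm]

/-- A smooth zonal function that is orthogonal to all polynomial zonal functions vanishes. -/
theorem eq_zero_of_zonal (hm : 1 ≤ m) {d : TestFun m} {s : Sphere m}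
    (hz : ∀ r q : Sphere m, inner ℝ (r : Ambient m) (s : Ambient m) =
      inner ℝ (q : Ambient m) (s : Ambient m) → d r = d q)
    (ho : ∀ p : ℝ[X], l2inner d (zonal p s) = 0) : d = 0 := by
  obtain ⟨e, he, hes⟩ := exists_orthogonal_unit hm s
  have hs : ‖(s : Ambient m)‖ = 1 := by simp
  -- A meridian: `x t` is a unit vector with `⟨x t, s⟩ = t` for `t ∈ [-1, 1]`. Along it `d` becomes
  -- a continuous function `g` of the height `t`, to which Weierstrass approximation applies.
  let x : ℝ → Ambient m := fun t => t • (s : Ambient m) + √(1 - t ^ 2) • e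
  have hx : ∀ t ∈ Set.Icc (-1 : ℝ) 1, ‖x t‖ = 1 := by
    intro t ht
    have h0 : 0 ≤ 1 - t ^ 2 := by nlinarith [ht.1, ht.2]
    have : ‖x t‖ ^ 2 = 1 := by
      simp only [x]
      rw [norm_add_sq_real, norm_smul, norm_smul, hs, he, real_inner_smul_left,
        real_inner_smul_right, real_inner_comm, hes, mul_one, mul_one, Real.norm_eq_abs,
        Real.norm_eq_abs, sq_abs, sq_abs, Real.sq_sqrt h0]
      ring
    rw [← Real.sqrt_sq (norm_nonneg (x t)), this, Real.sqrt_one]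
  have hxc : Continuous x := by fun_prop
  let g : ℝ → ℂ := fun t => radialExt d (x t)
  have hg : ContinuousOn g (Set.Icc (-1) 1) := fun t ht => by
    have h0 : x t ≠ 0 := fun h => by simpa [h] using hx t ht
    exact ((d.contDiffAt_two_radialExt h0).continuousAt.comp hxc.continuousAt).continuousWithinAt
  have hin : ∀ r : Sphere m, inner ℝ (r : Ambient m) (s : Ambient m) ∈ Set.Icc (-1 : ℝ) 1 := by
    intro r
    have := abs_real_inner_le_norm (r : Ambient m) (s : Ambient m)
    rw [hs, norm_eq_of_mem_sphere, mul_one] at this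
    exact abs_le.mp this
  have hdg : ∀ r : Sphere m, d r = g (inner ℝ (r : Ambient m) (s : Ambient m)) := by
    intro r
    set t : ℝ := inner ℝ (r : Ambient m) (s : Ambient m) with ht
    have hxt : x t ∈ Metric.sphere (0 : Ambient m) 1 := by
      rw [mem_sphere_zero_iff_norm]; exact hx t (hin r)
    have : g t = d ⟨x t, hxt⟩ := radialExt_coe d ⟨x t, hxt⟩
    rw [this]
    refine hz _ _ ?_
    simp only [x]
    rw [inner_add_left, real_inner_smul_left, real_inner_smul_left, hes,
      real_inner_self_eq_norm_sq, hs]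
    simp [ht]
  -- Real and imaginary parts are each approximated within `η`, whence `2 * η`. Subtracting the
  -- approximant, which is orthogonal to `d`, does not change `⟨d, d⟩`.
  have key : ∀ η : ℝ, 0 < η → ‖l2inner d d‖ ≤ (∫ r, ‖d r‖ ∂(surface m)) * (2 * η) := by
    intro η hη
    obtain ⟨p, hp⟩ := exists_polynomial_near_of_continuousOn (-1) 1 (fun t => (g t).re)
      (Complex.continuous_re.comp_continuousOn hg) η hη
    obtain ⟨q, hq⟩ := exists_polynomial_near_of_continuousOn (-1) 1 (fun t => (g t).im)
      (Complex.continuous_im.comp_continuousOn hg) η hη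
    set a : TestFun m := zonal p s + Complex.I • zonal q s with ha
    have hda : l2inner d a = 0 := by
      rw [← l2inner_conj, ha, l2inner_add_left, l2inner_smul_left, ← l2inner_conj, ho,
        ← l2inner_conj, ho]
      simp
    have hnear : ∀ r, ‖d r - a r‖ ≤ 2 * η := by
      intro r
      set t : ℝ := inner ℝ (r : Ambient m) (s : Ambient m) with ht
      have e1 : d r - a r = (((g t).re - p.eval t : ℝ) : ℂ) +
          (((g t).im - q.eval t : ℝ) : ℂ) * Complex.I := by
        rw [ha, TestFun.add_apply, TestFun.smul_apply, zonal_apply, zonal_apply, hdg r, ← ht]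
        conv_lhs => rw [← Complex.re_add_im (g t)]
        push_cast
        ring
      rw [e1]
      refine (norm_add_le _ _).trans ?_
      rw [norm_mul, Complex.norm_I, mul_one, Complex.norm_real, Complex.norm_real,
        Real.norm_eq_abs, Real.norm_eq_abs, abs_sub_comm, abs_sub_comm (g t).im]
      linarith [hp t (hin r), hq t (hin r)]
    have e2 : l2inner d d = ∫ r, d r * starRingEnd ℂ (d r - a r) ∂(surface m) := by
      rw [← sub_zero (l2inner d d), ← hda, l2inner, l2inner,
        ← integral_sub (integrable_l2 _ _) (integrable_l2 _ _)]
      refine integral_congr_ae (ae_of_all _ fun r => ?_)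
      simp only [map_sub]
      ring
    rw [e2, ← integral_mul_const]
    refine norm_integral_le_of_norm_le ?_ (ae_of_all _ fun r => ?_)
    · exact (integrable_of_continuous d.continuous.norm).mul_const _
    · rw [norm_mul, RCLike.norm_conj]
      exact mul_le_mul_of_nonneg_left (hnear r) (norm_nonneg _)
  refine eq_zero_of_l2inner_self (norm_eq_zero.mp (le_antisymm ?_ (norm_nonneg _)))
  set I := ∫ r, ‖d r‖ ∂(surface m) with hI
  have hlim : Tendsto (fun η : ℝ => I * (2 * η)) (𝓝[>] 0) (𝓝 0) := by
    have : Continuous fun η : ℝ => I * (2 * η) := by fun_prop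
    simpa using (this.tendsto 0).mono_left nhdsWithin_le_nhds
  exact ge_of_tendsto hlim (eventually_mem_nhdsWithin.mono fun η hη => key η hη)

theorem ultraPoly_eval_one (hm : 1 ≤ m) : ∀ n, (ultraPoly m n).eval 1 = 1
  | 0 => by simp [ultraPoly]
  | 1 => by simp [ultraPoly]
  | n + 2 => by
    have h := congrArg (eval 1) (ultraPoly_rec hm n)
    have h0 : (n + m : ℝ) ≠ 0 := by positivity
    simp only [eval_mul, eval_add, eval_sub, eval_natCast, eval_X, eval_one, eval_ofNat,
      ultraPoly_eval_one hm (n + 1), ultraPoly_eval_one hm n] at h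
    apply mul_left_cancel₀ h0
    rw [h]
    ring

theorem zonal_ultraPoly_self (hm : 1 ≤ m) (n : ℕ) (s : Sphere m) :
    zonal (ultraPoly m n) s s = 1 := by
  rw [zonal_apply, real_inner_self_eq_norm_sq]
  simp [ultraPoly_eval_one hm]

namespace HarmonicBasis

variable (B : HarmonicBasis m)

/-- The addition theorem for spherical harmonics. -/
theorem kernel_eq (hm : 1 ≤ m) (n : ℕ) (s : Sphere m) :
    B.kernel n s = ((harmDim m n / area m : ℝ) : ℂ) • zonal (ultraPoly m n) s := by
  set P := zonal (ultraPoly m n) s with hP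
  have hPm : P ∈ Harm m n := zonal_ultraPoly_mem hm n s
  have hPs : P s = 1 := zonal_ultraPoly_self hm n s
  have hPP : l2inner P P ≠ 0 := by
    intro h
    rw [eq_zero_of_l2inner_self h] at hPs
    exact zero_ne_one hPs
  have hKP : l2inner (B.kernel n s) P = 1 := by
    rw [← l2inner_conj, B.l2inner_kernel_of_mem s hPm, hPs, map_one]
  -- This `c` makes the difference orthogonal to `P`; orthogonality to every other `P_k` comes from
  -- the eigenvalues. The difference is zonal and orthogonal to all polynomial zonal functions,
  -- hence zero.
  set c : ℂ := (l2inner P P)⁻¹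
  have hd : B.kernel n s - c • P = 0 := by
    have hdm : B.kernel n s - c • P ∈ Harm m n :=
      Submodule.sub_mem _ (B.kernel_mem n s) (Submodule.smul_mem _ _ hPm)
    refine eq_zero_of_zonal (s := s) hm (fun r q h => ?_) fun p => ?_
    · change B.kernel n s r - c * P r = B.kernel n s q - c * P q
      rw [B.kernel_eq_of_inner_eq n h, hP, zonal_apply, zonal_apply, h]
    · induction mem_span_ultraPoly hm p using Submodule.span_induction with
      | mem q hq =>
        obtain ⟨k, rfl⟩ := hq
        rcases eq_or_ne n k with rfl | hnk
        · rw [l2inner_sub_left, l2inner_smul_left, hKP, inv_mul_cancel₀ hPP, sub_self]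
        · exact l2inner_eq_zero_of_ne hm hnk hdm (zonal_ultraPoly_mem hm k s)
      | zero =>
        have : zonal (0 : ℝ[X]) s = 0 := by
          ext r
          simp only [zonal_apply, eval_zero, Complex.ofReal_zero]
          rfl
        rw [this, ← l2inner_conj]
        have := map_zero (l2left (B.kernel n s - c • P))
        rw [show l2inner 0 (B.kernel n s - c • P) = 0 from this, map_zero]
      | add a b _ _ ha hb =>
        rw [zonal_add, ← l2inner_conj, l2inner_add_left, map_add, l2inner_conj, l2inner_conj, ha,
          hb, add_zero]
      | smul t a _ ha => rw [zonal_smul, l2inner_smul_right, ha, mul_zero]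
  -- Evaluation at the pole, where `P` is `1`, identifies `c` with the diagonal value of the kernel.
  have hc : c = ((harmDim m n / area m : ℝ) : ℂ) := by
    rw [← B.kernel_self_eq n s, sub_eq_zero.mp hd, TestFun.smul_apply, hPs, mul_one]
  rw [← hc]
  exact sub_eq_zero.mp hd

theorem kernel_apply_eq (hm : 1 ≤ m) (n : ℕ) (s r : Sphere m) :
    B.kernel n s r = ((harmDim m n / area m *
      ultraspherical m n (inner ℝ (r : Ambient m) (s : Ambient m)) : ℝ) : ℂ) := by
  rw [B.kernel_eq hm, TestFun.smul_apply, zonal_apply, eval_ultraPoly, Complex.ofReal_mul]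

/-- The arithmetic-geometric mean inequality reduces to the diagonal, whose value is known. -/
theorem norm_kernel_le (n : ℕ) (s r : Sphere m) :
    ‖B.kernel n s r‖ ≤ harmDim m n / area m := by
  have hself : ∀ q : Sphere m, ∑ k, ‖B.Y n k q‖ ^ 2 = harmDim m n / area m := by
    intro q
    have := B.kernel_self_eq n q
    rw [kernel_apply] at this
    have e : ∀ k, starRingEnd ℂ (B.Y n k q) * B.Y n k q = ((‖B.Y n k q‖ ^ 2 : ℝ) : ℂ) := fun k => by
      rw [mul_comm, Complex.mul_conj, Complex.normSq_eq_norm_sq]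
    simp_rw [e] at this
    exact_mod_cast this
  rw [kernel_apply]
  refine (norm_sum_le _ _).trans ?_
  have h1 : ∀ k, ‖starRingEnd ℂ (B.Y n k s) * B.Y n k r‖ ≤
      (‖B.Y n k s‖ ^ 2 + ‖B.Y n k r‖ ^ 2) / 2 := fun k => by
    rw [norm_mul, RCLike.norm_conj]
    nlinarith [sq_nonneg (‖B.Y n k s‖ - ‖B.Y n k r‖)]
  refine (Finset.sum_le_sum fun k _ => h1 k).trans ?_
  rw [← Finset.sum_div, Finset.sum_add_distrib, hself, hself]
  linarith

end HarmonicBasis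

/-! ### Growth of the dimension of the spaces of harmonics -/

/-- Integration of a polynomial zonal function. -/
def zonalIntegral (s : Sphere m) : ℝ[X] →ₗ[ℝ] ℝ where
  toFun p := ∫ r : Sphere m, p.eval (inner ℝ (r : Ambient m) (s : Ambient m)) ∂(surface m)
  map_add' p q := by
    simp only [eval_add]
    exact integral_add (integrable_of_continuous (by fun_prop))
      (integrable_of_continuous (by fun_prop))
  map_smul' c p := by
    simp only [eval_smul, smul_eq_mul, integral_const_mul, RingHom.id_apply]

theorem ofReal_zonalIntegral_mul (s : Sphere m) (p q : ℝ[X]) :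
    ((zonalIntegral s (p * q) : ℝ) : ℂ) = l2inner (zonal p s) (zonal q s) := by
  change ((∫ r : Sphere m, _ ∂(surface m) : ℝ) : ℂ) = _
  rw [← integral_complex_ofReal, l2inner]
  refine integral_congr_ae (ae_of_all _ fun r => ?_)
  simp only [zonal_apply, eval_mul, Complex.ofReal_mul, Complex.conj_ofReal]

theorem zonalIntegral_ultraPoly_of_ne (hm : 1 ≤ m) (s : Sphere m) {n k : ℕ} (h : n ≠ k) :
    zonalIntegral s (ultraPoly m n * ultraPoly m k) = 0 := by
  have := ofReal_zonalIntegral_mul s (ultraPoly m n) (ultraPoly m k)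
  rw [l2inner_eq_zero_of_ne hm h (zonal_ultraPoly_mem hm n s) (zonal_ultraPoly_mem hm k s)] at this
  exact_mod_cast this

/-- The reproducing property applied to `P_n` at its own pole. It expresses the dimension by the
norm of `P_n`, so the three-term recurrence determines the ratios of dimensions. -/
theorem HarmonicBasis.harmDim_mul_zonalIntegral (B : HarmonicBasis m) (hm : 1 ≤ m) (s : Sphere m)
    (n : ℕ) : (harmDim m n : ℝ) * zonalIntegral s (ultraPoly m n * ultraPoly m n) = area m := by
  have h1 := B.l2inner_kernel_of_mem s (zonal_ultraPoly_mem hm n s)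
  rw [B.kernel_eq hm, l2inner_smul_right, zonal_ultraPoly_self hm, ← ofReal_zonalIntegral_mul,
    Complex.conj_ofReal] at h1
  have h2 : harmDim m n / area m * zonalIntegral s (ultraPoly m n * ultraPoly m n) = 1 := by
    exact_mod_cast h1
  have := (area_pos m).ne'
  field_simp at h2
  exact h2

theorem zonalIntegral_natCast_mul (s : Sphere m) (c : ℕ) (p : ℝ[X]) :
    zonalIntegral s ((c : ℝ[X]) * p) = c * zonalIntegral s p := by
  rw [← nsmul_eq_mul, map_nsmul, nsmul_eq_mul]

/-- The integral of `t P_{n+1} P_{n+2}` is computed twice, from the recurrences for `P_{n+2}` and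
for `P_{n+3}`; orthogonality leaves one squared norm each time. -/
theorem zonalIntegral_recurrence (hm : 1 ≤ m) (s : Sphere m) (n : ℕ) :
    ((n + m) * (2 * n + m + 3) : ℝ) *
        zonalIntegral s (ultraPoly m (n + 2) * ultraPoly m (n + 2)) =
      ((2 * n + m + 1) * (n + 2) : ℝ) *
        zonalIntegral s (ultraPoly m (n + 1) * ultraPoly m (n + 1)) := by
  have h1 := congrArg (fun p => zonalIntegral s (p * ultraPoly m (n + 2))) (ultraPoly_rec hm n)
  have h2 := congrArg (fun p => zonalIntegral s (p * ultraPoly m (n + 1)))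
    (ultraPoly_rec hm (n + 1))
  set A := zonalIntegral s (X * ultraPoly m (n + 1) * ultraPoly m (n + 2)) with hA
  have e1 : ((n + m : ℕ) : ℝ) * zonalIntegral s (ultraPoly m (n + 2) * ultraPoly m (n + 2)) =
      ((2 * n + m + 1 : ℕ) : ℝ) * A := by
    rw [hA, ← zonalIntegral_natCast_mul, ← zonalIntegral_natCast_mul, ← mul_assoc, Nat.cast_add,
      h1, sub_mul, map_sub, mul_assoc (n + 1 : ℝ[X]),
      show (n + 1 : ℝ[X]) = ((n + 1 : ℕ) : ℝ[X]) by push_cast; rfl, zonalIntegral_natCast_mul,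
      zonalIntegral_ultraPoly_of_ne hm s (by omega), mul_zero, sub_zero]
    congr 1
    push_cast
    ring
  have e2 : 0 = ((2 * n + m + 3 : ℕ) : ℝ) * A -
      ((n + 2 : ℕ) : ℝ) * zonalIntegral s (ultraPoly m (n + 1) * ultraPoly m (n + 1)) := by
    rw [hA, ← zonalIntegral_natCast_mul, ← zonalIntegral_natCast_mul, ← map_sub]
    have h3 : zonalIntegral s (((n + 1 : ℕ) + m : ℝ[X]) * ultraPoly m (n + 1 + 2) *
        ultraPoly m (n + 1)) = 0 := by
      rw [mul_assoc, ← Nat.cast_add, zonalIntegral_natCast_mul,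
        zonalIntegral_ultraPoly_of_ne hm s (by omega), mul_zero]
    rw [← h3]
    refine h2.trans ?_
    congr 1
    push_cast
    ring
  push_cast at e1 e2
  linear_combination (2 * n + m + 3 : ℝ) * e1 - (2 * n + m + 1 : ℝ) * e2

theorem HarmonicBasis.harmDim_recurrence (B : HarmonicBasis m) (hm : 1 ≤ m) (n : ℕ) :
    (harmDim m (n + 2) : ℝ) * ((2 * n + m + 1) * (n + 2)) =
      harmDim m (n + 1) * ((n + m) * (2 * n + m + 3)) := by
  let s : Sphere m := TestFun.normalize (EuclideanSpace.single 0 1) (by simp)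
  have h := zonalIntegral_recurrence hm s n
  have h1 := B.harmDim_mul_zonalIntegral hm s (n + 1)
  have h2 := B.harmDim_mul_zonalIntegral hm s (n + 2)
  apply mul_left_cancel₀ (area_pos m).ne'
  linear_combination (-(harmDim m (n + 1) : ℝ) * harmDim m (n + 2)) * h
    + (harmDim m (n + 1) * ((n + m) * (2 * n + m + 3)) : ℝ) * h2
    - (harmDim m (n + 2) * ((2 * n + m + 1) * (n + 2)) : ℝ) * h1

/-- By `harmDim_recurrence`, this bounds the quotient of dimensions of orders `n + 2` and `n + 1` by
`((n+2)/(n+1))^(m-1)`, the quotient for the comparison sequence. For `m ≥ 2` the core is Bernoulli's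
inequality. -/
theorem growth_step (hm : 1 ≤ m) (n : ℕ) :
    ((n + m) * (2 * n + m + 3) : ℝ) * (n + 1) ^ (m - 1) ≤
      ((2 * n + m + 1) * (n + 2)) * (n + 2) ^ (m - 1) := by
  obtain rfl | ⟨j, rfl⟩ : m = 1 ∨ ∃ j, m = j + 2 := by
    rcases eq_or_ne m 1 with h | h
    · exact Or.inl h
    · exact Or.inr ⟨m - 2, by omega⟩
  · simp; nlinarith
  · have hn : (0 : ℝ) < n + 1 := by positivity
    have b1 : (n + j + 2 : ℝ) * (n + 1) ^ j ≤ (n + 2) ^ (j + 1) := by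
      have hb := one_add_mul_le_pow (a := (n + 1 : ℝ)⁻¹) (by have := inv_pos.mpr hn; linarith) j
      have e : (1 + (n + 1 : ℝ)⁻¹) = (n + 2) / (n + 1) := by field_simp; ring
      rw [e, div_pow, le_div_iff₀ (by positivity)] at hb
      have hp : (n + 1 : ℝ) ^ j ≤ (n + 2) ^ j := by gcongr; norm_num
      have hb2 : (n + 1 + j : ℝ) * (n + 1) ^ j ≤ (n + 1) * (n + 2) ^ j := by
        calc (n + 1 + j : ℝ) * (n + 1) ^ j
            = (n + 1) * ((1 + j * (n + 1 : ℝ)⁻¹) * (n + 1) ^ j) := by field_simp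
          _ ≤ _ := by gcongr
      calc (n + j + 2 : ℝ) * (n + 1) ^ j = (n + 1 + j : ℝ) * (n + 1) ^ j + (n + 1) ^ j := by ring
        _ ≤ (n + 1) * (n + 2) ^ j + (n + 2) ^ j := by gcongr
        _ = _ := by ring
    have b2 : ((2 * n + j + 5) * (n + 1) : ℝ) ≤ (2 * n + j + 3) * (n + 2) := by
      nlinarith [(Nat.cast_nonneg j : (0 : ℝ) ≤ j)]
    have := mul_le_mul b1 b2 (by positivity) (by positivity)
    rw [show j + 2 - 1 = j + 1 by omega]
    push_cast
    calc _ = (n + j + 2 : ℝ) * (n + 1) ^ j * ((2 * n + j + 5) * (n + 1)) := by ring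
      _ ≤ _ := this
      _ = _ := by ring

theorem HarmonicBasis.harmDim_le (B : HarmonicBasis m) (hm : 1 ≤ m) (n : ℕ) :
    (harmDim m (n + 1) : ℝ) ≤ harmDim m 1 * (n + 1 : ℝ) ^ (m - 1) := by
  induction n with
  | zero => simp
  | succ n ih =>
    have hpos : (0 : ℝ) < (2 * n + m + 1) * (n + 2) := by positivity
    have h := B.harmDim_recurrence hm n
    refine le_of_mul_le_mul_right ?_ hpos
    rw [h]
    have h2 := mul_le_mul_of_nonneg_right ih
      (by positivity : (0 : ℝ) ≤ (n + m) * (2 * n + m + 3))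
    refine h2.trans ?_
    have h3 := mul_le_mul_of_nonneg_left (growth_step hm n)
      (Nat.cast_nonneg (harmDim m 1) : (0 : ℝ) ≤ _)
    push_cast
    rw [show (n + 1 + 1 : ℝ) = n + 2 by ring]
    linarith

/-! ### Resolvents and uniqueness of generalised functions -/

/-- The operator `Id - ε Δ`. -/
def oneSubLaplace (m : ℕ) (ε : ℝ) : TestFun m →ₗ[ℂ] TestFun m :=
  LinearMap.id - (ε : ℂ) • laplaceBeltrami

theorem oneSubLaplace_apply (ε : ℝ) (h : TestFun m) (r : Sphere m) :
    oneSubLaplace m ε h r = h r - ε * laplaceBeltrami h r := by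
  rw [sub_eq_add_neg, ← neg_mul]
  have : oneSubLaplace m ε h = h + (-(ε : ℂ)) • laplaceBeltrami h := by
    simp [oneSubLaplace, sub_eq_add_neg]
  rw [this]
  rfl

theorem oneSubLaplace_of_mem {n : ℕ} {h : TestFun m} (hh : h ∈ Harm m n) (ε : ℝ) (K : ℕ) :
    (oneSubLaplace m ε ^ K) h = ((1 + ε * eig m n : ℝ) : ℂ) ^ K • h := by
  induction K with
  | zero => simp
  | succ K ih =>
    have : oneSubLaplace m ε h = ((1 + ε * eig m n : ℝ) : ℂ) • h := by
      ext r
      rw [oneSubLaplace_apply, laplaceBeltrami_of_mem hh, smul_apply, smul_apply]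
      push_cast
      ring
    rw [pow_succ', Module.End.mul_apply, ih, map_smul, this, smul_smul, ← pow_succ]

theorem norm_le_of_oneSubLaplace_pow {ε : ℝ} (hε : 0 ≤ ε) (K : ℕ) {h : TestFun m} {C : ℝ}
    (hC : ∀ r, ‖(oneSubLaplace m ε ^ K) h r‖ ≤ C) (r : Sphere m) : ‖h r‖ ≤ C := by
  induction K generalizing h r with
  | zero => simpa using hC r
  | succ K ih =>
    refine norm_laplace_max_principle h hε (fun q => ?_) r
    rw [← oneSubLaplace_apply]
    refine ih (fun q => ?_) q
    rw [← Module.End.mul_apply, ← pow_succ]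
    exact hC q

/-- The multiplier `(Id - ε Δ)^{-K}` on a sum of harmonics. -/
def resolvent (ε : ℝ) (K N : ℕ) (φ : ℕ → TestFun m) : TestFun m :=
  ∑ n ∈ Finset.range N, ((((1 + ε * eig m n) ^ K)⁻¹ : ℝ) : ℂ) • φ n

theorem resolvent_mem {ε : ℝ} {K N : ℕ} {φ : ℕ → TestFun m} (hφ : ∀ n, φ n ∈ Harm m n) :
    resolvent ε K N φ ∈ harmonics m :=
  Submodule.sum_mem _ fun n _ => Submodule.smul_mem _ _ (mem_harmonics (hφ n))

theorem oneSubLaplace_resolvent (hm : 1 ≤ m) {ε : ℝ} (hε : 0 ≤ ε) (K N : ℕ) {φ : ℕ → TestFun m}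
    (hφ : ∀ n, φ n ∈ Harm m n) :
    (oneSubLaplace m ε ^ K) (resolvent ε K N φ) = ∑ n ∈ Finset.range N, φ n := by
  rw [resolvent, map_sum]
  refine Finset.sum_congr rfl fun n _ => ?_
  have h0 : (1 + ε * eig m n) ^ K ≠ 0 := by
    have := mul_nonneg hε (eig_nonneg hm n)
    positivity
  rw [map_smul, oneSubLaplace_of_mem (hφ n), smul_smul, ← Complex.ofReal_pow,
    ← Complex.ofReal_mul, inv_mul_cancel₀ h0, Complex.ofReal_one, one_smul]

theorem norm_resolvent_le (hm : 1 ≤ m) {ε : ℝ} (hε : 0 ≤ ε) (K N : ℕ) {φ : ℕ → TestFun m}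
    (hφ : ∀ n, φ n ∈ Harm m n) {C : ℝ} (hC : ∀ r, ‖(∑ n ∈ Finset.range N, φ n) r‖ ≤ C)
    (r : Sphere m) : ‖resolvent ε K N φ r‖ ≤ C := by
  refine norm_le_of_oneSubLaplace_pow hε K (fun q => ?_) r
  rw [oneSubLaplace_resolvent hm hε K N hφ]
  exact hC q

/-- By the maximum principle the norms increase with their index, so the finite supremum in a
continuity bound is controlled by one norm of large order. -/
theorem seminormFamily_le_of_forall {K : ℕ} {φ : TestFun m} {C : ℝ} (hC0 : 0 ≤ C)
    (hC : ∀ r, ‖(oneSubLaplace m 1 ^ K) φ r‖ ≤ C) {k : ℕ} (hk : k ≤ K) :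
    seminormFamily m k φ ≤ C := by
  have e : oneSubLaplace m 1 = LinearMap.id - laplaceBeltrami := by
    simp [oneSubLaplace]
  change ‖toContₗ (((LinearMap.id - laplaceBeltrami : TestFun m →ₗ[ℂ] TestFun m) ^ k) φ)‖ ≤ C
  rw [← e, ContinuousMap.norm_le _ hC0]
  refine fun r => norm_le_of_oneSubLaplace_pow zero_le_one (K - k) (fun q => ?_) r
  rw [← Module.End.mul_apply, ← pow_add, Nat.sub_add_cancel hk]
  exact hC q

/-- A generalised function is determined by its values on spherical harmonics. -/
theorem genFun_eq_zero (hm : 1 ≤ m) (u : GenFun m) (hu : ∀ n, ∀ h ∈ Harm m n, u h = 0) :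
    u = 0 := by
  obtain ⟨S, C, hC, hb⟩ := Seminorm.bound_of_continuous (TestFun.withSeminorms m)
    ((normSeminorm ℂ ℂ).comp (u : TestFun m →ₗ[ℂ] ℂ)) (continuous_norm.comp u.continuous)
  -- The largest order among the finitely many norms that bound `u`.
  set K := S.sup id
  have hu' : ∀ h ∈ harmonics m, u h = 0 := by
    intro h hh
    obtain ⟨N, φ, hφ, rfl⟩ := exists_sum_of_mem_harmonics hh
    rw [map_sum]
    exact Finset.sum_eq_zero fun n _ => hu n _ (hφ n)
  ext φ
  -- The function approximated uniformly by harmonics is `(Id - Δ)^K φ`; the resolvent carries the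
  -- approximant back to a harmonic sum `χ`, on which `u` vanishes and which is close to `φ` in the
  -- relevant norms.
  have key : ∀ η : ℝ, 0 < η → ‖u φ‖ ≤ C * η := by
    intro η hη
    obtain ⟨g, hg, hgn⟩ := exists_harmonics_near hm (toContₗ ((oneSubLaplace m 1 ^ K) φ)) hη
    obtain ⟨N, ψ, hψ, rfl⟩ := exists_sum_of_mem_harmonics hg
    set χ := resolvent 1 K N ψ
    have h1 : u φ = u (φ - χ) := by rw [map_sub, hu' χ (resolvent_mem hψ), sub_zero]
    have h2 : ∀ r, ‖(oneSubLaplace m 1 ^ K) (φ - χ) r‖ ≤ η := by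
      intro r
      rw [map_sub, oneSubLaplace_resolvent hm zero_le_one K N hψ]
      exact (hgn r).le
    rw [h1]
    refine (hb (φ - χ)).trans ?_
    rw [_root_.smul_apply, NNReal.smul_def, smul_eq_mul]
    refine mul_le_mul_of_nonneg_left ?_ C.2
    refine Seminorm.finset_sup_apply_le hη.le fun k hk => ?_
    exact seminormFamily_le_of_forall hη.le h2 (Finset.le_sup (f := id) hk)
  have hlim : Tendsto (fun η : ℝ => C * η) (𝓝[>] 0) (𝓝 0) := by
    have : Continuous fun η : ℝ => C * η := by fun_prop
    simpa using (this.tendsto 0).mono_left nhdsWithin_le_nhds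
  exact norm_eq_zero.mp (le_antisymm (ge_of_tendsto hlim
    (eventually_mem_nhdsWithin.mono fun η hη => key η hη)) (norm_nonneg _))

/-! ### Summation of series by monotone weights -/

/-- Abel's inequality. -/
theorem norm_sum_mul_le_of_antitone {w : ℕ → ℝ} (hw : Antitone w) (hw0 : ∀ n, 0 ≤ w n)
    {g : ℕ → ℂ} {δ : ℝ} (hg : ∀ n, ‖∑ i ∈ Finset.range n, g i‖ ≤ δ) (n : ℕ) :
    ‖∑ i ∈ Finset.range n, w i • g i‖ ≤ δ * w 0 := by
  have hδ : 0 ≤ δ := (norm_nonneg _).trans (hg 0)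
  rw [Finset.sum_range_by_parts]
  refine (norm_sub_le _ _).trans ?_
  have h1 : ‖w (n - 1) • ∑ i ∈ Finset.range n, g i‖ ≤ w (n - 1) * δ := by
    rw [norm_smul, Real.norm_eq_abs, abs_of_nonneg (hw0 _)]
    exact mul_le_mul_of_nonneg_left (hg n) (hw0 _)
  -- Monotonicity gives the increments of `w` a sign, so after bounding the partial sums the series
  -- telescopes.
  have h2 : ‖∑ i ∈ Finset.range (n - 1), (w (i + 1) - w i) • ∑ j ∈ Finset.range (i + 1), g j‖ ≤
      ∑ i ∈ Finset.range (n - 1), (w i - w (i + 1)) * δ := by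
    refine (norm_sum_le _ _).trans (Finset.sum_le_sum fun i _ => ?_)
    have := hw (Nat.le_succ i)
    rw [norm_smul, Real.norm_eq_abs, abs_sub_comm, abs_of_nonneg (sub_nonneg.mpr this)]
    exact mul_le_mul_of_nonneg_left (hg _) (sub_nonneg.mpr this)
  rw [← Finset.sum_mul, Finset.sum_range_sub'] at h2
  linarith

/-- Summation by monotone weights that converge to `1` is regular. -/
theorem tendsto_tsum_weights {a : ℕ → ℂ} {A : ℂ}
    (hA : Tendsto (fun N => ∑ n ∈ Finset.range N, a n) atTop (𝓝 A)) {w : ℕ → ℕ → ℝ}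
    (hw : ∀ j, Antitone (w j)) (hw0 : ∀ j n, 0 ≤ w j n) (hw1 : ∀ j n, w j n ≤ 1)
    (hlim : ∀ n, Tendsto (fun j => w j n) atTop (𝓝 1)) (hs : ∀ j, Summable fun n => w j n • a n) :
    Tendsto (fun j => ∑' n, w j n • a n) atTop (𝓝 A) := by
  rw [Metric.tendsto_atTop]
  intro ε hε
  obtain ⟨M, hM⟩ := Metric.tendsto_atTop.mp hA (ε / 8) (by positivity)
  -- Two partial sums within `ε / 8` of `A` differ by at most `ε / 4`; Abel's inequality then bounds
  -- the weighted tails uniformly in `j`.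
  have htail : ∀ n, ‖∑ i ∈ Finset.range n, a (i + M)‖ ≤ ε / 4 := by
    intro n
    have e : ∑ i ∈ Finset.range n, a (i + M) =
        ∑ i ∈ Finset.range (M + n), a i - ∑ i ∈ Finset.range M, a i := by
      rw [Finset.sum_range_add, add_sub_cancel_left]
      exact Finset.sum_congr rfl fun i _ => by rw [add_comm]
    rw [e, ← dist_eq_norm]
    have h1 := hM (M + n) (by omega)
    have h2 := hM M le_rfl
    linarith [dist_triangle_right (∑ i ∈ Finset.range (M + n), a i) (∑ i ∈ Finset.range M, a i) A]
  have hhead : Tendsto (fun j => ∑ n ∈ Finset.range M, w j n • a n) atTop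
      (𝓝 (∑ n ∈ Finset.range M, a n)) := by
    refine tendsto_finsetSum _ fun n _ => ?_
    simpa using (hlim n).smul_const (a n)
  obtain ⟨J, hJ⟩ := Metric.tendsto_atTop.mp hhead (ε / 4) (by positivity)
  refine ⟨J, fun j hj => ?_⟩
  have hsum := (hs j).sum_add_tsum_nat_add M
  have ht : ‖∑' n, w j (n + M) • a (n + M)‖ ≤ ε / 4 := by
    refine le_of_tendsto ((summable_nat_add_iff M).mpr (hs j)).hasSum.tendsto_sum_nat.norm
      (Eventually.of_forall fun n => ?_)
    refine (norm_sum_mul_le_of_antitone (w := fun n => w j (n + M)) (g := fun n => a (n + M))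
      (fun x y hxy => hw j (by omega)) (fun n => hw0 j _) htail n).trans ?_
    have := hw1 j (0 + M)
    have : ε / 4 * w j (0 + M) ≤ ε / 4 * 1 := by gcongr
    linarith
  rw [← hsum, dist_eq_norm]
  have h1 := hJ j hj
  have h2 := hM M le_rfl
  rw [dist_eq_norm] at h1 h2
  calc ‖∑ n ∈ Finset.range M, w j n • a n + ∑' n, w j (n + M) • a (n + M) - A‖
      = ‖(∑ n ∈ Finset.range M, w j n • a n - ∑ n ∈ Finset.range M, a n) +
        (∑ n ∈ Finset.range M, a n - A) + ∑' n, w j (n + M) • a (n + M)‖ := by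
        congr 1; ring
    _ ≤ _ := norm_add₃_le
    _ < ε := by linarith

/-! ### Duality with spherical harmonics -/

/-- Duality between `L¹` and the sup norm. The test function is `conj G / (‖G‖ + δ)`, a continuous
substitute for the conjugate phase of `G`, approximated uniformly by harmonics. -/
theorem integral_norm_le_of_harmonics (hm : 1 ≤ m) {G : Sphere m → ℂ} (hG : Continuous G) {η : ℝ}
    (h : ∀ φ ∈ harmonics m, ∀ C : ℝ, (∀ r, ‖φ r‖ ≤ C) →
      ‖∫ r, G r * φ r ∂(surface m)‖ ≤ η * C) : ∫ r, ‖G r‖ ∂(surface m) ≤ η := by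
  set I := ∫ r, ‖G r‖ ∂(surface m) with hI
  have hGi : Integrable (fun r => ‖G r‖) (surface m) := integrable_of_continuous hG.norm
  have key : ∀ δ : ℝ, 0 < δ → I ≤ η * (1 + δ) + I * δ + area m * δ := by
    intro δ hδ
    have hpos : ∀ r, 0 < ‖G r‖ + δ := fun r => by positivity
    have hχc : Continuous fun r => starRingEnd ℂ (G r) / ((‖G r‖ + δ : ℝ) : ℂ) := by
      refine (Complex.continuous_conj.comp hG).div (by fun_prop) fun r => ?_
      exact_mod_cast (hpos r).ne'
    obtain ⟨φ, hφ, hn⟩ := exists_harmonics_near hm ⟨_, hχc⟩ hδ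
    simp only [ContinuousMap.coe_mk] at hn
    set χ : Sphere m → ℂ := fun r => starRingEnd ℂ (G r) / ((‖G r‖ + δ : ℝ) : ℂ) with hχ
    have hχ1 : ∀ r, ‖χ r‖ ≤ 1 := by
      intro r
      rw [hχ]
      simp only [norm_div, RCLike.norm_conj, Complex.norm_real, Real.norm_eq_abs,
        abs_of_pos (hpos r)]
      rw [div_le_one (hpos r)]
      linarith
    have h1 : ‖∫ r, G r * φ r ∂(surface m)‖ ≤ η * (1 + δ) := h φ hφ _ fun r => by
      have := norm_sub_norm_le (φ r) (χ r)
      rw [norm_sub_rev] at this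
      linarith [hχ1 r, hn r]
    have h2 : ‖∫ r, G r * (χ r - φ r) ∂(surface m)‖ ≤ I * δ := by
      rw [hI, ← integral_mul_const]
      refine norm_integral_le_of_norm_le (hGi.mul_const _) (ae_of_all _ fun r => ?_)
      rw [norm_mul]
      exact mul_le_mul_of_nonneg_left (hn r).le (norm_nonneg _)
    -- Uses `‖G‖² / (‖G‖ + δ) ≥ ‖G‖ - δ`.
    have h3 : I - area m * δ ≤ ‖∫ r, G r * χ r ∂(surface m)‖ := by
      have e : ∀ r, G r * χ r = ((‖G r‖ ^ 2 / (‖G r‖ + δ) : ℝ) : ℂ) := fun r => by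
        rw [hχ]
        simp only
        rw [← mul_div_assoc, Complex.mul_conj, Complex.normSq_eq_norm_sq]
        push_cast
        rfl
      simp_rw [e]
      rw [integral_complex_ofReal, Complex.norm_real]
      refine le_trans ?_ (le_abs_self _)
      have e2 : I - area m * δ = ∫ r, (‖G r‖ - δ) ∂(surface m) := by
        rw [integral_sub hGi (integrable_const _), integral_const, smul_eq_mul]
        rfl
      rw [e2]
      refine integral_mono (hGi.sub (integrable_const _)) (integrable_of_continuous ?_) fun r => ?_
      · exact Continuous.div (by fun_prop) (by fun_prop) fun r => (hpos r).ne'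
      · simp only
        rw [le_div_iff₀ (hpos r)]
        nlinarith
    have h4 : ∫ r, G r * χ r ∂(surface m) = ∫ r, G r * φ r ∂(surface m) +
        ∫ r, G r * (χ r - φ r) ∂(surface m) := by
      rw [← integral_add (f := fun r => G r * φ r) (g := fun r => G r * (χ r - φ r))
        (integrable_of_continuous (hG.mul φ.continuous))
        (integrable_of_continuous (hG.mul (hχc.sub φ.continuous)))]
      refine integral_congr_ae (ae_of_all _ fun r => ?_)
      simp only
      ring
    rw [h4] at h3
    linarith [norm_add_le (∫ r, G r * φ r ∂(surface m)) (∫ r, G r * (χ r - φ r) ∂(surface m))]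
  have hlim : Tendsto (fun δ : ℝ => η * (1 + δ) + I * δ + area m * δ) (𝓝[>] 0) (𝓝 η) := by
    have : Continuous fun δ : ℝ => η * (1 + δ) + I * δ + area m * δ := by fun_prop
    simpa using (this.tendsto 0).mono_left nhdsWithin_le_nhds
  exact ge_of_tendsto hlim (eventually_mem_nhdsWithin.mono fun δ hδ => key δ hδ)

theorem exists_harmonics_integral_near (hm : 1 ≤ m) {f : Sphere m → ℂ}
    (hf : Integrable f (surface m)) {η : ℝ} (hη : 0 < η) :
    ∃ g ∈ harmonics m, ∫ r, ‖f r - g r‖ ∂(surface m) ≤ η := by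
  obtain ⟨c, hc, hci⟩ := hf.exists_boundedContinuous_integral_sub_le (half_pos hη)
  obtain ⟨g, hg, hgn⟩ := exists_harmonics_near hm c.toContinuousMap
    (div_pos (half_pos hη) (area_pos m))
  refine ⟨g, hg, ?_⟩
  have h1 : ∫ r, ‖c r - g r‖ ∂(surface m) ≤ η / 2 := by
    refine (integral_mono (integrable_of_continuous (c.continuous.sub g.continuous).norm)
      (integrable_const (η / 2 / area m)) fun r => (hgn r).le).trans ?_
    rw [integral_const, smul_eq_mul]
    change area m * _ ≤ _
    rw [mul_div_cancel₀ _ (area_pos m).ne']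
  have hgi := integrable_of_continuous (c.continuous.sub g.continuous)
  calc ∫ r, ‖f r - g r‖ ∂(surface m) ≤ ∫ r, (‖f r - c r‖ + ‖c r - g r‖) ∂(surface m) := by
        refine integral_mono (hf.sub (integrable_of_continuous g.continuous)).norm
          ((hf.sub hci).norm.add hgi.norm) fun r => ?_
        exact norm_sub_le_norm_sub_add_norm_sub _ _ _
    _ = ∫ r, ‖f r - c r‖ ∂(surface m) + ∫ r, ‖c r - g r‖ ∂(surface m) :=
        integral_add (hf.sub hci).norm hgi.norm
    _ ≤ η := by linarith

/-- Fourier multipliers are symmetric for the bilinear pairing. This moves the resolvent onto the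
test function in the duality argument. -/
theorem integral_sum_mul_sum (hm : 1 ≤ m) (N M : ℕ) {φ ψ : ℕ → TestFun m}
    (hφ : ∀ n, φ n ∈ Harm m n) (hψ : ∀ n, ψ n ∈ Harm m n) (w : ℕ → ℂ) :
    ∫ r, (∑ n ∈ Finset.range N, w n • φ n) r * (∑ n ∈ Finset.range M, ψ n) r ∂(surface m) =
      ∫ r, (∑ n ∈ Finset.range N, φ n) r * (∑ n ∈ Finset.range M, w n • ψ n) r ∂(surface m) := by
  have hi : ∀ a b : TestFun m, Integrable (fun r => a r * b r) (surface m) := fun a b =>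
    integrable_of_continuous (a.continuous.mul b.continuous)
  simp only [TestFun.sum_apply, Finset.sum_mul_sum]
  rw [integral_finsetSum _ fun n _ => integrable_finsetSum _ fun k _ => hi _ _,
    integral_finsetSum _ fun n _ => integrable_finsetSum _ fun k _ => hi _ _]
  refine Finset.sum_congr rfl fun n _ => ?_
  rw [integral_finsetSum _ fun k _ => hi _ _, integral_finsetSum _ fun k _ => hi _ _]
  refine Finset.sum_congr rfl fun k _ => ?_
  rcases eq_or_ne n k with rfl | hnk
  · simp only [TestFun.smul_apply]
    refine integral_congr_ae (ae_of_all _ fun r => ?_)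
    simp only
    ring
  · rw [integral_mul_eq_zero_of_ne hm hnk (Submodule.smul_mem _ _ (hφ n)) (hψ k),
      integral_mul_eq_zero_of_ne hm hnk (hφ n) (Submodule.smul_mem _ _ (hψ k))]

theorem tendsto_integral_resolvent_sub (N : ℕ) (K : ℕ) (φ : ℕ → TestFun m) :
    Tendsto (fun ε : ℝ => ∫ r, ‖resolvent ε K N φ r - (∑ n ∈ Finset.range N, φ n) r‖ ∂(surface m))
      (𝓝 0) (𝓝 0) := by
  have hbound : ∀ ε : ℝ, ∫ r, ‖resolvent ε K N φ r - (∑ n ∈ Finset.range N, φ n) r‖ ∂(surface m) ≤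
      ∑ n ∈ Finset.range N, |((1 + ε * eig m n) ^ K)⁻¹ - 1| * ∫ r, ‖φ n r‖ ∂(surface m) := by
    intro ε
    have hi : ∀ n, Integrable (fun r => |((1 + ε * eig m n) ^ K)⁻¹ - 1| * ‖φ n r‖) (surface m) :=
      fun n => (integrable_of_continuous (φ n).continuous.norm).const_mul _
    simp_rw [← integral_const_mul]
    rw [← integral_finsetSum _ fun n _ => hi n]
    refine integral_mono (integrable_of_continuous
      ((resolvent ε K N φ).continuous.sub (TestFun.continuous _)).norm)
      (integrable_finsetSum _ fun n _ => hi n) fun r => ?_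
    simp only [resolvent, TestFun.sum_apply, ← Finset.sum_sub_distrib]
    refine (norm_sum_le _ _).trans (Finset.sum_le_sum fun n _ => ?_)
    rw [TestFun.smul_apply, ← sub_one_mul, norm_mul, ← Complex.ofReal_one, ← Complex.ofReal_sub,
      Complex.norm_real, Real.norm_eq_abs]
  refine squeeze_zero (fun ε => integral_nonneg fun r => norm_nonneg _) hbound ?_
  have : (0 : ℝ) = ∑ n ∈ Finset.range N, |((1 + 0 * eig m n) ^ K)⁻¹ - 1| *
      ∫ r, ‖φ n r‖ ∂(surface m) := by simp
  nth_rewrite 2 [this]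
  refine tendsto_finsetSum _ fun n _ => Tendsto.mul_const _ ?_
  refine ContinuousAt.tendsto (f := fun ε : ℝ => |((1 + ε * eig m n) ^ K)⁻¹ - 1|) ?_
  refine ((ContinuousAt.inv₀ (by fun_prop) (by simp)).sub continuousAt_const).abs

/-! ### The Green functions -/

namespace PseudoDiffOp

variable {B : HarmonicBasis m} (D : PseudoDiffOp B)

/-- The symbol of the pseudo-inverse. -/
def coef (n : ℕ) : ℝ := if n ∈ D.zeros then 0 else (D.symbol n)⁻¹

theorem mem_zeros {n : ℕ} : n ∈ D.zeros ↔ D.symbol n = 0 := by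
  simp [zeros]

theorem coef_eq (n : ℕ) : D.coef n = (D.symbol n)⁻¹ := by
  unfold coef
  split_ifs with h
  · rw [D.mem_zeros] at h
    rw [h, inv_zero]
  · rfl

theorem pinv_eq_tsum (h : TestFun m) (r : Sphere m) :
    D.pinv h r = ∑' n, (D.coef n : ℂ) * B.component n h r := by
  refine tsum_congr fun n => ?_
  unfold coef
  split_ifs <;> simp

theorem pinv_of_mem (hm : 1 ≤ m) {k : ℕ} {h : TestFun m} (hh : h ∈ Harm m k) (r : Sphere m) :
    D.pinv h r = D.coef k * h r := by
  rw [pinv_eq_tsum, tsum_eq_single k, B.component_of_mem hh]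
  intro n hn
  rw [B.component_of_mem_ne hm hn.symm hh]
  exact mul_zero _

theorem greenPartial_eq (hm : 1 ≤ m) (N : ℕ) (s r : Sphere m) :
    ((D.greenPartial N (inner ℝ (r : Ambient m) (s : Ambient m)) : ℝ) : ℂ) =
      ∑ n ∈ Finset.range N, (D.coef n : ℂ) * B.kernel n s r := by
  rw [greenPartial, Complex.ofReal_sum]
  refine Finset.sum_congr rfl fun n _ => ?_
  rw [B.kernel_apply_eq hm, ← Complex.ofReal_mul]
  congr 1
  unfold coef
  split_ifs
  · simp
  · field_simp

theorem coef_isBigO : D.coef =O[atTop] fun n : ℕ => (n : ℝ) ^ (-D.order) := by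
  have h := D.growth.2
  have h1 : (fun n : ℕ => |D.symbol n|⁻¹) =O[atTop] fun n : ℕ => ((n : ℝ) ^ D.order)⁻¹ := by
    refine h.inv_rev ?_
    filter_upwards [eventually_gt_atTop 0] with n hn h0
    exact absurd h0 (Real.rpow_pos_of_pos (by exact_mod_cast hn) _).ne'
  have e : D.coef = fun n => (D.symbol n)⁻¹ := funext D.coef_eq
  rw [e]
  refine Asymptotics.IsBigO.of_norm_left ?_
  simp only [norm_inv, Real.norm_eq_abs]
  refine h1.congr_right fun n => ?_
  rw [Real.rpow_neg (Nat.cast_nonneg n)]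

theorem symbol_isBigO : D.symbol =O[atTop] fun n : ℕ => (n : ℝ) ^ D.order := by
  have := D.growth.1
  exact Asymptotics.IsBigO.of_norm_left this

theorem _root_.Spherical.HarmonicBasis.harmDim_isBigO (B : HarmonicBasis m) (hm : 1 ≤ m) :
    (fun n => (harmDim m n : ℝ) / area m) =O[atTop] fun n : ℕ => (n : ℝ) ^ (m - 1 : ℝ) := by
  refine Asymptotics.IsBigO.of_bound (harmDim m 1 / area m) ?_
  filter_upwards [eventually_gt_atTop 0] with n hn
  obtain ⟨k, rfl⟩ : ∃ k, n = k + 1 := ⟨n - 1, by omega⟩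
  have ha := area_pos m
  rw [Real.norm_of_nonneg (by positivity), Real.norm_of_nonneg (by positivity)]
  have := B.harmDim_le hm k
  rw [div_mul_eq_mul_div]
  gcongr
  rw [show (m - 1 : ℝ) = ((m - 1 : ℕ) : ℝ) by rw [Nat.cast_sub hm, Nat.cast_one],
    Real.rpow_natCast]
  push_cast
  exact this

end PseudoDiffOp

/-! ### Summability and termwise integration -/

theorem HarmonicBasis.summable_mul_harmDim (B : HarmonicBasis m) (hm : 1 ≤ m) {c : ℕ → ℝ} {a : ℝ}
    (hc : c =O[atTop] fun n : ℕ => (n : ℝ) ^ a) (ha : a + m < 0) :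
    Summable fun n => |c n| * (harmDim m n / area m) := by
  have h1 := hc.abs_left.mul (B.harmDim_isBigO hm)
  refine summable_of_isBigO_nat (Real.summable_nat_rpow.mpr (by linarith : a + (m - 1) < -1))
    (h1.congr' EventuallyEq.rfl ?_)
  filter_upwards [eventually_gt_atTop 0] with n hn
  rw [Real.rpow_add (by exact_mod_cast hn)]

theorem weight_isBigO (hm : 1 ≤ m) {ε : ℝ} (hε : 0 < ε) (K : ℕ) :
    (fun n => ((1 + ε * eig m n) ^ K)⁻¹) =O[atTop] fun n : ℕ => (n : ℝ) ^ (-(2 * K : ℝ)) := by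
  refine Asymptotics.IsBigO.of_bound ((ε ^ K)⁻¹) ?_
  filter_upwards [eventually_gt_atTop 0] with n hn
  have hn' : (0 : ℝ) < n := by exact_mod_cast hn
  have h1 := sq_le_eig hm n
  have h2 : ε * (n : ℝ) ^ 2 ≤ 1 + ε * eig m n := by
    have := mul_le_mul_of_nonneg_left h1 hε.le
    linarith
  have h3 : 0 < ε * (n : ℝ) ^ 2 := by positivity
  rw [Real.norm_of_nonneg (inv_nonneg.mpr (pow_nonneg (h3.le.trans h2) _)),
    Real.norm_of_nonneg (by positivity), Real.rpow_neg hn'.le, ← mul_inv]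
  gcongr
  have : (n : ℝ) ^ (2 * K : ℝ) = ((n : ℝ) ^ 2) ^ K := by
    rw [← pow_mul, ← Real.rpow_natCast]
    push_cast
    rfl
  rw [this, ← mul_pow]
  gcongr

theorem integrable_mul_of_continuous {f g : Sphere m → ℂ} (hf : Continuous f) (hg : Continuous g) :
    Integrable (fun r => f r * g r) (surface m) :=
  integrable_of_continuous (hf.mul hg)

theorem hasSum_integral_mul {g : ℕ → Sphere m → ℂ} (hg : ∀ n, Continuous (g n)) {u : ℕ → ℝ}
    (hu : Summable u) (hgu : ∀ n r, ‖g n r‖ ≤ u n) {h : Sphere m → ℂ} (hh : Continuous h) :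
    HasSum (fun n => ∫ r, g n r * h r ∂(surface m)) (∫ r, (∑' n, g n r) * h r ∂(surface m)) := by
  have hi : ∀ n, Integrable (fun r => g n r * h r) (surface m) := fun n =>
    integrable_of_continuous ((hg n).mul hh)
  have hs : Summable fun n => ∫ r, ‖g n r * h r‖ ∂(surface m) := by
    refine Summable.of_nonneg_of_le (fun n => integral_nonneg fun r => norm_nonneg _) (fun n => ?_)
      (hu.mul_right (∫ r, ‖h r‖ ∂(surface m)))
    rw [← integral_const_mul (μ := surface m)]
    refine integral_mono (hi n).norm ((integrable_of_continuous hh.norm).const_mul _) fun r => ?_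
    simp only [norm_mul]
    exact mul_le_mul_of_nonneg_right (hgu n r) (norm_nonneg _)
  have := hasSum_integral_of_summable_integral_norm hi hs
  simp_rw [tsum_mul_right] at this
  exact this

/-! ### Decay of the components of smooth functions -/

theorem l2inner_oneSubLaplace_pow {n : ℕ} {h : TestFun m} (hh : h ∈ Harm m n) (φ : TestFun m)
    (K : ℕ) : l2inner ((oneSubLaplace m 1 ^ K) φ) h = ((1 + eig m n : ℝ) : ℂ) ^ K * l2inner φ h := by
  induction K generalizing φ with
  | zero => simp
  | succ K ih =>
    rw [pow_succ, Module.End.mul_apply, ih, pow_succ, mul_assoc]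
    congr 1
    have e : oneSubLaplace m 1 φ = φ - laplaceBeltrami φ := by simp [oneSubLaplace]
    have h1 : l2inner (laplaceBeltrami φ) h = -(eig m n : ℂ) * l2inner φ h := by
      have := integral_mul_laplaceBeltrami φ h.conjugate
      rw [laplaceBeltrami_of_mem (conjugate_mem hh)] at this
      simp only [TestFun.smul_apply, mul_left_comm _ (-(eig m n : ℂ)), integral_const_mul] at this
      exact this.symm
    rw [e, l2inner_sub_left, h1]
    push_cast
    ring

namespace HarmonicBasis

variable (B : HarmonicBasis m)

theorem l2inner_component {n : ℕ} {h : TestFun m} (hh : h ∈ Harm m n) (φ : TestFun m) :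
    l2inner (B.component n φ) h = l2inner φ h := by
  conv_rhs => rw [← B.component_of_mem hh]
  simp only [component, l2inner_sum_left, l2inner_sum_right, l2inner_smul_left,
    l2inner_smul_right, l2inner_conj, mul_comm]

/-- The component at `s` is the pairing with the kernel, an eigenfunction; moving `(Id - Δ)^K`
between the factors gains `(1 + λ_n)^{-K}`. -/
theorem norm_component_le (hm : 1 ≤ m) (φ : TestFun m) (K n : ℕ) (s : Sphere m) :
    ‖B.component n φ s‖ ≤ (∫ r, ‖(oneSubLaplace m 1 ^ K) φ r‖ ∂(surface m)) *
      (((1 + 1 * eig m n) ^ K)⁻¹ * (harmDim m n / area m)) := by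
  have h0 : 0 < (1 + eig m n) ^ K := by
    have := eig_nonneg hm n
    positivity
  have h1 := l2inner_oneSubLaplace_pow (B.kernel_mem n s) φ K
  have h2 : ‖l2inner ((oneSubLaplace m 1 ^ K) φ) (B.kernel n s)‖ ≤
      (∫ r, ‖(oneSubLaplace m 1 ^ K) φ r‖ ∂(surface m)) * (harmDim m n / area m) := by
    rw [l2inner, ← integral_mul_const]
    refine norm_integral_le_of_norm_le
      ((integrable_of_continuous (TestFun.continuous _).norm).mul_const _) (ae_of_all _ fun r => ?_)
    rw [norm_mul, RCLike.norm_conj]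
    exact mul_le_mul_of_nonneg_left (B.norm_kernel_le n s r) (norm_nonneg _)
  rw [h1, l2inner_kernel, norm_mul, norm_pow, Complex.norm_real, Real.norm_eq_abs,
    abs_of_nonneg (by linarith [eig_nonneg hm n])] at h2
  rw [one_mul, mul_left_comm, ← div_eq_inv_mul, le_div_iff₀ h0, mul_comm]
  exact h2

theorem exists_summable_bound (hm : 1 ≤ m) {c : ℕ → ℝ} {a : ℝ}
    (hc : c =O[atTop] fun n : ℕ => (n : ℝ) ^ a) (φ : TestFun m) :
    ∃ u : ℕ → ℝ, Summable u ∧ ∀ n r, ‖(c n : ℂ) * B.component n φ r‖ ≤ u n := by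
  -- This `K` gives `a - 2K + m < 0`, exactly what summability against the dimensions requires.
  obtain ⟨K, hK⟩ := exists_nat_gt ((a + m) / 2)
  have h1 : (fun n => c n * ((1 + 1 * eig m n) ^ K)⁻¹) =O[atTop]
      fun n : ℕ => (n : ℝ) ^ (a - 2 * K) := by
    refine (hc.mul (weight_isBigO hm one_pos K)).congr' EventuallyEq.rfl ?_
    filter_upwards [eventually_gt_atTop 0] with n hn
    rw [← Real.rpow_add (by exact_mod_cast hn)]
    rfl
  have h2 := B.summable_mul_harmDim hm h1 (by linarith)
  refine ⟨_, h2.mul_left (∫ r, ‖(oneSubLaplace m 1 ^ K) φ r‖ ∂(surface m)), fun n r => ?_⟩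
  have h0 : 0 ≤ ((1 + 1 * eig m n) ^ K)⁻¹ := by
    have := eig_nonneg hm n
    positivity
  rw [norm_mul, Complex.norm_real, Real.norm_eq_abs, abs_mul, abs_of_nonneg h0]
  refine (mul_le_mul_of_nonneg_left (B.norm_component_le hm φ K n r) (abs_nonneg _)).trans ?_
  refine le_of_eq ?_
  ring

/-- The spherical Fourier expansion of a smooth function. -/
theorem tsum_component (hm : 1 ≤ m) (φ : TestFun m) (r : Sphere m) :
    ∑' n, B.component n φ r = φ r := by
  have h1 : (fun _ : ℕ => (1 : ℝ)) =O[atTop] fun n : ℕ => (n : ℝ) ^ (0 : ℝ) := by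
    simpa using Asymptotics.isBigO_refl (fun _ : ℕ => (1 : ℝ)) atTop
  obtain ⟨u, hu, hb⟩ := B.exists_summable_bound hm h1 φ
  simp only [Complex.ofReal_one, one_mul] at hb
  set S : Sphere m → ℂ := fun r => ∑' n, B.component n φ r with hS
  have hSc : Continuous S := continuous_tsum (fun n => (B.component n φ).continuous) hu hb
  set d : Sphere m → ℂ := fun r => S r - φ r with hd
  have hdc : Continuous d := hSc.sub φ.continuous
  -- Uniform convergence allows termwise integration, so the sum and `φ` have the same pairing with
  -- each harmonic; duality then forces their difference to vanish.
  have hortho : ∀ n, ∀ h ∈ Harm m n, ∫ r, d r * h r ∂(surface m) = 0 := by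
    intro n h hh
    have h2 := hasSum_integral_mul (fun n => (B.component n φ).continuous) hu hb h.continuous
    have h3 : ∀ k, k ≠ n → ∫ r, B.component k φ r * h r ∂(surface m) = 0 := fun k hk =>
      integral_mul_eq_zero_of_ne hm hk (B.component_mem k φ) hh
    have h4 := h2.unique (hasSum_single n h3)
    have h5 : ∫ r, B.component n φ r * h r ∂(surface m) = ∫ r, φ r * h r ∂(surface m) := by
      have := B.l2inner_component (conjugate_mem hh) φ
      simpa only [l2inner, conjugate_apply, Complex.conj_conj] using this
    simp only [hd, sub_mul]
    rw [integral_sub (integrable_mul_of_continuous hSc h.continuous)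
      (integrable_mul_of_continuous φ.continuous h.continuous), ← h5, ← h4, sub_self]
  have h6 : ∫ r, ‖d r‖ ∂(surface m) ≤ 0 := by
    refine integral_norm_le_of_harmonics hm hdc fun h hh C _ => ?_
    obtain ⟨N, ψ, hψ, rfl⟩ := exists_sum_of_mem_harmonics hh
    simp only [TestFun.sum_apply, Finset.mul_sum]
    rw [integral_finsetSum _ fun n _ => integrable_mul_of_continuous hdc (ψ n).continuous,
      Finset.sum_eq_zero fun n _ => hortho n _ (hψ n)]
    simp
  have h7 : d = 0 := by
    refine continuous_eq_zero_of_integral_mul_conj hdc ?_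
    have h8 := (integral_eq_zero_iff_of_nonneg (fun r => norm_nonneg _)
      (integrable_of_continuous hdc.norm)).mp
      (le_antisymm h6 (integral_nonneg fun r => norm_nonneg (d r)))
    refine integral_eq_zero_of_ae ?_
    filter_upwards [h8] with r hr
    rw [norm_eq_zero.mp hr]
    simp
  exact sub_eq_zero.mp (congrFun h7 r)

end HarmonicBasis

/-! ### The symbol calculus of `D` -/

namespace PseudoDiffOp

variable {B : HarmonicBasis m} (D : PseudoDiffOp B)

theorem toLin_of_mem (hm : 1 ≤ m) {k : ℕ} {h : TestFun m} (hh : h ∈ Harm m k) :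
    D.toLin h = (D.symbol k : ℂ) • h := by
  ext r
  refine (D.hasSum h r).unique ?_
  convert hasSum_single k fun n hn => ?_ using 1
  · rw [B.component_of_mem hh, TestFun.smul_apply]
  · rw [B.component_of_mem_ne hm hn.symm hh]
    exact mul_zero _

theorem component_toLin (hm : 1 ≤ m) (φ : TestFun m) (n : ℕ) (s : Sphere m) :
    B.component n (D.toLin φ) s = D.symbol n * B.component n φ s := by
  obtain ⟨u, hu, hb⟩ := B.exists_summable_bound hm D.symbol_isBigO φ
  rw [← B.l2inner_kernel, l2inner]
  simp_rw [← fun r => (D.hasSum φ r).tsum_eq]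
  have hc : ∀ k, Continuous fun r => (D.symbol k : ℂ) * B.component k φ r := fun k =>
    continuous_const.mul (B.component k φ).continuous
  refine (hasSum_integral_mul hc hu hb
    (Complex.continuous_conj.comp (B.kernel n s).continuous)).unique ?_
  have h1 : ∀ k, ∫ r, (D.symbol k : ℂ) * B.component k φ r *
      (starRingEnd ℂ ∘ (B.kernel n s)) r ∂(surface m) =
      D.symbol k * l2inner (B.component k φ) (B.kernel n s) := fun k => by
    simp only [mul_assoc, integral_const_mul]
    rfl
  simp_rw [h1]
  convert hasSum_single n fun k hk => ?_ using 1
  · rw [B.l2inner_kernel_of_mem s (B.component_mem n φ)]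
  · rw [l2inner_eq_zero_of_ne hm hk (B.component_mem k φ) (B.kernel_mem n s), mul_zero]

theorem pinv_toLin (hm : 1 ≤ m) (hz : D.zeros = ∅) (φ : TestFun m) (s : Sphere m) :
    D.pinv (D.toLin φ) s = φ s := by
  rw [pinv_eq_tsum, ← B.tsum_component hm φ s]
  refine tsum_congr fun n => ?_
  have h0 : D.symbol n ≠ 0 := fun h => by
    have := D.mem_zeros.mpr h
    simp [hz] at this
  rw [D.component_toLin hm, D.coef_eq, ← mul_assoc, ← Complex.ofReal_mul, inv_mul_cancel₀ h0,
    Complex.ofReal_one, one_mul]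

/-! ### Smoothed Green functions -/

/-- The Green function at `s`, smoothed by `(Id - ε Δ)^{-m}`. -/
def smoothed (s : Sphere m) (ε : ℝ) (r : Sphere m) : ℂ :=
  ∑' n, ((1 + ε * eig m n) ^ m)⁻¹ • ((D.coef n : ℂ) * B.kernel n s r)

/-- The weights decay like `n^{-2m}` and the dimensions are `O(n^{m-1})`; the power `m` therefore
suffices for every order `p ≥ 0`. -/
theorem summable_smoothed_bound (hm : 1 ≤ m) {ε : ℝ} (hε : 0 < ε) :
    Summable fun n => |((1 + ε * eig m n) ^ m)⁻¹ * D.coef n| * (harmDim m n / area m) := by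
  have h1 : (fun n => ((1 + ε * eig m n) ^ m)⁻¹ * D.coef n) =O[atTop]
      fun n : ℕ => (n : ℝ) ^ (-(2 * m : ℝ) + -D.order) := by
    refine ((weight_isBigO hm hε m).mul D.coef_isBigO).congr' EventuallyEq.rfl ?_
    filter_upwards [eventually_gt_atTop 0] with n hn
    rw [← Real.rpow_add (by exact_mod_cast hn)]
  have : (1 : ℝ) ≤ m := by exact_mod_cast hm
  exact B.summable_mul_harmDim hm h1 (by linarith [D.order_nonneg])

theorem norm_smoothed_term_le (ε : ℝ) (n : ℕ) (s r : Sphere m) :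
    ‖((1 + ε * eig m n) ^ m)⁻¹ • ((D.coef n : ℂ) * B.kernel n s r)‖ ≤
      |((1 + ε * eig m n) ^ m)⁻¹ * D.coef n| * (harmDim m n / area m) := by
  rw [norm_smul, norm_mul, Complex.norm_real, ← mul_assoc, ← norm_mul, Real.norm_eq_abs]
  exact mul_le_mul_of_nonneg_left (B.norm_kernel_le n s r) (abs_nonneg _)

theorem continuous_smoothed_term (ε : ℝ) (n : ℕ) (s : Sphere m) :
    Continuous fun r => ((1 + ε * eig m n) ^ m)⁻¹ • ((D.coef n : ℂ) * B.kernel n s r) :=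
  (continuous_const.fun_mul (B.kernel n s).continuous).fun_const_smul _

theorem continuous_smoothed (hm : 1 ≤ m) (s : Sphere m) {ε : ℝ} (hε : 0 < ε) :
    Continuous (D.smoothed s ε) :=
  continuous_tsum (fun n => D.continuous_smoothed_term ε n s) (D.summable_smoothed_bound hm hε)
    fun n r => D.norm_smoothed_term_le ε n s r

theorem kernel_real (hm : 1 ≤ m) (n : ℕ) (s r : Sphere m) :
    starRingEnd ℂ (B.kernel n s r) = B.kernel n s r := by
  rw [B.kernel_apply_eq hm, Complex.conj_ofReal]

/-- On harmonics the smoothed function acts as `(Id - εΔ)^{-m}` applied to `D†δ_s`. This is the only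
link between it and `f` used later. -/
theorem integral_smoothed_mul (hm : 1 ≤ m) (s : Sphere m) {ε : ℝ} (hε : 0 < ε) {k : ℕ}
    {φ : TestFun m} (hφ : φ ∈ Harm m k) :
    ∫ r, D.smoothed s ε r * φ r ∂(surface m) =
      (((1 + ε * eig m k) ^ m)⁻¹ : ℝ) * (D.coef k * φ s) := by
  have h1 := hasSum_integral_mul (fun n => D.continuous_smoothed_term ε n s)
    (D.summable_smoothed_bound hm hε) (fun n r => D.norm_smoothed_term_le ε n s r) φ.continuous
  refine h1.unique ?_
  have h2 : ∀ n, ∫ r, ((1 + ε * eig m n) ^ m)⁻¹ • ((D.coef n : ℂ) * B.kernel n s r) * φ r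
      ∂(surface m) = (((1 + ε * eig m n) ^ m)⁻¹ : ℝ) * (D.coef n * B.component n φ s) := by
    intro n
    rw [← B.l2inner_kernel, l2inner, ← integral_const_mul, ← integral_const_mul]
    refine integral_congr_ae (ae_of_all _ fun r => ?_)
    simp only [kernel_real hm, Complex.real_smul]
    ring
  simp_rw [h2]
  convert hasSum_single k fun n hn => ?_ using 1
  · rw [B.component_of_mem hφ]
  · rw [B.component_of_mem_ne hm hn.symm hφ]
    change _ * (_ * (0 : ℂ)) = 0
    simp

/-- The eigenvalues increase with `n`, so the weights decrease; as `ε → 0` each tends to `1`.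
Conditional convergence of the Green series is therefore enough. -/
theorem tendsto_smoothed (hm : 1 ≤ m) {s r : Sphere m} {l : ℝ}
    (hl : Tendsto (fun N => D.greenPartial N (inner ℝ (r : Ambient m) (s : Ambient m))) atTop
      (𝓝 l)) {e : ℕ → ℝ} (he : ∀ j, 0 < e j) (he0 : Tendsto e atTop (𝓝 0)) :
    Tendsto (fun j => D.smoothed s (e j) r) atTop (𝓝 (l : ℂ)) := by
  have hA : Tendsto (fun N => ∑ n ∈ Finset.range N, (D.coef n : ℂ) * B.kernel n s r) atTop
      (𝓝 (l : ℂ)) := by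
    simp_rw [← D.greenPartial_eq hm]
    exact (Complex.continuous_ofReal.tendsto l).comp hl
  have hbase : ∀ j n, 1 ≤ 1 + e j * eig m n := fun j n => by
    have := mul_nonneg (he j).le (eig_nonneg hm n)
    linarith
  refine tendsto_tsum_weights (w := fun j n => ((1 + e j * eig m n) ^ m)⁻¹) hA
    (fun j n k hnk => ?_) (fun j n => ?_) (fun j n => ?_) (fun n => ?_) (fun j => ?_)
  · have := (eig_strictMono hm).monotone hnk
    have h1 := hbase j n
    have h2 := he j
    simp only
    gcongr
  · have := hbase j n
    positivity
  · exact inv_le_one_of_one_le₀ (one_le_pow₀ (hbase j n))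
  · have : ContinuousAt (fun x : ℝ => ((1 + x * eig m n) ^ m)⁻¹) 0 :=
      ContinuousAt.inv₀ (by fun_prop) (by simp)
    simpa [Function.comp_def] using this.tendsto.comp he0
  · exact Summable.of_norm_bounded (D.summable_smoothed_bound hm (he j))
      fun n => D.norm_smoothed_term_le (e j) n s r

/-- The `L¹` contraction of the resolvent, by duality: pairing the left-hand difference with a
harmonic sum equals pairing `f - g` with its resolvent `χ`, and the maximum principle bounds `χ` by
the same constant. -/
theorem integral_smoothed_sub_le (hm : 1 ≤ m) {s : Sphere m} {f : Sphere m → ℂ}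
    (hf : Integrable f (surface m)) (hG : D.IsGreenFunction s (regular f hf)) {ε : ℝ} (hε : 0 < ε)
    {N : ℕ} {φ : ℕ → TestFun m} (hφ : ∀ n, φ n ∈ Harm m n) :
    ∫ r, ‖D.smoothed s ε r - resolvent ε m N φ r‖ ∂(surface m) ≤
      ∫ r, ‖f r - (∑ n ∈ Finset.range N, φ n) r‖ ∂(surface m) := by
  set g := ∑ n ∈ Finset.range N, φ n
  have hFc := D.continuous_smoothed hm s hε
  have hfg : Integrable (fun r => f r - g r) (surface m) :=
    hf.sub (integrable_of_continuous g.continuous)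
  refine integral_norm_le_of_harmonics hm (hFc.sub (TestFun.continuous _)) fun h hh C hC => ?_
  obtain ⟨M, ψ, hψ, rfl⟩ := exists_sum_of_mem_harmonics hh
  set χ := resolvent ε m M ψ with hχ
  have hχC : ∀ r, ‖χ r‖ ≤ C := norm_resolvent_le hm hε.le m M hψ hC
  have hbdd : ∀ a : TestFun m, Integrable (fun r => f r * a r) (surface m) := fun a =>
    hf.mul_bdd (c := ‖toContₗ a‖) a.continuous.aestronglyMeasurable
      (ae_of_all _ (toContₗ a).norm_coe_le_norm)
  have hfY : ∀ n, ∀ a ∈ Harm m n, ∫ r, f r * a r ∂(surface m) = D.coef n * a s := fun n a ha =>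
    (hG a).trans (D.pinv_of_mem hm ha s)
  have e1 : ∫ r, D.smoothed s ε r * (∑ n ∈ Finset.range M, ψ n) r ∂(surface m) =
      ∫ r, f r * χ r ∂(surface m) := by
    simp only [hχ, resolvent, TestFun.sum_apply, Finset.mul_sum]
    rw [integral_finsetSum _ fun n _ => integrable_mul_of_continuous hFc (ψ n).continuous,
      integral_finsetSum _ fun n _ => hbdd _]
    refine Finset.sum_congr rfl fun n _ => ?_
    rw [D.integral_smoothed_mul hm s hε (hψ n), hfY n _ (Submodule.smul_mem _ _ (hψ n)),
      TestFun.smul_apply]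
    ring
  have e2 : ∫ r, resolvent ε m N φ r * (∑ n ∈ Finset.range M, ψ n) r ∂(surface m) =
      ∫ r, g r * χ r ∂(surface m) := integral_sum_mul_sum hm N M hφ hψ _
  have e3 : ∫ r, (D.smoothed s ε r - resolvent ε m N φ r) * (∑ n ∈ Finset.range M, ψ n) r
      ∂(surface m) = ∫ r, (f r - g r) * χ r ∂(surface m) := by
    simp only [sub_mul]
    rw [integral_sub (integrable_mul_of_continuous hFc (TestFun.continuous _))
      (integrable_mul_of_continuous (TestFun.continuous _) (TestFun.continuous _)), e1, e2,
      integral_sub (hbdd χ) (integrable_mul_of_continuous g.continuous χ.continuous)]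
  change ‖∫ r, (D.smoothed s ε r - resolvent ε m N φ r) * _ ∂(surface m)‖ ≤ _
  rw [e3, ← integral_mul_const]
  refine norm_integral_le_of_norm_le (hfg.norm.mul_const _) (ae_of_all _ fun r => ?_)
  rw [norm_mul]
  exact mul_le_mul_of_nonneg_left (hχC r) (norm_nonneg _)

/-- Choose a harmonic sum `g` near `f` in `L¹`. The contraction keeps the smoothed function near the
resolvent of `g`, which converges to `g` because the sum is finite. -/
theorem tendsto_integral_smoothed_sub (hm : 1 ≤ m) {s : Sphere m} {f : Sphere m → ℂ}
    (hf : Integrable f (surface m)) (hG : D.IsGreenFunction s (regular f hf)) {e : ℕ → ℝ}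
    (he : ∀ j, 0 < e j) (he0 : Tendsto e atTop (𝓝 0)) :
    Tendsto (fun j => ∫ r, ‖D.smoothed s (e j) r - f r‖ ∂(surface m)) atTop (𝓝 0) := by
  rw [Metric.tendsto_atTop]
  intro η hη
  obtain ⟨g, hg, hgn⟩ := exists_harmonics_integral_near hm hf (show 0 < η / 4 by positivity)
  obtain ⟨N, φ, hφ, rfl⟩ := exists_sum_of_mem_harmonics hg
  set g := ∑ n ∈ Finset.range N, φ n
  obtain ⟨J, hJ⟩ := Metric.tendsto_atTop.mp ((tendsto_integral_resolvent_sub N m φ).comp he0)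
    (η / 4) (by positivity)
  refine ⟨J, fun j hj => ?_⟩
  have h1 := D.integral_smoothed_sub_le hm hf hG (he j) (N := N) hφ
  have h2 := hJ j hj
  simp only [Function.comp, Real.dist_eq, sub_zero] at h2
  have h2' := (le_abs_self _).trans_lt h2
  have hFc := D.continuous_smoothed hm s (he j)
  have i1 : Integrable (fun r => ‖D.smoothed s (e j) r - resolvent (e j) m N φ r‖) (surface m) :=
    integrable_of_continuous (hFc.sub (resolvent (e j) m N φ).continuous).norm
  have i2 : Integrable (fun r => ‖resolvent (e j) m N φ r - g r‖) (surface m) :=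
    integrable_of_continuous ((resolvent (e j) m N φ).continuous.sub g.continuous).norm
  have i3 : Integrable (fun r => ‖f r - g r‖) (surface m) :=
    (hf.sub (integrable_of_continuous g.continuous)).norm
  have i4 : Integrable (fun r => ‖resolvent (e j) m N φ r - g r‖ + ‖f r - g r‖) (surface m) :=
    i2.add i3
  rw [Real.dist_eq, sub_zero, abs_of_nonneg (integral_nonneg fun r => norm_nonneg _)]
  calc ∫ r, ‖D.smoothed s (e j) r - f r‖ ∂(surface m)
      ≤ ∫ r, (‖D.smoothed s (e j) r - resolvent (e j) m N φ r‖ +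
          (‖resolvent (e j) m N φ r - g r‖ + ‖f r - g r‖)) ∂(surface m) := by
        refine integral_mono ((integrable_of_continuous hFc).sub hf).norm (i1.add i4)
          fun r => ?_
        simp only
        have a1 := norm_sub_le_norm_sub_add_norm_sub (D.smoothed s (e j) r)
          (resolvent (e j) m N φ r) (f r)
        have a2 := norm_sub_le_norm_sub_add_norm_sub (resolvent (e j) m N φ r) (g r) (f r)
        rw [norm_sub_rev (g r)] at a2
        linarith
    _ = ∫ r, ‖D.smoothed s (e j) r - resolvent (e j) m N φ r‖ ∂(surface m) +
          (∫ r, ‖resolvent (e j) m N φ r - g r‖ ∂(surface m) +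
            ∫ r, ‖f r - g r‖ ∂(surface m)) := by
        rw [integral_add i1 i4, integral_add i2 i3]
    _ < η := by linarith

/-- A Green function that is an ordinary function agrees with the trace of the Green kernel. -/
theorem ae_eq_trace (hm : 1 ≤ m) {s : Sphere m}
    (hconv : ∀ r : Sphere m, ∃ l : ℝ,
      Tendsto (fun N => D.greenPartial N (inner ℝ (r : Ambient m) (s : Ambient m))) atTop (𝓝 l))
    {f : Sphere m → ℂ} (hf : Integrable f (surface m))
    (hG : D.IsGreenFunction s (regular f hf)) : f =ᵐ[surface m] D.trace s := by
  set e : ℕ → ℝ := fun j => 1 / ((j : ℝ) + 1)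
  have he : ∀ j, 0 < e j := fun j => by positivity
  have he0 : Tendsto e atTop (𝓝 0) := tendsto_one_div_add_atTop_nhds_zero_nat
  have hc := fun j => D.continuous_smoothed hm s (he j)
  have hL1 : Tendsto (fun j => eLpNorm (D.smoothed s (e j) - f) 1 (surface m)) atTop (𝓝 0) := by
    have h1 := ENNReal.tendsto_ofReal (D.tendsto_integral_smoothed_sub hm hf hG he he0)
    rw [ENNReal.ofReal_zero] at h1
    refine h1.congr fun j => ?_
    rw [eLpNorm_one_eq_lintegral_enorm]
    exact ofReal_integral_norm_eq_lintegral_enorm ((integrable_of_continuous (hc j)).sub hf)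
  -- Convergence in `L¹` gives almost everywhere convergence only along a subsequence; this
  -- suffices, as the whole sequence converges pointwise to the kernel.
  obtain ⟨ns, hns, hae⟩ := (tendstoInMeasure_of_tendsto_eLpNorm one_ne_zero
    (fun j => (hc j).aestronglyMeasurable) hf.aestronglyMeasurable hL1).exists_seq_tendsto_ae
  filter_upwards [hae] with r hr
  obtain ⟨l, hl⟩ := hconv r
  have h2 := (D.tendsto_smoothed hm hl he he0).comp hns.tendsto_atTop
  rw [tendsto_nhds_unique hr h2, trace, greenKernel, hl.limUnder_eq]

end PseudoDiffOp

/-! ### Splines -/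

theorem regular_apply (f : Sphere m → ℂ) (hf : Integrable f (surface m)) (φ : TestFun m) :
    regular f hf φ = ∫ r, f r * φ r ∂(surface m) := rfl

theorem regular_congr {f g : Sphere m → ℂ} (hf : Integrable f (surface m))
    (hg : Integrable g (surface m)) (h : f =ᵐ[surface m] g) : regular f hf = regular g hg := by
  ext φ
  rw [regular_apply, regular_apply]
  refine integral_congr_ae ?_
  filter_upwards [h] with r hr
  rw [hr]

theorem integrable_mul_testFun {f : Sphere m → ℂ} (hf : Integrable f (surface m))
    (φ : TestFun m) : Integrable (fun r => f r * φ r) (surface m) :=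
  hf.mul_bdd (c := ‖toContₗ φ‖) φ.continuous.aestronglyMeasurable
    (ae_of_all _ (toContₗ φ).norm_coe_le_norm)

theorem genFun_ext (hm : 1 ≤ m) {u v : GenFun m} (h : ∀ n, ∀ φ ∈ Harm m n, u φ = v φ) : u = v :=
  sub_eq_zero.mp (genFun_eq_zero hm (u - v) fun n φ hφ => by
    rw [_root_.sub_apply, h n φ hφ, sub_self])

/-- The pairing is bilinear, so the coefficients `⟨s|conj Y⟩` call for an expansion of `φ` in the
conjugated basis. It comes from conjugating the expansion of `conj φ`. -/
theorem HarmonicBasis.sum_integral_smul_conjugate (B : HarmonicBasis m) {n : ℕ} {φ : TestFun m}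
    (hφ : φ ∈ Harm m n) :
    ∑ k, (∫ r, B.Y n k r * φ r ∂(surface m)) • (B.Y n k).conjugate = φ := by
  ext r
  have h := congrArg (fun f : TestFun m => starRingEnd ℂ (f r))
    (B.component_of_mem (conjugate_mem hφ))
  simp only [component, TestFun.sum_apply, TestFun.smul_apply, conjugate_apply, map_sum, map_mul,
    l2inner_conj, Complex.conj_conj] at h
  rw [← h, TestFun.sum_apply]
  refine Finset.sum_congr rfl fun k _ => ?_
  simp [l2inner]

namespace PseudoDiffOp

variable {B : HarmonicBasis m} (D : PseudoDiffOp B)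

theorem IsSplineAdmissible.trace_isGreenFunction {D : PseudoDiffOp B} (hD : D.IsSplineAdmissible)
    (hm : 1 ≤ m) (s : Sphere m) :
    ∃ h : Integrable (D.trace s) (surface m), D.IsGreenFunction s (regular (D.trace s) h) := by
  obtain ⟨hconv, f, hf, hG⟩ := hD s
  have hae := D.ae_eq_trace hm hconv hf hG
  have hi := hf.congr hae
  refine ⟨hi, ?_⟩
  rwa [← regular_congr hf hi hae]

theorem regular_trace_of_mem (hm : 1 ≤ m) {s : Sphere m} {h : Integrable (D.trace s) (surface m)}
    (hG : D.IsGreenFunction s (regular (D.trace s) h)) {n : ℕ} {φ : TestFun m}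
    (hφ : φ ∈ Harm m n) : ∫ r, D.trace s r * φ r ∂(surface m) = D.coef n * φ s :=
  (hG φ).trans (D.pinv_of_mem hm hφ s)

theorem IsSpline.symbol_mul {D : PseudoDiffOp B} (hm : 1 ≤ m) {M : ℕ} {r : Fin M → Sphere m}
    {α : Fin M → ℂ} {u : GenFun m} (hu : D.IsSpline r α u) {n : ℕ} {φ : TestFun m}
    (hφ : φ ∈ Harm m n) : D.symbol n * u φ = ∑ i, α i * φ (r i) := by
  have h := LinearMap.congr_fun hu φ
  simp only [dualApply, LinearMap.comp_apply, ContinuousLinearMap.coe_coe,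
    D.toLin_of_mem hm hφ, map_smul, smul_eq_mul] at h
  rw [h]
  simp only [_root_.sum_apply, _root_.smul_apply, smul_eq_mul]
  rfl

theorem IsSpline.eq_regular {D : PseudoDiffOp B} (hD : D.IsSplineAdmissible) (hm : 1 ≤ m) {M : ℕ}
    {r : Fin M → Sphere m} {α : Fin M → ℂ} {s : GenFun m} (hs : D.IsSpline r α s) :
    ∃ hF : Integrable (fun x : Sphere m => (∑ i, α i * D.trace (r i) x) +
        ∑ n ∈ D.zeros, ∑ k, s (B.Y n k).conjugate * B.Y n k x) (surface m),
      s = regular _ hF := by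
  choose hi hG using hD.trace_isGreenFunction hm
  have h1 : ∀ i, Integrable (fun x => α i * D.trace (r i) x) (surface m) := fun i =>
    (hi (r i)).const_mul _
  have h2 : ∀ n k, Integrable (fun x => s (B.Y n k).conjugate * B.Y n k x) (surface m) :=
    fun n k => (integrable_of_continuous (B.Y n k).continuous).const_mul _
  have h3 : Integrable (fun x => ∑ i, α i * D.trace (r i) x) (surface m) :=
    integrable_finsetSum _ fun i _ => h1 i
  have h4 : Integrable (fun x => ∑ n ∈ D.zeros, ∑ k, s (B.Y n k).conjugate * B.Y n k x)
      (surface m) :=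
    integrable_finsetSum _ fun n _ => integrable_finsetSum _ fun k _ => h2 n k
  refine ⟨h3.add h4, genFun_ext hm fun n φ hφ => ?_⟩
  rw [regular_apply]
  simp only [add_mul]
  rw [integral_add (integrable_mul_testFun h3 φ) (integrable_mul_testFun h4 φ)]
  simp only [Finset.sum_mul]
  rw [integral_finsetSum _ fun i _ => integrable_mul_testFun (h1 i) φ,
    integral_finsetSum _ fun n _ => integrable_finsetSum _ fun k _ =>
      integrable_mul_testFun (h2 n k) φ]
  have h7 : ∀ n', ∫ x, ∑ k, s (B.Y n' k).conjugate * B.Y n' k x * φ x ∂(surface m) =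
      ∑ k, s (B.Y n' k).conjugate * ∫ x, B.Y n' k x * φ x ∂(surface m) := fun n' => by
    rw [integral_finsetSum _ fun k _ => integrable_mul_testFun (h2 n' k) φ]
    simp only [mul_assoc, integral_const_mul]
  simp only [h7]
  simp only [mul_assoc, integral_const_mul, D.regular_trace_of_mem hm (hG _) hφ]
  have hsym := hs.symbol_mul hm hφ
  have h5 : ∑ i, α i * ((D.coef n : ℂ) * φ (r i)) = D.coef n * (D.symbol n * s φ) := by
    rw [hsym, Finset.mul_sum]
    exact Finset.sum_congr rfl fun i _ => by ring
  have h6 : ∀ k ∈ D.zeros, k ≠ n →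
      ∑ j, s (B.Y k j).conjugate * ∫ x, B.Y k j x * φ x ∂(surface m) = 0 := fun k _ hk =>
    Finset.sum_eq_zero fun j _ => by
      rw [integral_mul_eq_zero_of_ne hm hk (B.mem k j) hφ, mul_zero]
  rw [h5]
  -- At a zero of the symbol the Green part vanishes and the harmonic terms of order `n` reproduce
  -- `s φ`. Elsewhere the harmonic terms vanish by orthogonality and `coef n` inverts the symbol.
  by_cases hn : n ∈ D.zeros
  · rw [Finset.sum_eq_single_of_mem n hn h6, D.mem_zeros.mp hn, Complex.ofReal_zero, zero_mul,
      mul_zero, zero_add]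
    conv_lhs => rw [← B.sum_integral_smul_conjugate hφ]
    rw [map_sum]
    refine Finset.sum_congr rfl fun k _ => ?_
    rw [map_smul, smul_eq_mul, mul_comm]
  · rw [Finset.sum_eq_zero fun k hk => h6 k hk fun h => hn (h ▸ hk), add_zero, D.coef_eq,
      ← mul_assoc, ← Complex.ofReal_mul, inv_mul_cancel₀ fun h => hn (D.mem_zeros.mpr h),
      Complex.ofReal_one, one_mul]

/-- With no zeros, `D†D = Id` on smooth functions, so the Green function at `r i` paired with `D φ`
returns `φ (r i)`. -/
theorem isSpline_trace (hm : 1 ≤ m) (hz : D.zeros = ∅) {M : ℕ} (r : Fin M → Sphere m) (i : Fin M)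
    {h : Integrable (D.trace (r i)) (surface m)}
    (hG : D.IsGreenFunction (r i) (regular (D.trace (r i)) h)) :
    D.IsSpline r (Pi.single i 1) (regular (D.trace (r i)) h) := by
  ext φ
  simp only [dualApply, LinearMap.comp_apply, ContinuousLinearMap.coe_coe]
  rw [hG, D.pinv_toLin hm hz]
  simp only [_root_.sum_apply, _root_.smul_apply, smul_eq_mul]
  rw [Finset.sum_eq_single i (fun j _ hj => by simp [hj]) (by simp)]
  rw [Pi.single_eq_same, one_mul]
  rfl

/-- The general term is `O(n^{-p + m - 1})`, summable exactly in this range; the bound is uniform in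
the point. -/
theorem norm_trace_le (hm : 1 ≤ m) (hp : (m : ℝ) < D.order) {s r : Sphere m}
    (hconv : ∃ l : ℝ,
      Tendsto (fun N => D.greenPartial N (inner ℝ (r : Ambient m) (s : Ambient m))) atTop (𝓝 l)) :
    ‖D.trace s r‖ ≤ ∑' n, |D.coef n| * (harmDim m n / area m) := by
  have hsum := B.summable_mul_harmDim hm D.coef_isBigO (by linarith)
  obtain ⟨l, hl⟩ := hconv
  have h1 : Tendsto (fun N => ∑ n ∈ Finset.range N, (D.coef n : ℂ) * B.kernel n s r) atTop
      (𝓝 (D.trace s r)) := by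
    rw [trace, greenKernel, hl.limUnder_eq]
    simp_rw [← D.greenPartial_eq hm]
    exact (Complex.continuous_ofReal.tendsto l).comp hl
  refine le_of_tendsto h1.norm (Eventually.of_forall fun N => ?_)
  have hnn : ∀ n, 0 ≤ |D.coef n| * (harmDim m n / area m) := fun n => by
    have := area_pos m
    positivity
  refine (norm_sum_le _ _).trans ((Finset.sum_le_sum fun n _ => ?_).trans
    (hsum.sum_le_tsum _ fun n _ => hnn n))
  rw [norm_mul, Complex.norm_real, Real.norm_eq_abs]
  exact mul_le_mul_of_nonneg_left (B.norm_kernel_le n s r) (abs_nonneg _)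

end PseudoDiffOp

end Spherical

end

/-! ### The representation theorem and the spline space -/

theorem proposition5 (m : ℕ) (hm : 1 ≤ m) (B : Spherical.HarmonicBasis m)
    (D : Spherical.PseudoDiffOp B) (hD : D.IsSplineAdmissible)
    (M : ℕ) (r : Fin M → Spherical.Sphere m) :
    (∀ (s : Spherical.GenFun m) (α : Fin M → ℂ), D.IsSpline r α s →
      ∃ hF : Integrable (fun x : Spherical.Sphere m =>
          (∑ i, α i * D.trace (r i) x) +
            ∑ n ∈ D.zeros, ∑ k, s (B.Y n k).conjugate * B.Y n k x) (Spherical.surface m),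
        s = Spherical.regular _ hF) ∧
    (D.zeros = ∅ →
      (∀ (s : Spherical.GenFun m) (α : Fin M → ℂ), D.IsSpline r α s →
        ∃ hF : Integrable (fun x : Spherical.Sphere m => ∑ i, α i * D.trace (r i) x)
            (Spherical.surface m),
          s = Spherical.regular _ hF) ∧
      (∃ hψ : ∀ i, Integrable (D.trace (r i)) (Spherical.surface m),
        D.splineSpace r =
          Submodule.span ℂ (Set.range fun i => Spherical.regular (D.trace (r i)) (hψ i))) ∧
      ((m : ℝ) < D.order → ∀ i, MemLp (D.trace (r i)) 2 (Spherical.surface m))) := by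
  refine ⟨fun s α hs => hs.eq_regular hD hm, fun hz => ?_⟩
  choose hi hG using fun i => hD.trace_isGreenFunction hm (r i)
  have hsum : ∀ α : Fin M → ℂ, Integrable (fun x => ∑ i, α i * D.trace (r i) x)
      (Spherical.surface m) := fun α => integrable_finsetSum _ fun i _ => (hi i).const_mul _
  have hspline : ∀ (s : Spherical.GenFun m) (α : Fin M → ℂ), D.IsSpline r α s →
      s = Spherical.regular _ (hsum α) := by
    intro s α hs
    obtain ⟨hF, h⟩ := hs.eq_regular hD hm
    refine h.trans (Spherical.regular_congr _ _ (ae_of_all _ fun x => ?_))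
    simp [hz]
  refine ⟨fun s α hs => ⟨hsum α, hspline s α hs⟩, ⟨hi, le_antisymm ?_ ?_⟩, fun hp i => ?_⟩
  · rintro s ⟨α, hs⟩
    have e : s = ∑ i, α i • Spherical.regular (D.trace (r i)) (hi i) := by
      rw [hspline s α hs]
      ext φ
      simp only [_root_.sum_apply, _root_.smul_apply, smul_eq_mul, Spherical.regular_apply,
        Finset.sum_mul]
      rw [integral_finsetSum _ fun i _ =>
        Spherical.integrable_mul_testFun ((hi i).const_mul (α i)) φ]
      simp only [mul_assoc, integral_const_mul]
    rw [e]
    exact Submodule.sum_mem _ fun i _ =>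
      Submodule.smul_mem _ _ (Submodule.subset_span ⟨i, rfl⟩)
  · rw [Submodule.span_le]
    rintro _ ⟨i, rfl⟩
    exact ⟨Pi.single i 1, D.isSpline_trace hm hz r i (hG i)⟩
  -- Bounded measurable functions on a finite measure space are square integrable.
  · exact MemLp.of_bound (hi i).aestronglyMeasurable _
      (ae_of_all _ fun x => D.norm_trace_le hm hp ((hD (r i)).1 x))
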